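/- Let $n,m\ge 1$. There is a constant $C>0$, depending only on $n$ and $m$, such that the following holds. Let $\Omega\subset\mathbb{R}^n$ be a bounded domain, let $Q:\Omega\to\mathbb{R}$ be Lebesgue measurable with $Q_{min}\le Q\le Q_{max}$ a.e. in $\Omega$ for constants $Q_{max}\ge Q_{min}>0$, and let $\mathbf{g}\in H^1(\Omega;\mathbb{R}^m)$ with $g_i\ge 0$ a.e. in $\Omega$ for $i=1,\dots,m$. Let $$\mathcal{A}=\{\mathbf{v}\in H^1(\Omega;\mathbb{R}^m) : \mathbf{v}-\mathbf{g}\in H^1_0(\Omega;\mathbb{R}^m),\ v_i\ge 0 \text{ a.e. in } \Omega \text{ for } i=1,\dots,m\},$$ $$J(\mathbf{v})=\int_\Omega\bigl(|\nabla\mathbf{v}|^2+Q^2\chi_{\{|\mathbf{v}|>0\}}\bigr)\,dx,\qquad |\nabla \mathbf{v}|^2=\sum_{i=1}^m|\nabla v_i|^2,$$ $$d(\mathbf{u},\mathbf{v})=\|\mathbf{u}-\mathbf{v}\|_{H^1(\Omega;\mathbb{R}^m)}+\|\chi_{\{|\mathbf{u}|>0\}}-\chi_{\{|\mathbf{v}|>0\}}\|_{L^1(\Omega)}.$$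 A function $\mathbf{u}\in\mathcal{A}$ is an absolute minimizer if $J(\mathbf{u})\le J(\mathbf{v})$ for all $\mathbf{v}\in\mathcal{A}$, and a local minimizer if there is $\epsilon>0$ such that $J(\mathbf{u})\le J(\mathbf{v})$ for all $\mathbf{v}\in\mathcal{A}$ with $d(\mathbf{u},\mathbf{v})<\epsilon$. If $\mathbf{u}$ is an absolute or a local minimizer, then the limit $\lim_{\rho\to0^+}\frac{1}{|B_\rho(x)|}\int_{B_\rho(x)}\mathbf{u}\,dy$ exists for every $x\in\Omega$ and equals $\mathbf{u}(x)$ for a.e. $x\in\Omega$; below, $\mathbf{u}(x)$ denotes this limit for every $x\in\Omega$. Moreover: 1. If $\mathbf{u}$ is an absolute minimizer, then for every ball $B_r(x)\subset\Omega$ with $\mathbf{u}(x)=0$, $$[\mathbf{u}]_{C^{0,1}(B_{r/3}(x))}:=\sup_{y,z\in B_{r/3}(x),\,y\neq z}\frac{|\mathbf{u}(y)-\mathbf{u}(z)|}{|y-z|}\le C\,Q_{max}.$$ 2. If $\mathbf{u}$ is a local minimizer, then there is $r_0>0$ (which may depend on $\Omega$, $Q$, $\mathbf{g}$ and $\mathbf{u}$)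 such that the same estimate holds, with the same $C$, for every ball $B_r(x)\subset\Omega$ with $r\le r_0$ and $\mathbf{u}(x)=0$. -/

import Mathlib

open MeasureTheory Set Filter
open scoped Topology ENNReal ContDiff

noncomputable section

namespace BernoulliSystem

/-- The Euclidean space `ℝ^n`. -/
abbrev E (n : ℕ) : Type := EuclideanSpace ℝ (Fin n)

variable {n m : ℕ}

/-- `φ ∈ C_c^∞(Ω)`. -/
def IsTestFunction (Ω : Set (E n)) (φ : E n → ℝ) : Prop :=
  ContDiff ℝ ∞ φ ∧ HasCompactSupport φ ∧ tsupport φ ⊆ Ω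

/-- `G` is a distributional (weak) gradient of the scalar function `f` in `Ω`. -/
def IsWeakGradient (Ω : Set (E n)) (f : E n → ℝ) (G : E n → E n) : Prop :=
  LocallyIntegrableOn f Ω ∧ LocallyIntegrableOn G Ω ∧
    ∀ φ : E n → ℝ, IsTestFunction Ω φ →
      ∫ x in Ω, f x • gradient φ x = -∫ x in Ω, φ x • G x

/-- On an open set the weak gradient is unique up to null sets. -/
theorem IsWeakGradient.ae_eq {Ω : Set (E n)} (hΩ : IsOpen Ω) {f : E n → ℝ} {G H : E n → E n}
    (hG : IsWeakGradient Ω f G) (hH : IsWeakGradient Ω f H) :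
    G =ᵐ[volume.restrict Ω] H := by
  have key : ∀ᵐ x ∂(volume : Measure (E n)), x ∈ Ω → (G - H) x = 0 := by
    refine hΩ.ae_eq_zero_of_integral_contDiff_smul_eq_zero (hG.2.1.sub hH.2.1) ?_
    intro φ hφ hc hs
    have int : ∀ K : E n → E n, LocallyIntegrableOn K Ω →
        Integrable (fun x => φ x • K x) volume := by
      intro K hK
      have h1 : IntegrableOn K (tsupport φ) volume :=
        hK.integrableOn_compact_subset hs hc
      have h2 : IntegrableOn (fun x => φ x • K x) (tsupport φ) volume :=
        h1.continuousOn_smul hφ.continuous.continuousOn hc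
      refine (integrableOn_iff_integrable_of_support_subset ?_).1 h2
      intro x hx
      refine subset_tsupport φ ?_
      intro h0
      exact hx (by simp [h0])
    have hset : ∀ K : E n → E n, ∫ x in Ω, φ x • K x = ∫ x, φ x • K x := by
      intro K
      refine setIntegral_eq_integral_of_forall_compl_eq_zero ?_
      intro x hx
      have : φ x = 0 := image_eq_zero_of_notMem_tsupport (fun h => hx (hs h))
      simp [this]
    have e1 := hG.2.2 φ ⟨hφ, hc, hs⟩
    have e2 := hH.2.2 φ ⟨hφ, hc, hs⟩
    rw [hset] at e1 e2
    have e3 : ∫ x, φ x • G x = ∫ x, φ x • H x := neg_injective (e1.symm.trans e2)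
    simp only [Pi.sub_apply, smul_sub]
    rw [integral_sub (int G hG.2.1) (int H hH.2.1), e3, sub_self]
  rw [Filter.EventuallyEq, ae_restrict_iff' hΩ.measurableSet]
  filter_upwards [key] with x hx hxΩ
  exact sub_eq_zero.1 (hx hxΩ)

open Classical in
/-- The weak gradient `∇f` of `f` in `Ω` (a chosen version; it is `0` if there is none). -/
def weakGradient (Ω : Set (E n)) (f : E n → ℝ) : E n → E n :=
  if h : ∃ G, IsWeakGradient Ω f G then h.choose else 0

/-- `f ∈ H¹(Ω)`. -/
def MemH1 (Ω : Set (E n)) (f : E n → ℝ) : Prop :=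
  MemLp f 2 (volume.restrict Ω) ∧
    ∃ G, IsWeakGradient Ω f G ∧ MemLp G 2 (volume.restrict Ω)

/-- `‖f‖_{H¹(Ω)}²`, for `f ∈ H¹(Ω)`. -/
def h1NormSq (Ω : Set (E n)) (f : E n → ℝ) : ℝ :=
  ∫ x in Ω, (f x ^ 2 + ‖weakGradient Ω f x‖ ^ 2)

/-- `f ∈ H¹₀(Ω)`, the closure of `C_c^∞(Ω)` in `H¹(Ω)`. -/
def MemH10 (Ω : Set (E n)) (f : E n → ℝ) : Prop :=
  MemH1 Ω f ∧ ∀ ε : ℝ, 0 < ε → ∃ φ : E n → ℝ, IsTestFunction Ω φ ∧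
    Real.sqrt (h1NormSq Ω (fun x => f x - φ x)) < ε

/-- `u ∈ H¹(Ω; ℝ^m)`. -/
def MemH1Vec (Ω : Set (E n)) (u : E n → E m) : Prop :=
  ∀ i : Fin m, MemH1 Ω (fun x => u x i)

/-- `‖u‖_{H¹(Ω; ℝ^m)}`, for `u ∈ H¹(Ω; ℝ^m)`. -/
def h1Norm (Ω : Set (E n)) (u : E n → E m) : ℝ :=
  Real.sqrt (∑ i : Fin m, h1NormSq Ω (fun x => u x i))

/-- The characteristic function of `{|u| > 0}`. -/
def posChar (u : E n → E m) : E n → ℝ :=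
  Set.indicator {x | 0 < ‖u x‖} (fun _ => 1)

/-- `J(u) = ∫_Ω (|∇u|² + Q² χ_{|u| > 0})`, where `|∇u|² = |∇u₁|² + ⋯ + |∇u_m|²`. -/
def J (Ω : Set (E n)) (Q : E n → ℝ) (u : E n → E m) : ℝ :=
  ∫ x in Ω, ((∑ i : Fin m, ‖weakGradient Ω (fun y => u y i) x‖ ^ 2) + Q x ^ 2 * posChar u x)

/-- The distance `d(u, v) = ‖u - v‖_{H¹} + ‖χ_{|u| > 0} - χ_{|v| > 0}‖_{L¹}`. -/
def d (Ω : Set (E n)) (u v : E n → E m) : ℝ :=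
  h1Norm Ω (fun x => u x - v x) + ∫ x in Ω, |posChar u x - posChar v x|

/-- The admissible class: `v ∈ H¹(Ω; ℝ^m)`, `v = g` on `∂Ω` (that is, `v - g ∈ H¹₀`), and
`v_i ≥ 0` a.e. in `Ω`. -/
def Admissible (Ω : Set (E n)) (g v : E n → E m) : Prop :=
  MemH1Vec Ω v ∧ (∀ i : Fin m, MemH10 Ω (fun x => v x i - g x i)) ∧
    ∀ i : Fin m, ∀ᵐ x ∂volume.restrict Ω, 0 ≤ v x i

/-- Absolute minimizers of `J` with boundary data `g`. -/
def IsAbsoluteMinimizer (Ω : Set (E n)) (Q : E n → ℝ) (g u : E n → E m) : Prop :=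
  Admissible Ω g u ∧ ∀ v : E n → E m, Admissible Ω g v → J Ω Q u ≤ J Ω Q v

/-- Local minimizers of `J` with boundary data `g`. -/
def IsLocalMinimizer (Ω : Set (E n)) (Q : E n → ℝ) (g u : E n → E m) : Prop :=
  Admissible Ω g u ∧ ∃ ε : ℝ, 0 < ε ∧
    ∀ v : E n → E m, Admissible Ω g v → d Ω u v < ε → J Ω Q u ≤ J Ω Q v

/-- `w` is the version of `u` that is given at every point `x` of `Ω` by the limit of the means
of `u` over the balls `B_ρ(x)` as `ρ → 0`. -/
def IsPreciseVersion (Ω : Set (E n)) (u w : E n → E m) : Prop :=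
  w =ᵐ[volume.restrict Ω] u ∧
    ∀ x ∈ Ω, Tendsto (fun ρ : ℝ => ⨍ y in Metric.ball x ρ, u y) (𝓝[>] 0) (𝓝 (w x))

/-- The seminorm `[w]_{C^{0,1}(S)} = sup |w y - w z| / |y - z|` over `y ≠ z` in `S`, with values
in `[0, ∞]` (in `ℝ≥0∞` one has `0 / 0 = 0`, so that the pairs `y = z` do not contribute). -/
def lipSeminorm (w : E n → E m) (S : Set (E n)) : ℝ≥0∞ :=
  ⨆ y ∈ S, ⨆ z ∈ S, edist (w y) (w z) / edist y z

end BernoulliSystem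

end

open MeasureTheory Set Filter
open scoped Topology ENNReal ContDiff

noncomputable section

namespace BernoulliSystem

variable {n m : ℕ}

/-! ### Classical gradients of products, compositions and compactly supported functions -/

section GradientCalculus

/-! Three comparisons carry the estimate. Write `ζ_r` for a smooth radial bump rescaled to `B_r(x)`.

Lowering `u_i` by a small multiple of `φ u_i / √(u_i² + δ²)` keeps the signs and the positivity set,
so `√(u_i² + δ²)`, and in the limit `δ → 0` also `u_i`, is subharmonic. Raising `u_i` where `u` does
not vanish creates no new positivity, so `u_i` is also superharmonic there, hence harmonic. Raising
`u_i` by `Qmax r ζ_r` in any ball costs at most a multiple of `Qmax² r^n` in the remaining energy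
terms, which bounds the Laplacian of `u_i` tested against `ζ_r` by a multiple of `Qmax r^(n-1)`.

These facts are read off from smooth radial means. If `∇ζ(y) = -η(y) y`, the mean of `f` with weight
`η((z - x)/r)` has an `r`-derivative equal to a positive multiple of `-∫ ∇f · ∇ζ_r`. Thus the means
of `u_i` are nondecreasing in `r`, with slope at most `C Qmax`, and constant where `u ≠ 0`
(`IsMinimizerWithin.monotoneOn_radialMean`, `derivative_bound`, `antitoneOn_radialMean`). Their
limits as `r → 0` exist everywhere and define a continuous representative.

At a zero of `u` the means are at most `C Qmax r`, and the sub-mean value property turns this into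
`u_i ≤ C Qmax dist(·, z)` for every nearby zero `z`. Two points whose separation is comparable to
the distance to the zero set, or larger, are handled by this growth alone. Otherwise `u` is harmonic
on a comparatively large ball around them, and moving the kernel in the mean value formula gives the
bound (`abs_sub_le_of_ball`).

Minimality is used only for competitors supported in `B_r(x)`, whose distance to `u` is at most
`competitorDistance`. An absolute minimizer admits every radius, a local one every sufficiently
small radius, with the same constant. -/

theorem gradient_mul {f g : E n → ℝ} {x : E n} (hf : DifferentiableAt ℝ f x)
    (hg : DifferentiableAt ℝ g x) :
    gradient (fun y => f y * g y) x = f x • gradient g x + g x • gradient f x := by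
  simp only [gradient]
  rw [fderiv_fun_mul hf hg]
  simp

theorem gradient_comp {f : E n → ℝ} {G : ℝ → ℝ} {G' : ℝ} {x : E n} (hf : DifferentiableAt ℝ f x)
    (hG : HasDerivAt G G' (f x)) :
    gradient (fun y => G (f y)) x = G' • gradient f x := by
  have h := hG.comp_hasFDerivAt x hf.hasFDerivAt
  have h2 : fderiv ℝ (fun y => G (f y)) x = G' • fderiv ℝ f x := h.fderiv
  simp only [gradient]
  rw [h2]
  simp

theorem continuous_gradient {f : E n → ℝ} (hf : ContDiff ℝ ∞ f) : Continuous (gradient f) := by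
  have h : Continuous (fderiv ℝ f) := hf.continuous_fderiv (by simp)
  exact (InnerProductSpace.toDual ℝ (E n)).symm.continuous.comp h

theorem tsupport_gradient_subset (f : E n → ℝ) : tsupport (gradient f) ⊆ tsupport f := by
  refine closure_minimal ?_ (isClosed_tsupport f)
  intro x hx
  refine tsupport_fderiv_subset ℝ (subset_tsupport _ ?_)
  intro h0
  apply hx
  simp [gradient, h0]

end GradientCalculus

/-! ### Test functions and integrability of products with them -/

section TestFunctions

variable {Ω : Set (E n)} {φ : E n → ℝ}

theorem IsTestFunction.differentiable (h : IsTestFunction Ω φ) : Differentiable ℝ φ :=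
  h.1.differentiable (by simp)

theorem IsTestFunction.eq_zero (h : IsTestFunction Ω φ) {x : E n} (hx : x ∉ Ω) : φ x = 0 :=
  image_eq_zero_of_notMem_tsupport fun h' => hx (h.2.2 h')

theorem IsTestFunction.gradient_eq_zero (h : IsTestFunction Ω φ) {x : E n} (hx : x ∉ Ω) :
    gradient φ x = 0 :=
  image_eq_zero_of_notMem_tsupport fun h' => hx (h.2.2 (tsupport_gradient_subset φ h'))

theorem IsTestFunction.hasCompactSupport_gradient (h : IsTestFunction Ω φ) :
    HasCompactSupport (gradient φ) :=
  h.2.1.of_isClosed_subset (isClosed_tsupport _) (tsupport_gradient_subset φ)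

theorem IsTestFunction.mul (h : IsTestFunction Ω φ) {ψ : E n → ℝ} (hψ : ContDiff ℝ ∞ ψ) :
    IsTestFunction Ω (fun x => φ x * ψ x) := by
  refine ⟨h.1.mul hψ, h.2.1.mul_right, ?_⟩
  exact (closure_mono (Function.support_mul_subset_left φ ψ)).trans h.2.2

theorem IsTestFunction.const_mul (h : IsTestFunction Ω φ) (c : ℝ) :
    IsTestFunction Ω (fun x => c * φ x) := by
  have := h.mul (ψ := fun _ => c) contDiff_const
  simpa [mul_comm] using this

theorem IsTestFunction.add (h : IsTestFunction Ω φ) {ψ : E n → ℝ} (hψ : IsTestFunction Ω ψ) :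
    IsTestFunction Ω (fun x => φ x + ψ x) := by
  refine ⟨h.1.add hψ.1, h.2.1.add hψ.2.1, ?_⟩
  exact (tsupport_add φ ψ).trans (union_subset h.2.2 hψ.2.2)

theorem IsTestFunction.mono (h : IsTestFunction Ω φ) {U : Set (E n)} (hU : Ω ⊆ U) :
    IsTestFunction U φ :=
  ⟨h.1, h.2.1, h.2.2.trans hU⟩

variable {V : Type*} [NormedAddCommGroup V] [NormedSpace ℝ V]

/-- A locally integrable function times a continuous function with compact support in `Ω`. -/
theorem integrable_smul_of_support {g : E n → ℝ} {K : E n → V} (hg : Continuous g)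
    (hc : HasCompactSupport g) (hs : tsupport g ⊆ Ω) (hK : LocallyIntegrableOn K Ω) :
    Integrable (fun x => g x • K x) := by
  have h1 : IntegrableOn K (tsupport g) := hK.integrableOn_compact_subset hs hc
  have h2 : IntegrableOn (fun x => g x • K x) (tsupport g) :=
    h1.continuousOn_smul hg.continuousOn hc
  refine (integrableOn_iff_integrable_of_support_subset ?_).1 h2
  intro x hx
  refine subset_tsupport g ?_
  intro h0
  exact hx (by simp [h0])

theorem integrable_smul_of_support' {g : E n → V} {f : E n → ℝ} (hg : Continuous g)
    (hc : HasCompactSupport g) (hs : tsupport g ⊆ Ω) (hf : LocallyIntegrableOn f Ω) :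
    Integrable (fun x => f x • g x) := by
  have h1 : IntegrableOn f (tsupport g) := hf.integrableOn_compact_subset hs hc
  have h2 : IntegrableOn (fun x => f x • g x) (tsupport g) :=
    h1.smul_continuousOn hg.continuousOn hc
  refine (integrableOn_iff_integrable_of_support_subset ?_).1 h2
  intro x hx
  refine subset_tsupport g ?_
  intro h0
  exact hx (by simp [h0])

theorem IsTestFunction.integrable_smul (h : IsTestFunction Ω φ) {K : E n → V}
    (hK : LocallyIntegrableOn K Ω) : Integrable (fun x => φ x • K x) :=
  integrable_smul_of_support h.1.continuous h.2.1 h.2.2 hK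

theorem IsTestFunction.integrable_smul_gradient (h : IsTestFunction Ω φ) {f : E n → ℝ}
    (hf : LocallyIntegrableOn f Ω) : Integrable (fun x => f x • gradient φ x) :=
  integrable_smul_of_support' (continuous_gradient h.1) h.hasCompactSupport_gradient
    ((tsupport_gradient_subset φ).trans h.2.2) hf

theorem IsTestFunction.setIntegral_smul (h : IsTestFunction Ω φ) (K : E n → V) :
    ∫ x in Ω, φ x • K x = ∫ x, φ x • K x :=
  setIntegral_eq_integral_of_forall_compl_eq_zero fun x hx => by simp [h.eq_zero hx]

theorem IsTestFunction.setIntegral_smul_gradient (h : IsTestFunction Ω φ) (f : E n → ℝ) :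
    ∫ x in Ω, f x • gradient φ x = ∫ x, f x • gradient φ x :=
  setIntegral_eq_integral_of_forall_compl_eq_zero fun x hx => by simp [h.gradient_eq_zero hx]

end TestFunctions

/-! ### Algebra of weak gradients -/

section WeakGradient

variable {Ω : Set (E n)} {f g : E n → ℝ} {F G : E n → E n}

theorem IsWeakGradient.integral_eq (h : IsWeakGradient Ω f F) {φ : E n → ℝ}
    (hφ : IsTestFunction Ω φ) : ∫ x, f x • gradient φ x = -∫ x, φ x • F x := by
  rw [← hφ.setIntegral_smul_gradient, ← hφ.setIntegral_smul]
  exact h.2.2 φ hφ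

theorem isWeakGradient_of_integral (hf : LocallyIntegrableOn f Ω) (hF : LocallyIntegrableOn F Ω)
    (h : ∀ φ, IsTestFunction Ω φ → ∫ x, f x • gradient φ x = -∫ x, φ x • F x) :
    IsWeakGradient Ω f F := by
  refine ⟨hf, hF, fun φ hφ => ?_⟩
  rw [hφ.setIntegral_smul_gradient, hφ.setIntegral_smul]
  exact h φ hφ

theorem IsWeakGradient.add (hf : IsWeakGradient Ω f F) (hg : IsWeakGradient Ω g G) :
    IsWeakGradient Ω (fun x => f x + g x) (fun x => F x + G x) := by
  refine isWeakGradient_of_integral (hf.1.add hg.1) (hf.2.1.add hg.2.1) fun φ hφ => ?_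
  simp only [add_smul, smul_add]
  rw [integral_add (hφ.integrable_smul_gradient hf.1) (hφ.integrable_smul_gradient hg.1),
    integral_add (hφ.integrable_smul hf.2.1) (hφ.integrable_smul hg.2.1), hf.integral_eq hφ,
    hg.integral_eq hφ, neg_add]

theorem IsWeakGradient.const_mul (hf : IsWeakGradient Ω f F) (c : ℝ) :
    IsWeakGradient Ω (fun x => c * f x) (fun x => c • F x) := by
  refine isWeakGradient_of_integral (hf.1.smul c) (hf.2.1.smul c) fun φ hφ => ?_
  have e1 : ∀ x, (c * f x) • gradient φ x = c • (f x • gradient φ x) := fun x => by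
    rw [smul_smul]
  have e2 : ∀ x, φ x • c • F x = c • (φ x • F x) := fun x => smul_comm _ _ _
  simp only [e1, e2, integral_smul, hf.integral_eq hφ, smul_neg]

theorem IsWeakGradient.sub (hf : IsWeakGradient Ω f F) (hg : IsWeakGradient Ω g G) :
    IsWeakGradient Ω (fun x => f x - g x) (fun x => F x - G x) := by
  have := hf.add (hg.const_mul (-1))
  simpa [sub_eq_add_neg] using this

theorem integral_mul_gradient_of_contDiff {ψ φ : E n → ℝ} (hψ : ContDiff ℝ ∞ ψ)
    (hφ : ContDiff ℝ ∞ φ) (hc : HasCompactSupport φ) :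
    ∫ x, ψ x • gradient φ x = -∫ x, φ x • gradient ψ x := by
  have hT : IsTestFunction univ φ := ⟨hφ, hc, subset_univ _⟩
  have i1 : Integrable (fun x => ψ x • gradient φ x) :=
    hT.integrable_smul_gradient (hψ.continuous.locallyIntegrable.locallyIntegrableOn _)
  have i2 : Integrable (fun x => φ x • gradient ψ x) :=
    hT.integrable_smul ((continuous_gradient hψ).locallyIntegrable.locallyIntegrableOn _)
  have i3 : Integrable (fun x => φ x • ψ x) :=
    hT.integrable_smul (hψ.continuous.locallyIntegrable.locallyIntegrableOn _)
  -- Pairing with an arbitrary `v` reduces the vector identity to scalar integration by parts along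
  -- `v`.
  refine ext_inner_right ℝ fun v => ?_
  rw [inner_neg_left, real_inner_comm, ← integral_inner i1, real_inner_comm,
    ← integral_inner i2]
  simp only [real_inner_smul_right, inner_gradient_right, conj_trivial]
  have key := integral_mul_fderiv_eq_neg_fderiv_mul_of_integrable (μ := (volume : Measure (E n)))
    (f := ψ) (g := φ) (v := v) ?_ ?_ ?_ (fun x _ => hψ.differentiable (by simp) x)
    (fun x _ => hφ.differentiable (by simp) x)
  · rw [key]
    simp only [mul_comm]
  · have := i2.const_inner (𝕜 := ℝ) v
    simpa [real_inner_smul_right, inner_gradient_right, mul_comm] using this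
  · have := i1.const_inner (𝕜 := ℝ) v
    simpa [real_inner_smul_right, inner_gradient_right, mul_comm] using this
  · simpa [mul_comm] using i3

theorem isWeakGradient_of_contDiff {ψ : E n → ℝ} (hψ : ContDiff ℝ ∞ ψ) :
    IsWeakGradient Ω ψ (gradient ψ) :=
  isWeakGradient_of_integral (hψ.continuous.locallyIntegrable.locallyIntegrableOn _)
    ((continuous_gradient hψ).locallyIntegrable.locallyIntegrableOn _)
    fun _ hφ => integral_mul_gradient_of_contDiff hψ hφ.1 hφ.2.1

theorem IsWeakGradient.mul_contDiff (hΩ : IsOpen Ω) (hf : IsWeakGradient Ω f F) {χ : E n → ℝ}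
    (hχ : ContDiff ℝ ∞ χ) :
    IsWeakGradient Ω (fun x => χ x * f x) (fun x => χ x • F x + f x • gradient χ x) := by
  have l1 : LocallyIntegrableOn (fun x => χ x • F x) Ω :=
    hf.2.1.continuousOn_smul hΩ.isLocallyClosed hχ.continuous.continuousOn
  have l2 : LocallyIntegrableOn (fun x => f x • gradient χ x) Ω :=
    hf.1.smul_continuousOn hΩ.isLocallyClosed (continuous_gradient hχ).continuousOn
  refine isWeakGradient_of_integral
    (hf.1.continuousOn_smul hΩ.isLocallyClosed hχ.continuous.continuousOn) (l1.add l2)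
    fun φ hφ => ?_
  have hT := hφ.mul hχ
  have h := hf.integral_eq hT
  have e1 : ∀ x, f x • gradient (fun y => φ y * χ y) x
      = φ x • (f x • gradient χ x) + (χ x * f x) • gradient φ x := fun x => by
    rw [gradient_mul (hφ.differentiable x) (hχ.differentiable (by simp) x), smul_add, smul_smul,
      smul_smul, smul_smul, mul_comm (f x), mul_comm (f x)]
  have i1 := hφ.integrable_smul l2
  have i2 : Integrable (fun x => (χ x * f x) • gradient φ x) := hφ.integrable_smul_gradient
    (hf.1.continuousOn_smul hΩ.isLocallyClosed hχ.continuous.continuousOn)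
  have i3 := hφ.integrable_smul l1
  simp only [e1] at h
  rw [integral_add i1 i2] at h
  simp only [smul_add]
  rw [integral_add i3 i1, eq_sub_of_add_eq' h]
  simp only [mul_smul]
  abel

theorem IsWeakGradient.mono (hf : IsWeakGradient Ω f F) {U : Set (E n)} (hU : U ⊆ Ω) :
    IsWeakGradient U f F :=
  isWeakGradient_of_integral (hf.1.mono_set hU) (hf.2.1.mono_set hU)
    fun _ hφ => hf.integral_eq (hφ.mono hU)

theorem isWeakGradient_weakGradient (hf : IsWeakGradient Ω f F) :
    IsWeakGradient Ω f (weakGradient Ω f) := by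
  have h : ∃ G, IsWeakGradient Ω f G := ⟨F, hf⟩
  rw [weakGradient, dif_pos h]
  exact h.choose_spec

theorem IsWeakGradient.weakGradient_ae_eq (hΩ : IsOpen Ω) (hf : IsWeakGradient Ω f F) :
    weakGradient Ω f =ᵐ[volume.restrict Ω] F :=
  (isWeakGradient_weakGradient hf).ae_eq hΩ hf

theorem MemH1.isWeakGradient (hf : MemH1 Ω f) : IsWeakGradient Ω f (weakGradient Ω f) := by
  obtain ⟨_, G, hG, _⟩ := hf
  exact isWeakGradient_weakGradient hG

theorem MemH1.memLp_weakGradient (hΩ : IsOpen Ω) (hf : MemH1 Ω f) :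
    MemLp (weakGradient Ω f) 2 (volume.restrict Ω) := by
  obtain ⟨_, G, hG, h2⟩ := hf
  exact h2.ae_eq (hG.weakGradient_ae_eq hΩ).symm

theorem IsWeakGradient.h1NormSq_eq (hΩ : IsOpen Ω) (hf : IsWeakGradient Ω f F) :
    h1NormSq Ω f = ∫ x in Ω, (f x ^ 2 + ‖F x‖ ^ 2) := by
  refine integral_congr_ae ?_
  filter_upwards [hf.weakGradient_ae_eq hΩ] with x hx
  rw [hx]

end WeakGradient

/-! ### Mollification in `L²` -/

section Mollification

variable {V : Type*} [NormedAddCommGroup V]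

theorem tendsto_eLpNorm_translate_sub {F : E n → V} (hF : MemLp F 2) :
    Tendsto (fun t => eLpNorm (fun x => F (x - t) - F x) 2 volume) (𝓝 0) (𝓝 0) := by
  have : Fact ((1 : ℝ≥0∞) ≤ 2) := ⟨by norm_num⟩
  -- Currying subtraction gives a continuous family of measure preserving maps. Composition of a
  -- fixed `L²` function with such a family is continuous into `L²`.
  let c : C(E n × E n, E n) := ⟨fun p => p.2 - p.1, by fun_prop⟩
  let τ : E n → C(E n, E n) := c.curry
  have hτ : Continuous τ := c.curry.continuous
  have hmp : ∀ t, MeasurePreserving (τ t) (volume : Measure (E n)) volume := fun t =>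
    measurePreserving_sub_right volume t
  have h := (continuous_const (y := hF.toLp F)).compMeasurePreservingLp (Z := E n) hτ hmp
    ENNReal.ofNat_ne_top
  have h0 := h.tendsto 0
  simp only [Lp.toLp_compMeasurePreserving hF] at h0
  rw [Lp.tendsto_Lp_iff_tendsto_eLpNorm''] at h0
  have e : (F ∘ τ 0) = F := by
    ext x
    simp [τ, c]
  simp only [e] at h0
  exact h0

/-- Jensen's inequality: `ρ dx` is a probability measure, so the `L¹` norm is at most the `L²` norm.
-/
theorem sq_lintegral_mul_le {ρ h : E n → ℝ≥0∞} (hρ : Measurable ρ) (h1 : ∫⁻ x, ρ x = 1)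
    (hh : AEMeasurable h) : (∫⁻ x, ρ x * h x) ^ 2 ≤ ∫⁻ x, ρ x * h x ^ 2 := by
  set ν : Measure (E n) := volume.withDensity ρ with hν
  have hac : ν ≪ volume := withDensity_absolutelyContinuous _ _
  have hp : IsProbabilityMeasure ν := ⟨by rw [hν, withDensity_apply _ MeasurableSet.univ]; simpa⟩
  have hh' : AEMeasurable h ν := hh.mono_ac hac
  have e1 : ∫⁻ x, ρ x * h x = ∫⁻ x, h x ∂ν := by
    rw [hν, lintegral_withDensity_eq_lintegral_mul₀ hρ.aemeasurable hh]
    rfl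
  have e2 : ∫⁻ x, ρ x * h x ^ 2 = ∫⁻ x, h x ^ 2 ∂ν := by
    rw [hν, lintegral_withDensity_eq_lintegral_mul₀ hρ.aemeasurable (hh.pow_const 2)]
    rfl
  rw [e1, e2]
  have key := eLpNorm_le_eLpNorm_of_exponent_le (p := 1) (q := 2) (μ := ν) (f := h)
    (by norm_num) hh'.aestronglyMeasurable
  rw [eLpNorm_one_eq_lintegral_enorm] at key
  have e3 : eLpNorm h 2 ν ^ 2 = ∫⁻ x, h x ^ 2 ∂ν := by
    have := eLpNorm_nnreal_pow_eq_lintegral (f := h) (p := 2) (μ := ν) (by norm_num)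
    simpa using this
  rw [← e3]
  exact pow_le_pow_left' (by simpa using key) 2

theorem eLpNorm_two_sq {α : Type*} [MeasurableSpace α] {μ : Measure α} (F : α → V) :
    eLpNorm F 2 μ ^ 2 = ∫⁻ x, ‖F x‖ₑ ^ 2 ∂μ := by
  have := eLpNorm_nnreal_pow_eq_lintegral (f := F) (p := 2) (μ := μ) (by norm_num)
  simpa using this

variable [NormedSpace ℝ V] [CompleteSpace V]

/-- The error is an average over `t` of `F(x - t) - F(x)`. Jensen pointwise in `x`, then Tonelli,
reduce its `L²` norm to those of the single translates with `t` in the support of the bump. -/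
theorem eLpNorm_convolution_sub_le {F : E n → V} (hF : MemLp F 2) {ε : ℝ≥0∞}
    {ρ : ContDiffBump (0 : E n)}
    (hρ : ∀ t : E n, ‖t‖ < ρ.rOut → eLpNorm (fun x => F (x - t) - F x) 2 volume ≤ ε) :
    eLpNorm (fun x => convolution (ρ.normed volume) F (ContinuousLinearMap.lsmul ℝ ℝ) volume x
      - F x) 2 volume ≤ ε := by
  set κ : E n → ℝ≥0∞ := fun t => ENNReal.ofReal (ρ.normed volume t) with hκ
  have hκm : Measurable κ := (ρ.continuous_normed (μ := volume)).measurable.ennreal_ofReal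
  have hκ1 : ∫⁻ t, κ t = 1 := by
    rw [hκ, ← ofReal_integral_eq_lintegral_ofReal ρ.integrable_normed
      (Eventually.of_forall ρ.nonneg_normed), ρ.integral_normed, ENNReal.ofReal_one]
  have hFl : LocallyIntegrable F := hF.locallyIntegrable (by norm_num)
  have hm2 : AEStronglyMeasurable (fun p : E n × E n => F (p.1 - p.2) - F p.1)
      (volume.prod volume) := by
    have q := quasiMeasurePreserving_sub (volume : Measure (E n)) (volume : Measure (E n))
    exact (hF.1.comp_quasiMeasurePreserving q).sub
      (hF.1.comp_quasiMeasurePreserving Measure.quasiMeasurePreserving_fst)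
  have hm1 : ∀ x, AEStronglyMeasurable (fun t => F (x - t) - F x) volume := fun x =>
    (hF.1.comp_quasiMeasurePreserving
      (quasiMeasurePreserving_sub_left volume x)).sub aestronglyMeasurable_const
  have hpt : ∀ x, ‖convolution (ρ.normed volume) F (ContinuousLinearMap.lsmul ℝ ℝ) volume x
      - F x‖ₑ ≤ ∫⁻ t, κ t * ‖F (x - t) - F x‖ₑ := by
    intro x
    have e : convolution (ρ.normed volume) F (ContinuousLinearMap.lsmul ℝ ℝ) volume x - F x
        = ∫ t, ρ.normed volume t • (F (x - t) - F x) := by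
      have hce : Integrable (fun t => ρ.normed volume t • F (x - t)) :=
        (ρ.hasCompactSupport_normed.convolutionExists_left (ContinuousLinearMap.lsmul ℝ ℝ)
          ρ.continuous_normed hFl x)
      simp only [smul_sub]
      rw [integral_sub hce (ρ.integrable_normed.smul_const _), ρ.integral_normed_smul]
      rfl
    rw [e]
    refine (enorm_integral_le_lintegral_enorm _).trans (lintegral_mono fun t => ?_)
    rw [enorm_smul, Real.enorm_of_nonneg (ρ.nonneg_normed t)]
  rw [← ENNReal.pow_le_pow_left_iff (n := 2) (by norm_num), eLpNorm_two_sq]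
  calc ∫⁻ x, ‖convolution (ρ.normed volume) F (ContinuousLinearMap.lsmul ℝ ℝ) volume x
        - F x‖ₑ ^ 2
      ≤ ∫⁻ x, ∫⁻ t, κ t * ‖F (x - t) - F x‖ₑ ^ 2 := by
        refine lintegral_mono fun x => ?_
        exact (pow_le_pow_left' (hpt x) 2).trans (sq_lintegral_mul_le hκm hκ1 (hm1 x).enorm)
    _ = ∫⁻ t, ∫⁻ x, κ t * ‖F (x - t) - F x‖ₑ ^ 2 := by
        refine lintegral_lintegral_swap ?_
        exact (hκm.comp measurable_snd).aemeasurable.mul (hm2.enorm.pow_const 2)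
    _ ≤ ∫⁻ t, κ t * ε ^ 2 := by
        refine lintegral_mono fun t => ?_
        rw [lintegral_const_mul' _ _ ENNReal.ofReal_ne_top, ← eLpNorm_two_sq]
        by_cases ht : ‖t‖ < ρ.rOut
        · exact mul_le_mul_right (pow_le_pow_left' (hρ t ht) 2) _
        · have : ρ.normed volume t = 0 := by
            rw [← Function.notMem_support, ρ.support_normed_eq]
            simpa using ht
          simp [hκ, this]
    _ = ε ^ 2 := by rw [lintegral_mul_const _ hκm, hκ1, one_mul]

end Mollification

/-! ### Smooth approximation of compactly supported Sobolev functions -/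

section Density

variable {Ω : Set (E n)}

theorem gradient_comp_sub_left {ψ : E n → ℝ} (hψ : Differentiable ℝ ψ) (x s : E n) :
    gradient (fun s => ψ (x - s)) s = -gradient ψ (x - s) := by
  have h : HasFDerivAt (fun s => ψ (x - s)) (-(fderiv ℝ ψ (x - s))) s := by
    have := (hψ (x - s)).hasFDerivAt.comp s ((hasFDerivAt_id s).const_sub x)
    simpa using! this
  simp only [gradient]
  rw [h.fderiv]
  simp

/-- The weak gradient identity is tested with `s ↦ ψ (x - s)`. The reflection contributes a sign
that cancels the one from integration by parts. -/
theorem gradient_convolution {p : E n → ℝ} {P : E n → E n} (hp : IsWeakGradient univ p P)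
    {ψ : E n → ℝ} (hψ : ContDiff ℝ ∞ ψ) (hc : HasCompactSupport ψ) (x : E n) :
    gradient (convolution ψ p (ContinuousLinearMap.lsmul ℝ ℝ) volume) x =
      convolution ψ P (ContinuousLinearMap.lsmul ℝ ℝ) volume x := by
  have hpl : LocallyIntegrable p := locallyIntegrableOn_univ.1 hp.1
  have hψ1 : ContDiff ℝ 1 ψ := hψ.of_le (by simp)
  have hder := hc.hasFDerivAt_convolution_left (μ := volume) (ContinuousLinearMap.lsmul ℝ ℝ) hψ1
    hpl x
  have hT : IsTestFunction univ (fun s => ψ (x - s)) := by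
    refine ⟨hψ.comp (contDiff_const.sub contDiff_id), ?_, subset_univ _⟩
    exact hc.comp_homeomorph (Homeomorph.subLeft x)
  have key := hp.integral_eq hT
  simp only [gradient_comp_sub_left (hψ.differentiable (by simp)), smul_neg, integral_neg,
    neg_inj] at key
  have hg : gradient (convolution ψ p (ContinuousLinearMap.lsmul ℝ ℝ) volume) x
      = ∫ s, p s • gradient ψ (x - s) := by
    simp only [gradient]
    rw [hder.fderiv]
    have e : (convolution (fderiv ℝ ψ) p
        ((ContinuousLinearMap.lsmul ℝ ℝ).precompL (E n)) volume) x
        = ∫ s, p s • fderiv ℝ ψ (x - s) := by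
      rw [convolution_eq_swap]
      refine integral_congr_ae (Eventually.of_forall fun s => ?_)
      ext v
      simp [mul_comm]
    rw [e]
    symm
    refine Eq.trans ?_ ((InnerProductSpace.toDual ℝ
      (E n)).symm.toContinuousLinearEquiv.integral_comp_comm fun s => p s • fderiv ℝ ψ (x - s))
    simp
  rw [hg, key, convolution_eq_swap]
  rfl

/-- A mollification at a scale below the distance from `K` to the complement of `Ω` remains
supported in `Ω`. Its gradient is the mollification of `P`, so both errors are governed by `L²`
continuity of translations. -/
theorem exists_isTestFunction_approx (hΩ : IsOpen Ω) {p : E n → ℝ} {P : E n → E n}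
    (hp : IsWeakGradient univ p P) (hp2 : MemLp p 2) (hP2 : MemLp P 2) {K : Set (E n)}
    (hK : IsCompact K) (hKΩ : K ⊆ Ω) (hpK : ∀ x ∉ K, p x = 0) {ε : ℝ≥0∞} (hε : 0 < ε) :
    ∃ φ : E n → ℝ, IsTestFunction Ω φ ∧ eLpNorm (fun x => φ x - p x) 2 volume ≤ ε ∧
      eLpNorm (fun x => gradient φ x - P x) 2 volume ≤ ε := by
  obtain ⟨δ, hδ, hδΩ⟩ := hK.exists_cthickening_subset_open hΩ hKΩ
  have e1 := (tendsto_eLpNorm_translate_sub hp2).eventually (ge_mem_nhds hε)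
  have e2 := (tendsto_eLpNorm_translate_sub hP2).eventually (ge_mem_nhds hε)
  obtain ⟨r, hr, hr'⟩ := Metric.eventually_nhds_iff.1 (e1.and e2)
  set R := min r δ with hR
  have hR0 : 0 < R := lt_min hr hδ
  let ρ : ContDiffBump (0 : E n) := ⟨R / 2, R, by linarith, by linarith⟩
  have hρc : HasCompactSupport (ρ.normed (volume : Measure (E n))) := ρ.hasCompactSupport_normed
  have hρs : ContDiff ℝ ∞ (ρ.normed (volume : Measure (E n))) := ρ.contDiff_normed
  have hpl : LocallyIntegrable p := locallyIntegrableOn_univ.1 hp.1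
  have hsupp : tsupport (convolution (ρ.normed volume) p (ContinuousLinearMap.lsmul ℝ ℝ) volume)
      ⊆ Metric.cthickening δ K := by
    refine closure_minimal ?_ Metric.isClosed_cthickening
    refine (support_convolution_subset _).trans ?_
    rintro _ ⟨a, ha, b, hb, rfl⟩
    have hbK : b ∈ K := by
      by_contra h
      exact hb (hpK b h)
    rw [ρ.support_normed_eq] at ha
    refine Metric.mem_cthickening_of_dist_le (a + b) b δ K hbK ?_
    have : dist (a + b) b = ‖a‖ := by simp [dist_eq_norm]
    rw [this]
    exact ((mem_ball_zero_iff.1 ha).trans_le (min_le_right _ _)).le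
  refine ⟨convolution (ρ.normed volume) p (ContinuousLinearMap.lsmul ℝ ℝ) volume,
    ⟨hρc.contDiff_convolution_left _ hρs hpl, ?_, hsupp.trans hδΩ⟩, ?_, ?_⟩
  · exact hK.cthickening.of_isClosed_subset (isClosed_tsupport _) hsupp
  · refine eLpNorm_convolution_sub_le hp2 fun t ht => (hr' ?_).1
    simpa using ht.trans_le (min_le_left _ _)
  · simp only [gradient_convolution hp hρs hρc]
    refine eLpNorm_convolution_sub_le hP2 fun t ht => (hr' ?_).2
    simpa using ht.trans_le (min_le_left _ _)

end Density

/-! ### Operations on `H¹` and `H¹₀`, cutoffs -/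

section SobolevAlgebra

variable {Ω : Set (E n)} {f g : E n → ℝ} {F G : E n → E n}

theorem integral_norm_sq_eq_toReal {α V : Type*} [MeasurableSpace α] {μ : Measure α}
    [NormedAddCommGroup V] {H : α → V} (hH : AEStronglyMeasurable H μ) :
    ∫ x, ‖H x‖ ^ 2 ∂μ = (eLpNorm H 2 μ ^ 2).toReal := by
  rw [eLpNorm_two_sq, integral_eq_lintegral_of_nonneg_ae
    (Eventually.of_forall fun x => sq_nonneg _) (hH.norm.pow 2)]
  congr 1
  refine lintegral_congr fun x => ?_
  rw [← ofReal_norm, ENNReal.ofReal_pow (norm_nonneg _)]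

theorem integrable_norm_sq {α V : Type*} [MeasurableSpace α] {μ : Measure α}
    [NormedAddCommGroup V] {H : α → V} (hH : MemLp H 2 μ) : Integrable (fun x => ‖H x‖ ^ 2) μ :=
  (memLp_two_iff_integrable_sq_norm hH.1).1 hH

theorem IsTestFunction.memLp {φ : E n → ℝ} (h : IsTestFunction Ω φ) (p : ℝ≥0∞) (μ : Measure (E n))
    [IsFiniteMeasureOnCompacts μ] : MemLp φ p μ :=
  h.1.continuous.memLp_of_hasCompactSupport h.2.1

theorem IsTestFunction.memLp_gradient {φ : E n → ℝ} (h : IsTestFunction Ω φ) (p : ℝ≥0∞)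
    (μ : Measure (E n)) [IsFiniteMeasureOnCompacts μ] : MemLp (gradient φ) p μ :=
  (continuous_gradient h.1).memLp_of_hasCompactSupport h.hasCompactSupport_gradient

theorem IsTestFunction.memH1 {φ : E n → ℝ} (h : IsTestFunction Ω φ) (U : Set (E n)) : MemH1 U φ :=
  ⟨h.memLp 2 _, gradient φ, isWeakGradient_of_contDiff h.1, h.memLp_gradient 2 _⟩

theorem MemH1.add (hf : MemH1 Ω f) (hg : MemH1 Ω g) : MemH1 Ω (fun x => f x + g x) := by
  obtain ⟨hf2, F, hF, hF2⟩ := hf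
  obtain ⟨hg2, G, hG, hG2⟩ := hg
  exact ⟨hf2.add hg2, _, hF.add hG, hF2.add hG2⟩

theorem MemH1.sub (hf : MemH1 Ω f) (hg : MemH1 Ω g) : MemH1 Ω (fun x => f x - g x) := by
  obtain ⟨hf2, F, hF, hF2⟩ := hf
  obtain ⟨hg2, G, hG, hG2⟩ := hg
  exact ⟨hf2.sub hg2, _, hF.sub hG, hF2.sub hG2⟩

theorem MemH1.const_mul (hf : MemH1 Ω f) (c : ℝ) : MemH1 Ω (fun x => c * f x) := by
  obtain ⟨hf2, F, hF, hF2⟩ := hf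
  exact ⟨hf2.const_mul c, _, hF.const_mul c, hF2.const_smul c⟩

theorem h1NormSq_add_le (hΩ : IsOpen Ω) (hf : MemH1 Ω f) (hg : MemH1 Ω g) :
    h1NormSq Ω (fun x => f x + g x) ≤ 2 * h1NormSq Ω f + 2 * h1NormSq Ω g := by
  have hw := (hf.isWeakGradient.add hg.isWeakGradient).weakGradient_ae_eq hΩ
  have i1 := integrable_norm_sq hf.1
  have i2 := integrable_norm_sq hg.1
  have i3 := integrable_norm_sq (hf.memLp_weakGradient hΩ)
  have i4 := integrable_norm_sq (hg.memLp_weakGradient hΩ)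
  simp only [Real.norm_eq_abs, sq_abs] at i1 i2
  have i5 := integrable_norm_sq (hf.add hg).1
  have i6 := integrable_norm_sq ((hf.add hg).memLp_weakGradient hΩ)
  simp only [Real.norm_eq_abs, sq_abs] at i5
  have j1 : Integrable (fun x => 2 * (f x ^ 2 + ‖weakGradient Ω f x‖ ^ 2))
    (volume.restrict Ω) := (i1.add i3).const_mul 2
  have j2 : Integrable (fun x => 2 * (g x ^ 2 + ‖weakGradient Ω g x‖ ^ 2))
    (volume.restrict Ω) := (i2.add i4).const_mul 2
  rw [h1NormSq, h1NormSq, h1NormSq, ← integral_const_mul, ← integral_const_mul,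
    ← integral_add j1 j2]
  refine integral_mono_ae (i5.add i6) (j1.add j2) ?_
  filter_upwards [hw] with x hx
  rw [hx]
  have h1 := norm_add_le (weakGradient Ω f x) (weakGradient Ω g x)
  have h2 : ‖weakGradient Ω f x + weakGradient Ω g x‖ ^ 2
      ≤ (‖weakGradient Ω f x‖ + ‖weakGradient Ω g x‖) ^ 2 := by gcongr
  nlinarith [sq_nonneg (f x - g x), sq_nonneg (‖weakGradient Ω f x‖ - ‖weakGradient Ω g x‖)]

theorem MemH10.add (hΩ : IsOpen Ω) (hf : MemH10 Ω f) (hg : MemH10 Ω g) :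
    MemH10 Ω (fun x => f x + g x) := by
  refine ⟨hf.1.add hg.1, fun ε hε => ?_⟩
  obtain ⟨φ, hφ, h1⟩ := hf.2 (ε / 2) (by positivity)
  obtain ⟨ψ, hψ, h2⟩ := hg.2 (ε / 2) (by positivity)
  refine ⟨fun x => φ x + ψ x, hφ.add hψ, ?_⟩
  have e : (fun x => f x + g x - (φ x + ψ x)) = fun x => (f x - φ x) + (g x - ψ x) := by
    ext x
    ring
  rw [e]
  have h := h1NormSq_add_le hΩ (hf.1.sub (hφ.memH1 Ω)) (hg.1.sub (hψ.memH1 Ω))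
  rw [Real.sqrt_lt' (by positivity)] at h1 h2 ⊢
  nlinarith

/-- A smooth cutoff function which is `1` on a given compact subset of `Ω`. -/
theorem exists_isTestFunction_one (hΩ : IsOpen Ω) {K : Set (E n)} (hK : IsCompact K)
    (hKΩ : K ⊆ Ω) :
    ∃ χ : E n → ℝ, IsTestFunction Ω χ ∧ (∀ x ∈ K, χ x = 1) ∧ ∀ x, 0 ≤ χ x := by
  obtain ⟨δ, hδ, hδΩ⟩ := hK.exists_cthickening_subset_open hΩ hKΩ
  obtain ⟨χ, h1, h2, h3, h4⟩ := exists_contMDiff_support_eq_eq_one_iff (n := ⊤)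
    (modelWithCornersSelf ℝ (E n)) (Metric.isOpen_thickening (δ := δ) (E := K)) hK.isClosed
    (Metric.self_subset_thickening hδ K)
  have hs : tsupport χ ⊆ Metric.cthickening δ K := by
    rw [tsupport, h3]
    exact Metric.closure_thickening_subset_cthickening δ K
  refine ⟨χ, ⟨h1.contDiff, ?_, hs.trans hδΩ⟩, fun x hx => (h4 x).1 hx,
    fun x => (h2 (mem_range_self x)).1⟩
  exact hK.cthickening.of_isClosed_subset (isClosed_tsupport _) hs

theorem IsTestFunction.bounded {φ : E n → ℝ} (h : IsTestFunction Ω φ) :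
    ∃ C : ℝ, 0 < C ∧ (∀ x, |φ x| ≤ C) ∧ ∀ x, ‖gradient φ x‖ ≤ C := by
  obtain ⟨A, hA⟩ := h.2.1.exists_bound_of_continuous h.1.continuous
  obtain ⟨B, hB⟩ := h.hasCompactSupport_gradient.exists_bound_of_continuous
    (continuous_gradient h.1)
  refine ⟨|A| + |B| + 1, by positivity, fun x => ?_, fun x => ?_⟩
  · exact (hA x).trans (by linarith [le_abs_self A, abs_nonneg B])
  · exact (hB x).trans (by linarith [le_abs_self B, abs_nonneg A])

/-- Cutting off with `χ` makes the function a Sobolev function on the whole space, where convolution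
is available. -/
theorem IsWeakGradient.univ_of_isTestFunction (hf : IsWeakGradient Ω f F)
    {χ : E n → ℝ} (hχ : IsTestFunction Ω χ) :
    IsWeakGradient univ (fun x => χ x * f x) (fun x => χ x • F x + f x • gradient χ x) := by
  have i1 : Integrable (fun x => χ x * f x) := hχ.integrable_smul hf.1
  have i2 := (hχ.integrable_smul hf.2.1).add (hχ.integrable_smul_gradient hf.1)
  refine isWeakGradient_of_integral (i1.locallyIntegrable.locallyIntegrableOn _)
    (i2.locallyIntegrable.locallyIntegrableOn _) fun ψ hψ => ?_
  have hT := hχ.mul hψ.1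
  have h := hf.integral_eq hT
  have e1 : ∀ x, f x • gradient (fun y => χ y * ψ y) x
      = (χ x * f x) • gradient ψ x + ψ x • (f x • gradient χ x) := fun x => by
    rw [gradient_mul (hχ.differentiable x) (hψ.differentiable x), smul_add, smul_smul,
      smul_smul, smul_smul, mul_comm (f x), mul_comm (f x)]
  have j1 := hψ.integrable_smul_gradient (i1.locallyIntegrable.locallyIntegrableOn _)
  have j2 := hψ.integrable_smul
    ((hχ.integrable_smul_gradient hf.1).locallyIntegrable.locallyIntegrableOn _)
  have j3 := hψ.integrable_smul ((hχ.integrable_smul hf.2.1).locallyIntegrable.locallyIntegrableOn _)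
  simp only [e1] at h
  rw [integral_add j1 j2] at h
  simp only [smul_add]
  rw [integral_add j3 j2, eq_sub_of_add_eq h]
  simp only [smul_smul, mul_comm (ψ _)]
  abel

theorem memLp_of_restrict {V : Type*} [NormedAddCommGroup V] {H : E n → V}
    (hΩ : MeasurableSet Ω) (h0 : ∀ x ∉ Ω, H x = 0)
    (hH : MemLp H 2 (volume.restrict Ω)) : MemLp H 2 := by
  rw [← memLp_indicator_iff_restrict hΩ] at hH
  rwa [indicator_eq_self.2 fun x hx => by_contra fun h => hx (h0 x h)] at hH

variable {V : Type*} [NormedAddCommGroup V] [NormedSpace ℝ V]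

theorem memLp_smul_of_bounded {μ : Measure (E n)} {χ : E n → ℝ} (hχ : Continuous χ) {C : ℝ}
    (hC : ∀ x, |χ x| ≤ C) {H : E n → V} (hH : MemLp H 2 μ) : MemLp (fun x => χ x • H x) 2 μ := by
  refine hH.of_le_mul (c := C) (hχ.aestronglyMeasurable.smul hH.1)
    (Eventually.of_forall fun x => ?_)
  rw [norm_smul]
  exact mul_le_mul_of_nonneg_right (hC x) (norm_nonneg _)

theorem memLp_smul_of_bounded' {μ : Measure (E n)} {Y : E n → V} (hY : Continuous Y) {C : ℝ}
    (hC : ∀ x, ‖Y x‖ ≤ C) {f : E n → ℝ} (hf : MemLp f 2 μ) :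
    MemLp (fun x => f x • Y x) 2 μ := by
  refine hf.of_le_mul (c := C) (hf.1.smul hY.aestronglyMeasurable)
    (Eventually.of_forall fun x => ?_)
  rw [norm_smul, mul_comm]
  exact mul_le_mul_of_nonneg_right (hC x) (norm_nonneg _)

theorem IsTestFunction.memLp_mul (hΩ : IsOpen Ω) {χ : E n → ℝ} (hχ : IsTestFunction Ω χ)
    (hf : MemLp f 2 (volume.restrict Ω)) : MemLp (fun x => χ x * f x) 2 := by
  obtain ⟨C, _, h1, _⟩ := hχ.bounded
  exact memLp_of_restrict hΩ.measurableSet (fun x hx => by simp [hχ.eq_zero hx])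
    (memLp_smul_of_bounded hχ.1.continuous h1 hf)

theorem IsTestFunction.memLp_gradient_mul (hΩ : IsOpen Ω) {χ : E n → ℝ} (hχ : IsTestFunction Ω χ)
    (hf : MemLp f 2 (volume.restrict Ω)) (hF : MemLp F 2 (volume.restrict Ω)) :
    MemLp (fun x => χ x • F x + f x • gradient χ x) 2 := by
  obtain ⟨C, _, h1, h2⟩ := hχ.bounded
  exact memLp_of_restrict hΩ.measurableSet
    (fun x hx => by simp [hχ.eq_zero hx, hχ.gradient_eq_zero hx])
    ((memLp_smul_of_bounded hχ.1.continuous h1 hF).add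
      (memLp_smul_of_bounded' (continuous_gradient hχ.1) h2 hf))

theorem MemH1.isTestFunction_mul (hΩ : IsOpen Ω) {χ : E n → ℝ} (hχ : IsTestFunction Ω χ)
    (hf : MemH1 Ω f) : MemH1 Ω (fun x => χ x * f x) := by
  obtain ⟨hf2, F, hF, hF2⟩ := hf
  exact ⟨(hχ.memLp_mul hΩ hf2).restrict Ω, _, hF.mul_contDiff hΩ hχ.1,
    (hχ.memLp_gradient_mul hΩ hf2 hF2).restrict Ω⟩

/-- An `H¹` function with compact support in `Ω` belongs to `H¹₀(Ω)`. -/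
theorem MemH1.memH10_of_compact (hΩ : IsOpen Ω) (hf : MemH1 Ω f) {K : Set (E n)}
    (hK : IsCompact K) (hKΩ : K ⊆ Ω) (h0 : ∀ x ∉ K, f x = 0) : MemH10 Ω f := by
  refine ⟨hf, fun ε hε => ?_⟩
  obtain ⟨χ, hχ, hχ1, -⟩ := exists_isTestFunction_one hΩ hK hKΩ
  obtain ⟨hf2, F, hF, hF2⟩ := hf
  -- Since `χ = 1` on `K` and `f = 0` elsewhere, `f` itself is the cut-off function and can be
  -- mollified on the whole space.
  have e : (fun x => χ x * f x) = f := by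
    ext x
    by_cases hx : x ∈ K
    · rw [hχ1 x hx, one_mul]
    · rw [h0 x hx, mul_zero]
  have w := hF.univ_of_isTestFunction hχ
  have m1 := hχ.memLp_mul hΩ hf2
  have m2 := hχ.memLp_gradient_mul hΩ hf2 hF2
  rw [e] at w m1
  set P : E n → E n := fun x => χ x • F x + f x • gradient χ x
  obtain ⟨φ, hφ, a1, a2⟩ := exists_isTestFunction_approx hΩ w m1 m2 hK hKΩ h0
    (ε := ENNReal.ofReal (ε / 2)) (by simpa using hε)
  refine ⟨φ, hφ, ?_⟩
  have hw : IsWeakGradient Ω (fun x => f x - φ x) (fun x => P x - gradient φ x) :=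
    (w.mono (subset_univ _)).sub (isWeakGradient_of_contDiff hφ.1)
  have n1 : MemLp (fun x => f x - φ x) 2 (volume.restrict Ω) :=
    (m1.sub (hφ.memLp 2 _)).restrict Ω
  have n2 : MemLp (fun x => P x - gradient φ x) 2 (volume.restrict Ω) :=
    (m2.sub (hφ.memLp_gradient 2 _)).restrict Ω
  have b1 : eLpNorm (fun x => f x - φ x) 2 (volume.restrict Ω) ≤ ENNReal.ofReal (ε / 2) := by
    refine (eLpNorm_restrict_le _ _ _ _).trans ?_
    rw [← eLpNorm_neg]
    simpa [Pi.neg_def] using a1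
  have b2 : eLpNorm (fun x => P x - gradient φ x) 2 (volume.restrict Ω)
      ≤ ENNReal.ofReal (ε / 2) := by
    refine (eLpNorm_restrict_le _ _ _ _).trans ?_
    rw [← eLpNorm_neg]
    simpa [Pi.neg_def] using a2
  have c : ∀ a : ℝ≥0∞, a ≤ ENNReal.ofReal (ε / 2) → (a ^ 2).toReal ≤ (ε / 2) ^ 2 := fun a ha => by
    rw [ENNReal.toReal_pow]
    have := ENNReal.toReal_le_of_le_ofReal (by positivity) ha
    gcongr
  rw [Real.sqrt_lt' hε, hw.h1NormSq_eq hΩ]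
  have i1 := integrable_norm_sq n1
  have q1 := integral_norm_sq_eq_toReal n1.1
  simp only [Real.norm_eq_abs, sq_abs] at i1 q1
  rw [integral_add i1 (integrable_norm_sq n2), q1, integral_norm_sq_eq_toReal n2.1]
  have := c _ b1
  have := c _ b2
  nlinarith

end SobolevAlgebra

/-! ### The chain rule for smooth Lipschitz functions of an `H¹` function -/

section ChainRule

variable {Ω : Set (E n)} {f : E n → ℝ} {F : E n → E n}

theorem enorm_integral_smul_le {V : Type*} [NormedAddCommGroup V] [NormedSpace ℝ V]
    {a : E n → ℝ} {h : E n → V} (ha : AEStronglyMeasurable a) (hh : AEStronglyMeasurable h) :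
    ‖∫ x, a x • h x‖ₑ ≤ eLpNorm a 2 volume * eLpNorm h 2 volume := by
  refine (enorm_integral_le_lintegral_enorm _).trans ?_
  rw [← eLpNorm_one_eq_lintegral_enorm]
  exact eLpNorm_smul_le_mul_eLpNorm hh ha

/-- For smooth `φ k` the identity is classical. On the left the limit uses that `Γ` is Lipschitz; on
the right `Γ'` is only bounded and continuous, so a subsequence converging a.e. is needed. -/
theorem integral_comp_gradient_eq {p : E n → ℝ} {P : E n → E n} (hp2 : MemLp p 2)
    (hP2 : MemLp P 2) {φ : ℕ → E n → ℝ} (hφ : ∀ k, IsTestFunction univ (φ k))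
    (h1 : Tendsto (fun k => eLpNorm (fun x => φ k x - p x) 2 volume) atTop (𝓝 0))
    (h2 : Tendsto (fun k => eLpNorm (fun x => gradient (φ k) x - P x) 2 volume) atTop (𝓝 0))
    {Γ Γ' : ℝ → ℝ} (hΓ : ContDiff ℝ ∞ Γ) (hd : ∀ s, HasDerivAt Γ (Γ' s) s) {L : ℝ}
    (hL : ∀ s, |Γ' s| ≤ L) {ψ : E n → ℝ} (hψ : IsTestFunction univ ψ) :
    ∫ x, Γ (p x) • gradient ψ x = -∫ x, ψ x • Γ' (p x) • P x := by
  have hc : Continuous Γ' := by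
    have : Γ' = deriv Γ := funext fun s => (hd s).deriv.symm
    rw [this]
    exact hΓ.continuous_deriv (by simp)
  have hm : TendstoInMeasure volume φ atTop p := by
    refine tendstoInMeasure_of_tendsto_eLpNorm (p := 2) (by norm_num)
      (fun k => (hφ k).1.continuous.aestronglyMeasurable) hp2.1 ?_
    exact h1
  obtain ⟨ns, hns, hae⟩ := hm.exists_seq_tendsto_ae
  have hlip : ∀ s t, |Γ s - Γ t| ≤ L * |s - t| := fun s t => by
    have := Convex.norm_image_sub_le_of_norm_hasDerivWithin_le (f := Γ) (f' := Γ') (C := L)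
      (s := univ) (fun x _ => (hd x).hasDerivWithinAt) (fun x _ => hL x) convex_univ
      (mem_univ t) (mem_univ s)
    simpa using this
  have hL0 : 0 ≤ L := (abs_nonneg _).trans (hL 0)
  have ep : ∀ k, ∫ x, Γ (φ (ns k) x) • gradient ψ x
      = -∫ x, ψ x • Γ' (φ (ns k) x) • gradient (φ (ns k)) x := fun k => by
    rw [integral_mul_gradient_of_contDiff (ψ := fun x => Γ (φ (ns k) x))
      (hΓ.comp (hφ (ns k)).1) hψ.1 hψ.2.1]
    congr 2
    ext1 x
    rw [gradient_comp ((hφ (ns k)).differentiable x) (hd _)]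
  have hpl : LocallyIntegrable p := hp2.locallyIntegrable (by norm_num)
  have hΓp : AEStronglyMeasurable (fun x => Γ (p x)) := hΓ.continuous.comp_aestronglyMeasurable hp2.1
  have hφc : ∀ k, Continuous (φ k) := fun k => (hφ k).1.continuous
  have l1 : Tendsto (fun k => ∫ x, Γ (φ (ns k) x) • gradient ψ x) atTop
      (𝓝 (∫ x, Γ (p x) • gradient ψ x)) := by
    -- `Γ` grows at most linearly: `|Γ s| ≤ |Γ 0| + L |s|`.
    have hint : Integrable (fun x => Γ (p x) • gradient ψ x) := by
      refine hψ.integrable_smul_gradient ?_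
      refine (((locallyIntegrable_const |Γ 0|).locallyIntegrableOn univ).add
        ((hpl.locallyIntegrableOn univ).norm.smul L)).mono hΓp ?_
      refine Eventually.of_forall fun x => ?_
      have := hlip (p x) 0
      rw [sub_zero] at this
      have h3 : |Γ (p x)| ≤ |Γ (p x) - Γ 0| + |Γ 0| := by
        simpa using abs_add_le (Γ (p x) - Γ 0) (Γ 0)
      rw [Real.norm_eq_abs, Real.norm_eq_abs]
      refine le_trans ?_ (le_abs_self _)
      simp only [Pi.add_apply, Pi.smul_apply, Real.norm_eq_abs, smul_eq_mul]
      linarith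
    have hintk : ∀ k, Integrable (fun x => Γ (φ (ns k) x) • gradient ψ x) := fun k =>
      hψ.integrable_smul_gradient
        ((hΓ.continuous.comp (hφc _)).locallyIntegrable.locallyIntegrableOn _)
    rw [tendsto_iff_edist_tendsto_0]
    refine tendsto_of_tendsto_of_tendsto_of_le_of_le tendsto_const_nhds
      (h := fun k => ENNReal.ofReal L * eLpNorm (fun x => φ (ns k) x - p x) 2 volume *
        eLpNorm (gradient ψ) 2 volume) ?_ (fun k => zero_le) fun k => ?_
    · have := (ENNReal.Tendsto.const_mul (a := ENNReal.ofReal L) (h1.comp hns.tendsto_atTop)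
        (Or.inr ENNReal.ofReal_ne_top))
      have := ENNReal.Tendsto.mul_const (b := eLpNorm (gradient ψ) 2 volume) this
        (Or.inr (hψ.memLp_gradient 2 volume).2.ne)
      simpa using this
    · rw [edist_eq_enorm_sub, ← integral_sub (hintk k) hint]
      simp only [← sub_smul]
      refine (enorm_integral_smul_le (((hΓ.continuous.comp
        (hφc _)).aestronglyMeasurable).sub hΓp) (continuous_gradient hψ.1).aestronglyMeasurable).trans ?_
      gcongr
      refine eLpNorm_le_mul_eLpNorm_of_ae_le_mul (Eventually.of_forall fun x => ?_) 2
      exact hlip _ _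
  have l2 : Tendsto (fun k => ∫ x, ψ x • Γ' (φ (ns k) x) • gradient (φ (ns k)) x) atTop
      (𝓝 (∫ x, ψ x • Γ' (p x) • P x)) := by
    have hPl : LocallyIntegrable P := hP2.locallyIntegrable (by norm_num)
    have hb : Integrable (fun x => L * ‖ψ x • P x‖) :=
      ((hψ.integrable_smul (hPl.locallyIntegrableOn _)).norm.const_mul L)
    have hbd : ∀ (s : ℝ) (x : E n), ‖ψ x • Γ' s • P x‖ ≤ L * ‖ψ x • P x‖ := fun s x => by
      rw [smul_comm, norm_smul]
      exact mul_le_mul_of_nonneg_right (hL s) (norm_nonneg _)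
    have hms : ∀ k, AEStronglyMeasurable (fun x => ψ x • Γ' (φ (ns k) x) • P x) := fun k =>
      hψ.1.continuous.aestronglyMeasurable.smul
        ((hc.comp (hφc _)).aestronglyMeasurable.smul hP2.1)
    -- With the gradient frozen at `P`, dominated convergence applies. The remaining difference of
    -- gradients, weighted by `ψ Γ'`, is removed afterwards by Cauchy–Schwarz.
    have l3 : Tendsto (fun k => ∫ x, ψ x • Γ' (φ (ns k) x) • P x) atTop
        (𝓝 (∫ x, ψ x • Γ' (p x) • P x)) := by
      refine tendsto_integral_of_dominated_convergence _ hms hb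
        (fun k => Eventually.of_forall fun x => hbd _ x) ?_
      filter_upwards [hae] with x hx
      exact (((hc.tendsto _).comp hx).smul_const _).const_smul _
    have l4 : Tendsto (fun k => ∫ x, (ψ x * Γ' (φ (ns k) x)) • (gradient (φ (ns k)) x - P x)) atTop
        (𝓝 0) := by
      rw [tendsto_zero_iff_enorm_tendsto_zero]
      refine tendsto_of_tendsto_of_tendsto_of_le_of_le tendsto_const_nhds
        (h := fun k => ENNReal.ofReal L * eLpNorm ψ 2 volume *
          eLpNorm (fun x => gradient (φ (ns k)) x - P x) 2 volume) ?_ (fun k => zero_le)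
          fun k => ?_
      · have := (ENNReal.Tendsto.const_mul (a := ENNReal.ofReal L * eLpNorm ψ 2 volume)
          (h2.comp hns.tendsto_atTop)
          (Or.inr (ENNReal.mul_ne_top ENNReal.ofReal_ne_top (hψ.memLp 2 volume).2.ne)))
        simpa using this
      · refine (enorm_integral_smul_le ((hψ.1.continuous.mul
          (hc.comp (hφc _))).aestronglyMeasurable)
          ((continuous_gradient (hφ _).1).aestronglyMeasurable.sub hP2.1)).trans ?_
        refine mul_le_mul_left ?_ _
        refine eLpNorm_le_mul_eLpNorm_of_ae_le_mul (Eventually.of_forall fun x => ?_) 2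
        rw [Pi.mul_apply, norm_mul, mul_comm]
        exact mul_le_mul_of_nonneg_right (hL _) (norm_nonneg _)
    have l5 := l3.add l4
    rw [add_zero] at l5
    refine l5.congr fun k => ?_
    have i1 : Integrable (fun x => ψ x • Γ' (φ (ns k) x) • P x) :=
      hb.mono' (hms k) (Eventually.of_forall fun x => hbd _ x)
    have i2 : Integrable (fun x => ψ x • Γ' (φ (ns k) x) • gradient (φ (ns k)) x) :=
      hψ.integrable_smul (((hc.comp (hφc _)).smul
        (continuous_gradient (hφ _).1)).locallyIntegrable.locallyIntegrableOn _)
    have e : ∀ x, (ψ x * Γ' (φ (ns k) x)) • (gradient (φ (ns k)) x - P x)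
        = ψ x • Γ' (φ (ns k) x) • gradient (φ (ns k)) x - ψ x • Γ' (φ (ns k) x) • P x :=
      fun x => by rw [smul_sub, mul_smul, mul_smul]
    simp only [e]
    rw [integral_sub i2 i1]
    abel
  simp only [ep] at l1
  exact tendsto_nhds_unique l1 l2.neg

/-- The chain rule for the composition of an `H¹` function with a smooth Lipschitz function. -/
theorem IsWeakGradient.comp (hΩ : IsOpen Ω) (hf : IsWeakGradient Ω f F)
    (hf2 : MemLp f 2 (volume.restrict Ω)) (hF2 : MemLp F 2 (volume.restrict Ω))
    {Γ Γ' : ℝ → ℝ} (hΓ : ContDiff ℝ ∞ Γ) (hd : ∀ s, HasDerivAt Γ (Γ' s) s) {L : ℝ}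
    (hL : ∀ s, |Γ' s| ≤ L) (hi : LocallyIntegrableOn (fun x => Γ (f x)) Ω) :
    IsWeakGradient Ω (fun x => Γ (f x)) (fun x => Γ' (f x) • F x) := by
  have hc : Continuous Γ' := by
    have : Γ' = deriv Γ := funext fun s => (hd s).deriv.symm
    rw [this]
    exact hΓ.continuous_deriv (by simp)
  have hi2 : LocallyIntegrableOn (fun x => Γ' (f x) • F x) Ω := by
    have : MemLp (fun x => Γ' (f x) • F x) 2 (volume.restrict Ω) := by
      refine hF2.of_le_mul (c := L) ((hc.comp_aestronglyMeasurable hf2.1).smul hF2.1)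
        (Eventually.of_forall fun x => ?_)
      rw [norm_smul]
      exact mul_le_mul_of_nonneg_right (hL _) (norm_nonneg _)
    exact locallyIntegrableOn_of_locallyIntegrable_restrict
      (this.locallyIntegrable (by norm_num))
  refine isWeakGradient_of_integral hi hi2 fun ψ hψ => ?_
  -- Only values on the support of `ψ` enter, and there `f` may be replaced by the compactly
  -- supported `χ f`.
  obtain ⟨χ, hχ, hχ1, -⟩ := exists_isTestFunction_one hΩ hψ.2.1 hψ.2.2
  have w := hf.univ_of_isTestFunction hχ
  have m1 := hχ.memLp_mul hΩ hf2
  have m2 := hχ.memLp_gradient_mul hΩ hf2 hF2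
  have hap : ∀ k : ℕ, ∃ φ : E n → ℝ, IsTestFunction univ φ ∧
      eLpNorm (fun x => φ x - χ x * f x) 2 volume ≤ ((k : ℝ≥0∞) + 1)⁻¹ ∧
      eLpNorm (fun x => gradient φ x - (χ x • F x + f x • gradient χ x)) 2 volume
        ≤ ((k : ℝ≥0∞) + 1)⁻¹ := fun k =>
    exists_isTestFunction_approx isOpen_univ w m1 m2 hχ.2.1 (subset_univ _)
      (fun x hx => by rw [image_eq_zero_of_notMem_tsupport hx, zero_mul])
      (ENNReal.inv_pos.2 (by simp))
  choose φ hφ a1 a2 using hap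
  have hz : Tendsto (fun k : ℕ => ((k : ℝ≥0∞) + 1)⁻¹) atTop (𝓝 0) := by
    have := ENNReal.tendsto_inv_nat_nhds_zero.comp (tendsto_add_atTop_nat 1)
    refine this.congr fun k => ?_
    simp
  have key := integral_comp_gradient_eq m1 m2 hφ
    (tendsto_of_tendsto_of_tendsto_of_le_of_le tendsto_const_nhds hz (fun _ => zero_le) a1)
    (tendsto_of_tendsto_of_tendsto_of_le_of_le tendsto_const_nhds hz (fun _ => zero_le) a2)
    hΓ hd hL (hψ.mono (subset_univ _))
  have e1 : ∀ x, Γ (χ x * f x) • gradient ψ x = Γ (f x) • gradient ψ x := fun x => by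
    by_cases hx : x ∈ tsupport ψ
    · rw [hχ1 x hx, one_mul]
    · rw [image_eq_zero_of_notMem_tsupport fun h => hx (tsupport_gradient_subset ψ h), smul_zero,
        smul_zero]
  have e2 : ∀ x, ψ x • Γ' (χ x * f x) • (χ x • F x + f x • gradient χ x)
      = ψ x • Γ' (f x) • F x := fun x => by
    by_cases hx : ψ x = 0
    · rw [hx, zero_smul, zero_smul]
    -- The set `ψ ≠ 0` is open and `χ = 1` on it, so `∇χ` vanishes wherever `ψ` does not.
    · have hloc : χ =ᶠ[𝓝 x] fun _ => 1 := by
        filter_upwards [hψ.1.continuous.continuousAt.eventually_ne hx] with y hy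
        exact hχ1 y (subset_tsupport _ hy)
      have hg : gradient χ x = 0 := by
        rw [hloc.gradient_eq]
        exact gradient_fun_const x 1
      rw [hg, hχ1 x (subset_tsupport _ hx), one_mul, one_smul, smul_zero, add_zero]
  simp only [e1, e2] at key
  exact key

end ChainRule

/-! ### The radial kernel and the derivative of radial means -/

section Kernel

/-- The radial potential `ζ(y) = exp (-1 / (1 - |y|²))` on the unit ball, extended by `0`. -/
def potential (y : E n) : ℝ := expNegInvGlue (1 - ‖y‖ ^ 2)

/-- The radial weight `η` with `∇ζ(y) = -η(y) y`. -/
def kernel (y : E n) : ℝ := 2 * ((1 - ‖y‖ ^ 2)⁻¹ ^ 2 * expNegInvGlue (1 - ‖y‖ ^ 2))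

/-- The dilation `z ↦ k ((z - x) / r)`. -/
def dilate (k : E n → ℝ) (x : E n) (r : ℝ) (z : E n) : ℝ := k (r⁻¹ • (z - x))

theorem contDiff_potential : ContDiff ℝ ∞ (potential (n := n)) :=
  expNegInvGlue.contDiff.comp (contDiff_const.sub (contDiff_norm_sq ℝ))

theorem contDiff_kernel : ContDiff ℝ ∞ (kernel (n := n)) := by
  have h := expNegInvGlue.contDiff_polynomial_eval_inv_mul (n := ⊤) (Polynomial.X ^ 2)
  have h2 : ContDiff ℝ ∞ fun x : ℝ => x⁻¹ ^ 2 * expNegInvGlue x := by simpa using h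
  exact contDiff_const.mul (h2.comp (contDiff_const.sub (contDiff_norm_sq ℝ)))

theorem one_sub_sq_nonpos {y : E n} (hy : 1 ≤ ‖y‖) : 1 - ‖y‖ ^ 2 ≤ 0 := by nlinarith

theorem potential_eq_zero {y : E n} (hy : 1 ≤ ‖y‖) : potential y = 0 :=
  expNegInvGlue.zero_of_nonpos (one_sub_sq_nonpos hy)

theorem kernel_eq_zero {y : E n} (hy : 1 ≤ ‖y‖) : kernel y = 0 := by
  rw [kernel, expNegInvGlue.zero_of_nonpos (one_sub_sq_nonpos hy), mul_zero, mul_zero]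

theorem potential_nonneg (y : E n) : 0 ≤ potential y := expNegInvGlue.nonneg _

theorem kernel_nonneg (y : E n) : 0 ≤ kernel y := by
  have := expNegInvGlue.nonneg (1 - ‖y‖ ^ 2)
  rw [kernel]
  positivity

theorem kernel_pos {y : E n} (hy : ‖y‖ < 1) : 0 < kernel y := by
  have h : 0 < 1 - ‖y‖ ^ 2 := by nlinarith [norm_nonneg y]
  have := expNegInvGlue.pos_of_pos h
  rw [kernel]
  positivity

theorem gradient_potential (y : E n) : gradient potential y = -(kernel y • y) := by
  have h1 : HasDerivAt expNegInvGlue ((1 - ‖y‖ ^ 2)⁻¹ ^ 2 * expNegInvGlue (1 - ‖y‖ ^ 2))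
      (1 - ‖y‖ ^ 2) := by
    have := expNegInvGlue.hasDerivAt_polynomial_eval_inv_mul 1 (1 - ‖y‖ ^ 2)
    simpa using! this
  have h2 : HasFDerivAt (fun z : E n => 1 - ‖z‖ ^ 2) (-(2 • (innerSL ℝ y))) y :=
    (hasStrictFDerivAt_norm_sq y).hasFDerivAt.const_sub 1
  have h3 := h1.comp_hasFDerivAt y h2
  have h4 : HasGradientAt potential (-(kernel y • y)) y := by
    rw [hasGradientAt_iff_hasFDerivAt]
    refine HasFDerivAt.congr_fderiv h3 ?_
    ext v
    simp [kernel]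
    ring
  exact h4.gradient

theorem tsupport_subset_of_eq_zero {k : E n → ℝ} (hk : ∀ y, 1 ≤ ‖y‖ → k y = 0) :
    tsupport k ⊆ Metric.closedBall 0 1 := by
  refine closure_minimal ?_ Metric.isClosed_closedBall
  intro y hy
  rw [mem_closedBall_zero_iff]
  by_contra h
  exact hy (hk y (not_le.1 h).le)

theorem hasCompactSupport_of_eq_zero {k : E n → ℝ} (hk : ∀ y, 1 ≤ ‖y‖ → k y = 0) :
    HasCompactSupport k :=
  (isCompact_closedBall 0 1).of_isClosed_subset (isClosed_tsupport _)
    (tsupport_subset_of_eq_zero hk)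

theorem dilate_eq_zero {k : E n → ℝ} (hk : ∀ y, 1 ≤ ‖y‖ → k y = 0) {x z : E n} {r : ℝ}
    (hr : 0 < r) (hz : z ∉ Metric.ball x r) : dilate k x r z = 0 := by
  refine hk _ ?_
  rw [norm_smul, norm_inv, Real.norm_of_nonneg hr.le, ← div_eq_inv_mul, le_div_iff₀ hr, one_mul]
  simpa [dist_eq_norm] using hz

theorem contDiff_dilate {k : E n → ℝ} (hk : ContDiff ℝ ∞ k) (x : E n) (r : ℝ) :
    ContDiff ℝ ∞ (dilate k x r) :=
  hk.comp ((contDiff_id.sub contDiff_const).const_smul r⁻¹)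

theorem isTestFunction_dilate {Ω : Set (E n)} {k : E n → ℝ} (hk : ContDiff ℝ ∞ k)
    (hk0 : ∀ y, 1 ≤ ‖y‖ → k y = 0) {x : E n} {r : ℝ} (hr : 0 < r)
    (h : Metric.closedBall x r ⊆ Ω) : IsTestFunction Ω (dilate k x r) := by
  have hs : tsupport (dilate k x r) ⊆ Metric.closedBall x r := by
    refine closure_minimal ?_ Metric.isClosed_closedBall
    intro z hz
    by_contra h'
    exact hz (dilate_eq_zero hk0 hr fun h => h' (Metric.ball_subset_closedBall h))
  exact ⟨contDiff_dilate hk x r, (isCompact_closedBall x r).of_isClosed_subset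
    (isClosed_tsupport _) hs, hs.trans h⟩

theorem hasFDerivAt_dilate {k : E n → ℝ} (hk : Differentiable ℝ k) (x : E n) (r : ℝ) (z : E n) :
    HasFDerivAt (dilate k x r) (r⁻¹ • fderiv ℝ k (r⁻¹ • (z - x))) z := by
  have h1 : HasFDerivAt (fun z : E n => r⁻¹ • (z - x)) (r⁻¹ • ContinuousLinearMap.id ℝ (E n)) z :=
    ((hasFDerivAt_id z).sub_const x).const_smul r⁻¹
  have h2 := (hk (r⁻¹ • (z - x))).hasFDerivAt.comp z h1
  refine h2.congr_fderiv ?_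
  ext v
  simp

theorem gradient_dilate {k : E n → ℝ} (hk : Differentiable ℝ k) (x : E n) (r : ℝ) (z : E n) :
    gradient (dilate k x r) z = r⁻¹ • gradient k (r⁻¹ • (z - x)) := by
  simp only [gradient]
  rw [(hasFDerivAt_dilate hk x r z).fderiv]
  simp

theorem integral_dilate (k : E n → ℝ) (x : E n) {r : ℝ} (hr : 0 < r) :
    ∫ z, dilate k x r z = r ^ n * ∫ y, k y := by
  have h1 : ∫ z, dilate k x r z = ∫ z, k (r⁻¹ • z) :=
    integral_sub_right_eq_self (fun z => k (r⁻¹ • z)) x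
  rw [h1, Measure.integral_comp_inv_smul]
  simp [abs_of_pos hr]

/-- The mean of `f` over the ball of radius `r` about `x` with respect to the weight `η`, up to
the normalization of `η`. -/
def radialMean (Ω : Set (E n)) (f : E n → ℝ) (x : E n) (r : ℝ) : ℝ :=
  (r ^ n)⁻¹ * ∫ z in Ω, dilate kernel x r z * f z

variable {Ω : Set (E n)} {f : E n → ℝ} {F : E n → E n}

/-- This is the divergence theorem for the field `η(y) y = -∇ζ(y)`, `y = (z - x)/r`. Each coordinate
`κ j` is a test function, and summing over `j` produces the divergence `n η + ∇η · y` on the left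
and `F · ∇ζ_r` on the right. -/
theorem integral_mul_dilate_kernel (hf : IsWeakGradient Ω f F) {x : E n} {r : ℝ} (hr : 0 < r)
    (h : Metric.closedBall x r ⊆ Ω) :
    ∫ z in Ω, (r⁻¹ * (n * dilate kernel x r z
        + fderiv ℝ kernel (r⁻¹ • (z - x)) (r⁻¹ • (z - x)))) * f z
      = r * ∫ z in Ω, inner ℝ (F z) (gradient (dilate potential x r) z) := by
  set e : Fin n → E n := fun j => EuclideanSpace.single j 1
  have hco : ∀ j : Fin n, ContDiff ℝ ∞ fun y : E n => y j := fun j => by fun_prop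
  have hkd : Differentiable ℝ (kernel (n := n)) := contDiff_kernel.differentiable (by simp)
  have hpd : Differentiable ℝ (potential (n := n)) := contDiff_potential.differentiable (by simp)
  set κ : Fin n → E n → ℝ := fun j y => kernel y * y j with hκ
  have hκs : ∀ j, ContDiff ℝ ∞ (κ j) := fun j => contDiff_kernel.mul (hco j)
  have hκ0 : ∀ j y, 1 ≤ ‖y‖ → κ j y = 0 := fun j y hy => by
    simp only [hκ, kernel_eq_zero hy, zero_mul]
  have hT : ∀ j, IsTestFunction Ω (dilate (κ j) x r) := fun j =>
    isTestFunction_dilate (hκs j) (hκ0 j) hr h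
  have hder : ∀ j y, fderiv ℝ (κ j) y (e j) = kernel y + y j * fderiv ℝ kernel y (e j) := by
    intro j y
    have hp : HasFDerivAt (fun y : E n => y j) (EuclideanSpace.proj (𝕜 := ℝ) j) y :=
      (EuclideanSpace.proj (𝕜 := ℝ) j).hasFDerivAt
    have hm : HasFDerivAt (κ j) _ y := (hkd y).hasFDerivAt.mul hp
    rw [hm.fderiv]
    simp [e]
  have hj : ∀ j, ∫ z in Ω, f z * (r⁻¹ * fderiv ℝ (κ j) (r⁻¹ • (z - x)) (e j))
      = -∫ z in Ω, dilate (κ j) x r z * F z j := by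
    intro j
    have h1 := hf.2.2 _ (hT j)
    have i1 := ((hT j).integrable_smul_gradient hf.1).integrableOn (s := Ω)
    have i2 := ((hT j).integrable_smul hf.2.1).integrableOn (s := Ω)
    have h2 := congrArg (fun v => inner ℝ (e j) v) h1
    simp only [inner_neg_right] at h2
    rw [← integral_inner i1, ← integral_inner i2] at h2
    simp only [real_inner_smul_right, inner_gradient_right, conj_trivial,
      (hasFDerivAt_dilate ((hκs j).differentiable (by simp)) x r _).fderiv] at h2
    simpa [e, EuclideanSpace.inner_single_left] using h2
  have i3 : ∀ j, IntegrableOn (fun z => f z * (r⁻¹ * fderiv ℝ (κ j) (r⁻¹ • (z - x)) (e j))) Ω := by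
    intro j
    have i1 := (((hT j).integrable_smul_gradient hf.1).integrableOn (s := Ω)).const_inner
      (𝕜 := ℝ) (e j)
    simp only [real_inner_smul_right, inner_gradient_right, conj_trivial,
      (hasFDerivAt_dilate ((hκs j).differentiable (by simp)) x r _).fderiv] at i1
    simpa using! i1
  have i4 : ∀ j, IntegrableOn (fun z => dilate (κ j) x r z * F z j) Ω := by
    intro j
    have i1 := (((hT j).integrable_smul hf.2.1).integrableOn (s := Ω)).const_inner
      (𝕜 := ℝ) (e j)
    simpa [e, real_inner_smul_right, EuclideanSpace.inner_single_left] using! i1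
  have hs : ∀ y : E n, ∑ j, fderiv ℝ (κ j) y (e j) = n * kernel y + fderiv ℝ kernel y y := by
    intro y
    simp only [hder, Finset.sum_add_distrib]
    have hy : y = ∑ j, y j • e j := by
      have := (EuclideanSpace.basisFun (Fin n) ℝ).sum_repr y
      simpa [e] using this.symm
    conv_rhs => rw [show fderiv ℝ kernel y y = fderiv ℝ kernel y (∑ j, y j • e j) by rw [← hy]]
    simp
  have hsum := Finset.sum_congr rfl fun j (_ : j ∈ Finset.univ) => hj j
  rw [← integral_finsetSum _ fun j _ => i3 j, Finset.sum_neg_distrib,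
    ← integral_finsetSum _ fun j _ => i4 j] at hsum
  have e1 : ∀ z, ∑ j, f z * (r⁻¹ * fderiv ℝ (κ j) (r⁻¹ • (z - x)) (e j))
      = (r⁻¹ * (n * dilate kernel x r z
        + fderiv ℝ kernel (r⁻¹ • (z - x)) (r⁻¹ • (z - x)))) * f z := fun z => by
    rw [← Finset.mul_sum, ← Finset.mul_sum, hs, mul_comm]
    rfl
  have e2 : ∀ z, ∑ j, dilate (κ j) x r z * F z j
      = -(r * inner ℝ (F z) (gradient (dilate potential x r) z)) := fun z => by
    rw [gradient_dilate hpd, gradient_potential]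
    simp only [dilate, hκ, PiLp.inner_apply]
    simp only [smul_neg, PiLp.neg_apply, PiLp.smul_apply, smul_eq_mul, RCLike.inner_apply,
      conj_trivial]
    rw [Finset.mul_sum, ← Finset.sum_neg_distrib]
    refine Finset.sum_congr rfl fun j _ => ?_
    field_simp
  simp only [e1, e2] at hsum
  rw [hsum, integral_neg, neg_neg, integral_const_mul]

theorem exists_bound_of_eq_zero {k : E n → ℝ} (hk : Continuous k)
    (hk0 : ∀ y, 1 ≤ ‖y‖ → k y = 0) : ∃ C : ℝ, 0 ≤ C ∧ ∀ y, |k y| ≤ C := by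
  obtain ⟨C, hC⟩ := (hasCompactSupport_of_eq_zero hk0).exists_bound_of_continuous hk
  exact ⟨C, (norm_nonneg _).trans (hC 0), hC⟩

theorem hasDerivAt_integral_dilate_kernel (hf : IntegrableOn f Ω) (x : E n) {r : ℝ} (hr : 0 < r) :
    IntegrableOn (fun z => (-r⁻¹ * fderiv ℝ kernel (r⁻¹ • (z - x)) (r⁻¹ • (z - x))) * f z) Ω ∧
    HasDerivAt (fun r => ∫ z in Ω, dilate kernel x r z * f z)
      (∫ z in Ω, (-r⁻¹ * fderiv ℝ kernel (r⁻¹ • (z - x)) (r⁻¹ • (z - x))) * f z) r := by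
  have hkd : Differentiable ℝ (kernel (n := n)) := contDiff_kernel.differentiable (by simp)
  have hkc : Continuous (fderiv ℝ (kernel (n := n))) := contDiff_kernel.continuous_fderiv (by simp)
  have hDc : Continuous fun y : E n => fderiv ℝ kernel y y := hkc.clm_apply continuous_id
  -- The derivative is supported in the closed unit ball; any radius above `1` would serve.
  have hD0 : ∀ y : E n, 2 ≤ ‖y‖ → fderiv ℝ kernel y y = 0 := by
    intro y hy
    have : y ∉ tsupport (fderiv ℝ (kernel (n := n))) := fun h => by
      have := tsupport_subset_of_eq_zero (fun y => kernel_eq_zero)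
        (tsupport_fderiv_subset ℝ h)
      rw [mem_closedBall_zero_iff] at this
      linarith
    rw [image_eq_zero_of_notMem_tsupport this]
    rfl
  obtain ⟨M, hM⟩ : ∃ M, ∀ y : E n, ‖fderiv ℝ kernel y y‖ ≤ M := by
    refine HasCompactSupport.exists_bound_of_continuous ?_ hDc
    refine HasCompactSupport.of_support_subset_isCompact (isCompact_closedBall 0 2) ?_
    intro y hy
    rw [mem_closedBall_zero_iff]
    by_contra h
    exact hy (hD0 y (not_le.1 h).le)
  obtain ⟨B, -, hB⟩ := exists_bound_of_eq_zero (n := n) contDiff_kernel.continuous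
    (fun y => kernel_eq_zero)
  have hcd : ∀ s : ℝ, Continuous fun z : E n => dilate kernel x s z := fun s =>
    (contDiff_dilate contDiff_kernel x s).continuous
  have hmeas : ∀ s : ℝ, AEStronglyMeasurable (fun z => dilate kernel x s z * f z)
      (volume.restrict Ω) := fun s => (hcd s).aestronglyMeasurable.mul hf.1
  refine hasDerivAt_integral_of_dominated_loc_of_deriv_le (μ := volume.restrict Ω)
    (F := fun r z => dilate kernel x r z * f z)
    (F' := fun r z => (-r⁻¹ * fderiv ℝ kernel (r⁻¹ • (z - x)) (r⁻¹ • (z - x))) * f z)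
    -- `2 / r` bounds `1 / s` for `|s - r| < r / 2`, and `M` bounds the radial derivative of the
    -- kernel.
    (bound := fun z => (2 / r * M) * |f z|)
    (Metric.ball_mem_nhds r (half_pos hr)) (Eventually.of_forall hmeas) ?_ ?_ ?_ ?_ ?_
  · refine hf.bdd_mul (c := B) (hcd r).aestronglyMeasurable (Eventually.of_forall fun z => hB _)
  · refine AEStronglyMeasurable.mul ?_ hf.1
    exact (continuous_const.mul (hDc.comp (g := fun y : E n => fderiv ℝ kernel y y)
      (f := fun z : E n => r⁻¹ • (z - x)) (by fun_prop))).aestronglyMeasurable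
  · refine Eventually.of_forall fun z s hs => ?_
    have hs' : r / 2 < s := by
      rw [Metric.mem_ball, Real.dist_eq, abs_lt] at hs
      linarith
    have hs0 : 0 < s := by linarith
    rw [norm_mul, norm_mul, norm_neg, norm_inv, Real.norm_of_nonneg hs0.le, Real.norm_eq_abs (f z)]
    refine mul_le_mul_of_nonneg_right ?_ (abs_nonneg _)
    refine mul_le_mul ?_ (hM _) (norm_nonneg _) (by positivity)
    rw [inv_le_comm₀ hs0 (by positivity), inv_div]
    exact hs'.le
  · exact hf.abs.const_mul _
  · refine Eventually.of_forall fun z s hs => ?_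
    have hs' : r / 2 < s := by
      rw [Metric.mem_ball, Real.dist_eq, abs_lt] at hs
      linarith
    have hs0 : s ≠ 0 := by linarith
    have h1 : HasDerivAt (fun s : ℝ => s⁻¹ • (z - x)) ((-(s ^ 2)⁻¹) • (z - x)) s :=
      (hasDerivAt_inv hs0).smul_const (z - x)
    have h2 := (hkd (s⁻¹ • (z - x))).hasFDerivAt.comp_hasDerivAt s h1
    refine HasDerivAt.mul_const ?_ (f z)
    refine h2.congr_deriv ?_
    simp only [map_smul, smul_eq_mul]
    field_simp

/-- Differentiating the normalization gives the term `n η`, differentiating the dilation gives `∇η ·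
y`; together they form minus the divergence in `integral_mul_dilate_kernel`. Hence the derivative
has the sign of the distributional Laplacian of `f` tested against the nonnegative `ζ_r`. -/
theorem hasDerivAt_radialMean (hf : IsWeakGradient Ω f F) (hfi : IntegrableOn f Ω) {x : E n}
    {r : ℝ} (hr : 0 < r) (h : Metric.closedBall x r ⊆ Ω) :
    HasDerivAt (radialMean Ω f x)
      (-((r ^ n)⁻¹ * r * ∫ z in Ω, inner ℝ (F z) (gradient (dilate potential x r) z))) r := by
  obtain ⟨j0, h1⟩ := hasDerivAt_integral_dilate_kernel hfi x hr
  have h2 : HasDerivAt (fun r : ℝ => (r ^ n)⁻¹) (-(n * r⁻¹) * (r ^ n)⁻¹) r := by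
    refine ((hasDerivAt_pow n r).inv (by positivity)).congr_deriv ?_
    -- The power rule carries the truncated exponent `n - 1`, so `n = 0` is separated.
    rcases Nat.eq_zero_or_pos n with hn | hn
    · simp [hn]
    · obtain ⟨k, hk⟩ := Nat.exists_eq_succ_of_ne_zero hn.ne'
      rw [hk, Nat.succ_sub_one, Nat.succ_eq_add_one]
      field_simp
      ring
  refine (h2.mul h1).congr_deriv ?_
  have h3 := integral_mul_dilate_kernel hf hr h
  have hT := isTestFunction_dilate contDiff_kernel (fun y => kernel_eq_zero) hr h
  have j1 : IntegrableOn (fun z => n * r⁻¹ * (dilate kernel x r z * f z)) Ω :=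
    ((hT.integrable_smul hf.1).integrableOn (s := Ω)).const_mul _
  have j2 : IntegrableOn (fun z => (r⁻¹ * fderiv ℝ kernel (r⁻¹ • (z - x)) (r⁻¹ • (z - x))) * f z)
      Ω := by
    simpa using! j0.neg
  have e : ∀ z, (r⁻¹ * (n * dilate kernel x r z
        + fderiv ℝ kernel (r⁻¹ • (z - x)) (r⁻¹ • (z - x)))) * f z
      = n * r⁻¹ * (dilate kernel x r z * f z)
        + (r⁻¹ * fderiv ℝ kernel (r⁻¹ • (z - x)) (r⁻¹ • (z - x))) * f z := fun z => by ring
  simp only [e] at h3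
  rw [integral_add j1 j2, integral_const_mul] at h3
  simp only [neg_mul, integral_neg]
  rw [mul_assoc _ r, ← h3]
  ring

end Kernel

/-! ### One-component perturbations and the first variation of the energy -/

section Perturbation

variable {Ω : Set (E n)} {Q : E n → ℝ} {g u : E n → E m} {p : E n → ℝ} {P : E n → E n}

theorem integrable_inner_of_memLp {α V : Type*} [MeasurableSpace α] {μ : Measure α}
    [NormedAddCommGroup V] [InnerProductSpace ℝ V] {F G : α → V} (hF : MemLp F 2 μ)
    (hG : MemLp G 2 μ) : Integrable (fun x => inner ℝ (F x) (G x)) μ := by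
  refine ((integrable_norm_sq hF).add (integrable_norm_sq hG)).mono' (hF.1.inner hG.1)
    (Eventually.of_forall fun x => ?_)
  have := norm_inner_le_norm (𝕜 := ℝ) (F x) (G x)
  simp only [Pi.add_apply]
  nlinarith [sq_nonneg (‖F x‖ - ‖G x‖), sq_nonneg (‖F x‖ + ‖G x‖)]

theorem MemH10.const_mul (hΩ : IsOpen Ω) (hp : MemH10 Ω p) {t : ℝ} (ht : 0 < t) :
    MemH10 Ω fun x => t * p x := by
  have hP := hp.1.isWeakGradient
  refine ⟨hp.1.const_mul t, fun η hη => ?_⟩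
  obtain ⟨φ, hφ, hlt⟩ := hp.2 (η / t) (by positivity)
  refine ⟨fun x => t * φ x, hφ.const_mul t, ?_⟩
  have e : (fun x => t * p x - t * φ x) = fun x => t * (p x - φ x) := by
    ext x
    ring
  have hd := hP.sub (isWeakGradient_of_contDiff hφ.1 (Ω := Ω))
  rw [e, (hd.const_mul t).h1NormSq_eq hΩ]
  rw [hd.h1NormSq_eq hΩ] at hlt
  have e2 : ∀ x, (t * (p x - φ x)) ^ 2 + ‖t • (weakGradient Ω p x - gradient φ x)‖ ^ 2
      = t ^ 2 * ((p x - φ x) ^ 2 + ‖weakGradient Ω p x - gradient φ x‖ ^ 2) := fun x => by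
    rw [norm_smul, Real.norm_of_nonneg ht.le]
    ring
  simp only [e2]
  rw [integral_const_mul, Real.sqrt_mul (sq_nonneg t), Real.sqrt_sq ht.le]
  rwa [lt_div_iff₀' ht] at hlt

/-- The function obtained from `u` by adding `p` to its `i`-th component. -/
def perturb (u : E n → E m) (i : Fin m) (p : E n → ℝ) (x : E n) : E m :=
  u x + p x • EuclideanSpace.single i 1

theorem perturb_apply (u : E n → E m) (i : Fin m) (p : E n → ℝ) (x : E n) (j : Fin m) :
    perturb u i p x j = u x j + (if j = i then 1 else 0) * p x := by
  by_cases h : j = i <;> simp [perturb, h]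

theorem perturb_apply_self (u : E n → E m) (i : Fin m) (p : E n → ℝ) (x : E n) :
    perturb u i p x i = u x i + p x := by
  simp [perturb]

theorem perturb_of_eq_zero (u : E n → E m) (i : Fin m) {x : E n} (h : p x = 0) :
    perturb u i p x = u x := by
  simp [perturb, h]

theorem Admissible.perturb (hΩ : IsOpen Ω) (hu : Admissible Ω g u) {i : Fin m} (hp : MemH10 Ω p)
    (h0 : ∀ᵐ x ∂volume.restrict Ω, 0 ≤ u x i + p x) : Admissible Ω g (perturb u i p) := by
  have hz : MemH10 Ω (fun _ => (0 : ℝ)) := by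
    have h1 : MemH1 Ω (fun _ => (0 : ℝ)) := by simpa using hp.1.const_mul 0
    exact h1.memH10_of_compact hΩ isCompact_empty (empty_subset _) fun _ _ => rfl
  refine ⟨fun j => ?_, fun j => ?_, fun j => ?_⟩
  · simp only [perturb_apply]
    exact (hu.1 j).add (hp.1.const_mul _)
  · by_cases h : j = i
    · have := (hu.2.1 j).add hΩ hp
      simpa [perturb_apply, h, sub_add_eq_add_sub] using! this
    · have := (hu.2.1 j).add hΩ hz
      simpa [perturb_apply, h] using! this
  · by_cases h : j = i
    · filter_upwards [h0] with x hx
      rw [h, perturb_apply_self]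
      exact hx
    · filter_upwards [hu.2.2 j] with x hx
      simpa [perturb_apply, h] using hx

theorem MemH1Vec.aestronglyMeasurable (hu : MemH1Vec Ω u) :
    AEStronglyMeasurable u (volume.restrict Ω) := by
  have h : AEMeasurable (fun x => (WithLp.toLp 2 fun i => u x i : E m)) (volume.restrict Ω) :=
    (WithLp.measurable_toLp 2 (Fin m → ℝ)).comp_aemeasurable
      (aemeasurable_pi_lambda _ fun i => (hu i).1.1.aemeasurable)
  exact h.aestronglyMeasurable

theorem posChar_nonneg (u : E n → E m) (x : E n) : 0 ≤ posChar u x :=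
  indicator_nonneg (fun _ _ => zero_le_one) x

theorem posChar_le_one (u : E n → E m) (x : E n) : posChar u x ≤ 1 :=
  indicator_le' (fun _ _ => le_rfl) (fun _ _ => zero_le_one) x

theorem posChar_of_pos {u : E n → E m} {x : E n} (h : 0 < ‖u x‖) : posChar u x = 1 :=
  indicator_of_mem (s := {x | 0 < ‖u x‖}) h _

theorem posChar_congr {v : E n → E m} {x : E n} (h : u x = v x) : posChar u x = posChar v x := by
  simp only [posChar, indicator, mem_ofPred_eq, h]

theorem norm_pos_of_apply_pos {v : E m} {i : Fin m} (h : 0 < v i) : 0 < ‖v‖ := by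
  refine norm_pos_iff.2 ?_
  rintro rfl
  simp at h

theorem MemH1Vec.aestronglyMeasurable_posChar (hu : MemH1Vec Ω u) :
    AEStronglyMeasurable (posChar u) (volume.restrict Ω) := by
  have h := hu.aestronglyMeasurable.norm.aemeasurable
  have hm : Measurable (indicator (Ioi (0 : ℝ)) fun _ => (1 : ℝ)) :=
    measurable_const.indicator measurableSet_Ioi
  exact (hm.comp_aemeasurable h).aestronglyMeasurable

theorem MemH1Vec.integrable_posChar (hb : Bornology.IsBounded Ω) (hu : MemH1Vec Ω u)
    (hQm : AEMeasurable Q (volume.restrict Ω)) {Qmax : ℝ}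
    (hQ : ∀ᵐ x ∂volume.restrict Ω, |Q x| ≤ Qmax) :
    IntegrableOn (fun x => Q x ^ 2 * posChar u x) Ω := by
  have : IsFiniteMeasure (volume.restrict Ω) := ⟨by simpa using hb.measure_lt_top⟩
  refine Integrable.of_bound ((hQm.pow_const 2).aestronglyMeasurable.mul
    hu.aestronglyMeasurable_posChar) (Qmax ^ 2) ?_
  filter_upwards [hQ] with x hx
  rw [norm_mul, Real.norm_of_nonneg (posChar_nonneg u x), norm_pow, Real.norm_eq_abs]
  have h1 : |Q x| ^ 2 ≤ Qmax ^ 2 := by gcongr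
  nlinarith [posChar_nonneg u x, posChar_le_one u x, sq_nonneg |Q x|]

/-- The energy after adding `p` to the `i`-th component. -/
theorem J_perturb (hΩ : IsOpen Ω) (hb : Bornology.IsBounded Ω) (hu : MemH1Vec Ω u)
    (hQm : AEMeasurable Q (volume.restrict Ω)) {Qmax : ℝ}
    (hQ : ∀ᵐ x ∂volume.restrict Ω, |Q x| ≤ Qmax) (i : Fin m)
    (hp : MemLp p 2 (volume.restrict Ω)) (hP : IsWeakGradient Ω p P)
    (hP2 : MemLp P 2 (volume.restrict Ω)) :
    J Ω Q (perturb u i p) = J Ω Q u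
      + (2 * ∫ x in Ω, inner ℝ (weakGradient Ω (fun y => u y i) x) (P x))
      + (∫ x in Ω, ‖P x‖ ^ 2)
      + ∫ x in Ω, Q x ^ 2 * (posChar (perturb u i p) x - posChar u x) := by
  have hpu : MemH1Vec Ω (perturb u i p) := fun j => by
    simp only [perturb_apply]
    exact (hu j).add (MemH1.const_mul ⟨hp, P, hP, hP2⟩ _)
  have hw : ∀ j, weakGradient Ω (fun y => perturb u i p y j) =ᵐ[volume.restrict Ω]
      fun x => weakGradient Ω (fun y => u y j) x + (if j = i then (1 : ℝ) else 0) • P x := fun j => by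
    simp only [perturb_apply]
    exact ((hu j).isWeakGradient.add (hP.const_mul _)).weakGradient_ae_eq hΩ
  have hF2 : ∀ j, MemLp (weakGradient Ω (fun y => u y j)) 2 (volume.restrict Ω) := fun j =>
    (hu j).memLp_weakGradient hΩ
  have i1 : IntegrableOn (fun x => ∑ j, ‖weakGradient Ω (fun y => u y j) x‖ ^ 2) Ω :=
    integrable_finsetSum _ fun j _ => integrable_norm_sq (hF2 j)
  have i2 : IntegrableOn (fun x => inner ℝ (weakGradient Ω (fun y => u y i) x) (P x)) Ω :=
    integrable_inner_of_memLp (hF2 i) hP2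
  have i3 : IntegrableOn (fun x => ‖P x‖ ^ 2) Ω := integrable_norm_sq hP2
  have i4 := hu.integrable_posChar hb hQm hQ
  have i5 := hpu.integrable_posChar hb hQm hQ
  have hae : (fun x => (∑ j, ‖weakGradient Ω (fun y => perturb u i p y j) x‖ ^ 2)
      + Q x ^ 2 * posChar (perturb u i p) x) =ᵐ[volume.restrict Ω] fun x =>
      ((((∑ j, ‖weakGradient Ω (fun y => u y j) x‖ ^ 2) + Q x ^ 2 * posChar u x)
      + 2 * inner ℝ (weakGradient Ω (fun y => u y i) x) (P x)) + ‖P x‖ ^ 2)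
      + Q x ^ 2 * (posChar (perturb u i p) x - posChar u x) := by
    -- Only the `i`-th square changes; the others cancel in the expansion.
    filter_upwards [eventually_all.2 hw] with x hx
    have h1 : ∀ j, ‖weakGradient Ω (fun y => perturb u i p y j) x‖ ^ 2
        = ‖weakGradient Ω (fun y => u y j) x‖ ^ 2 + (if j = i then
          (2 * inner ℝ (weakGradient Ω (fun y => u y i) x) (P x) + ‖P x‖ ^ 2) else 0) := fun j => by
      rw [hx j]
      by_cases h : j = i
      · subst h
        simp only [if_true, one_smul]
        rw [norm_add_sq_real]
        ring
      · simp [h]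
    simp only [h1, Finset.sum_add_distrib, Finset.sum_ite_eq', Finset.mem_univ, if_true]
    ring
  have i6 : IntegrableOn (fun x => Q x ^ 2 * (posChar (perturb u i p) x - posChar u x)) Ω := by
    simp only [mul_sub]
    exact i5.sub i4
  have i7 : IntegrableOn (fun x => (∑ j, ‖weakGradient Ω (fun y => u y j) x‖ ^ 2)
    + Q x ^ 2 * posChar u x) Ω := i1.add i4
  have i8 : IntegrableOn (fun x => ((∑ j, ‖weakGradient Ω (fun y => u y j) x‖ ^ 2)
    + Q x ^ 2 * posChar u x) + 2 * inner ℝ (weakGradient Ω (fun y => u y i) x) (P x)) Ω :=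
    i7.add (i2.const_mul 2)
  have i9 : IntegrableOn (fun x => (((∑ j, ‖weakGradient Ω (fun y => u y j) x‖ ^ 2)
    + Q x ^ 2 * posChar u x) + 2 * inner ℝ (weakGradient Ω (fun y => u y i) x) (P x))
    + ‖P x‖ ^ 2) Ω := i8.add i3
  rw [J, integral_congr_ae hae, integral_add i9 i6, integral_add i8 i3,
    integral_add i7 (i2.const_mul 2), integral_const_mul]
  rfl

theorem h1Norm_sub_perturb (hΩ : IsOpen Ω) (i : Fin m) (hP : IsWeakGradient Ω p P) :
    h1Norm Ω (fun x => u x - perturb u i p x)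
      = Real.sqrt (∫ x in Ω, (p x ^ 2 + ‖P x‖ ^ 2)) := by
  have hj : ∀ j, h1NormSq Ω (fun x => (u x - perturb u i p x) j)
      = if j = i then ∫ x in Ω, (p x ^ 2 + ‖P x‖ ^ 2) else 0 := fun j => by
    have e : (fun x => (u x - perturb u i p x) j) = fun x => (if j = i then (-1 : ℝ) else 0) * p x := by
      ext x
      rw [PiLp.sub_apply, perturb_apply]
      split_ifs <;> ring
    rw [e, (hP.const_mul _).h1NormSq_eq hΩ]
    by_cases h : j = i <;> simp [h]
  rw [h1Norm, Finset.sum_congr rfl fun j _ => hj j]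
  simp

/-- First variation along a direction which does not change the positivity set. -/
theorem first_variation_nonneg (hΩ : IsOpen Ω) (hb : Bornology.IsBounded Ω)
    (hQm : AEMeasurable Q (volume.restrict Ω)) {Qmax : ℝ}
    (hQ : ∀ᵐ x ∂volume.restrict Ω, |Q x| ≤ Qmax) (hu : Admissible Ω g u) {ε : ℝ} (hε : 0 < ε)
    (hmin : ∀ v, Admissible Ω g v → d Ω u v < ε → J Ω Q u ≤ J Ω Q v) (i : Fin m)
    (hp : MemH10 Ω p) (hP : IsWeakGradient Ω p P) (hP2 : MemLp P 2 (volume.restrict Ω))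
    {t₀ : ℝ} (ht₀ : 0 < t₀)
    (h0 : ∀ t, 0 < t → t < t₀ → ∀ᵐ x ∂volume.restrict Ω, 0 ≤ u x i + t * p x)
    (h1 : ∀ t, 0 < t → t < t₀ → ∀ᵐ x ∂volume.restrict Ω,
      posChar (perturb u i fun y => t * p y) x = posChar u x) :
    0 ≤ ∫ x in Ω, inner ℝ (weakGradient Ω (fun y => u y i) x) (P x) := by
  set A := ∫ x in Ω, inner ℝ (weakGradient Ω (fun y => u y i) x) (P x) with hA
  set B := ∫ x in Ω, ‖P x‖ ^ 2 with hB
  set N := ∫ x in Ω, (p x ^ 2 + ‖P x‖ ^ 2) with hN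
  -- The positivity set is unchanged, so the distance to the competitor is exactly `t √N` and the
  -- energy difference is `t (2A + t B)`. Dividing by `t` and letting `t → 0` gives `A ≥ 0`.
  have key : ∀ t, 0 < t → t < t₀ → t * Real.sqrt N < ε → 0 ≤ 2 * A + t * B := by
    intro t ht ht' htN
    have hPt := hP.const_mul t
    have hPt2 : MemLp (fun x => t • P x) 2 (volume.restrict Ω) := hP2.const_smul t
    have hadm := hu.perturb hΩ (hp.const_mul hΩ ht) (h0 t ht ht')
    have hJ := J_perturb hΩ hb hu.1 hQm hQ i (hp.const_mul hΩ ht).1.1 hPt hPt2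
    have hz1 : ∫ x in Ω, Q x ^ 2 * (posChar (perturb u i fun x => t * p x) x - posChar u x) = 0 := by
      refine integral_eq_zero_of_ae ?_
      filter_upwards [h1 t ht ht'] with x hx
      rw [hx, sub_self, mul_zero]
      rfl
    have hz2 : ∫ x in Ω, |posChar u x - posChar (perturb u i fun x => t * p x) x| = 0 := by
      refine integral_eq_zero_of_ae ?_
      filter_upwards [h1 t ht ht'] with x hx
      rw [hx, sub_self, abs_zero]
      rfl
    have hd : d Ω u (perturb u i fun x => t * p x) < ε := by
      rw [d, hz2, add_zero, h1Norm_sub_perturb hΩ i hPt]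
      have e2 : ∀ x, (t * p x) ^ 2 + ‖t • P x‖ ^ 2 = t ^ 2 * (p x ^ 2 + ‖P x‖ ^ 2) := fun x => by
        rw [norm_smul, Real.norm_of_nonneg ht.le]
        ring
      simp only [e2]
      rw [integral_const_mul, Real.sqrt_mul (sq_nonneg t), Real.sqrt_sq ht.le]
      exact htN
    have hle := hmin _ hadm hd
    rw [hJ, hz1] at hle
    simp only [real_inner_smul_right, norm_smul, mul_pow, Real.norm_eq_abs, sq_abs,
      integral_const_mul] at hle
    have : 0 ≤ t * (2 * A + t * B) := by linarith
    exact nonneg_of_mul_nonneg_right this ht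
  have hlim : Tendsto (fun t : ℝ => 2 * A + t * B) (𝓝[>] 0) (𝓝 (2 * A)) := by
    have : ContinuousAt (fun t : ℝ => 2 * A + t * B) 0 := by fun_prop
    have h := this.tendsto.mono_left (nhdsWithin_le_nhds (s := Ioi 0))
    simpa using h
  have hev : ∀ᶠ t in 𝓝[>] (0 : ℝ), 0 ≤ 2 * A + t * B := by
    have h2 : ∀ᶠ t in 𝓝[>] (0 : ℝ), t * Real.sqrt N < ε := by
      have : ContinuousAt (fun t : ℝ => t * Real.sqrt N) 0 := by fun_prop
      exact (this.eventually_lt_const (by simpa using hε)).filter_mono nhdsWithin_le_nhds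
    have h3 : ∀ᶠ t in 𝓝[>] (0 : ℝ), t < t₀ :=
      (eventually_lt_nhds ht₀).filter_mono nhdsWithin_le_nhds
    filter_upwards [self_mem_nhdsWithin, h2, h3] with t ht h2 h3 using key t ht h3 h2
  have := ge_of_tendsto hlim hev
  linarith

end Perturbation

/-! ### Regularized subharmonicity and monotonicity criteria for radial means -/

section Minimizers

/-- `u` minimizes `J` among the admissible functions at distance less than `ε` from `u`. -/
structure IsMinimizerWithin (Ω : Set (E n)) (Q : E n → ℝ) (Qmax : ℝ) (g u : E n → E m) (ε : ℝ) :
    Prop where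
  isOpen : IsOpen Ω
  isBounded : Bornology.IsBounded Ω
  aemeasurable : AEMeasurable Q (volume.restrict Ω)
  pos : 0 < Qmax
  abs_le : ∀ᵐ x ∂volume.restrict Ω, |Q x| ≤ Qmax
  admissible : Admissible Ω g u
  eps_pos : 0 < ε
  le : ∀ v, Admissible Ω g v → d Ω u v < ε → J Ω Q u ≤ J Ω Q v

variable {Ω : Set (E n)} {Q : E n → ℝ} {Qmax ε : ℝ} {g u : E n → E m}

theorem sqrt_sq_add_sq_pos (s : ℝ) {δ : ℝ} (hδ : 0 < δ) : 0 < Real.sqrt (s ^ 2 + δ ^ 2) :=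
  Real.sqrt_pos.2 (by positivity)

theorem contDiff_sqrt_sq_add_sq {δ : ℝ} (hδ : 0 < δ) :
    ContDiff ℝ ∞ fun s : ℝ => Real.sqrt (s ^ 2 + δ ^ 2) :=
  ((contDiff_id.pow 2).add contDiff_const).sqrt fun s => by positivity

theorem hasDerivAt_sqrt_sq_add_sq (s : ℝ) {δ : ℝ} (hδ : 0 < δ) :
    HasDerivAt (fun s : ℝ => Real.sqrt (s ^ 2 + δ ^ 2)) (s / Real.sqrt (s ^ 2 + δ ^ 2)) s := by
  have h1 : HasDerivAt (fun s : ℝ => s ^ 2 + δ ^ 2) (2 * s) s := by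
    simpa using (hasDerivAt_pow 2 s).add_const (δ ^ 2)
  refine (h1.sqrt (by positivity)).congr_deriv ?_
  field_simp

theorem abs_le_sqrt_sq_add_sq (s δ : ℝ) : |s| ≤ Real.sqrt (s ^ 2 + δ ^ 2) :=
  Real.abs_le_sqrt (by nlinarith [sq_nonneg δ])

theorem le_sqrt_sq_add_sq (s δ : ℝ) : δ ≤ Real.sqrt (s ^ 2 + δ ^ 2) :=
  Real.le_sqrt_of_sq_le (by nlinarith [sq_nonneg s])

theorem sqrt_sq_add_sq_le {s δ : ℝ} (hs : 0 ≤ s) (hδ : 0 ≤ δ) :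
    Real.sqrt (s ^ 2 + δ ^ 2) ≤ s + δ :=
  Real.sqrt_le_iff.2 ⟨by positivity, by nlinarith⟩

theorem hasDerivAt_div_sqrt (s : ℝ) {δ : ℝ} (hδ : 0 < δ) :
    HasDerivAt (fun s : ℝ => s / Real.sqrt (s ^ 2 + δ ^ 2))
      (δ ^ 2 / Real.sqrt (s ^ 2 + δ ^ 2) ^ 3) s := by
  have h0 := sqrt_sq_add_sq_pos s hδ
  refine ((hasDerivAt_id' s).div (hasDerivAt_sqrt_sq_add_sq s hδ) h0.ne').congr_deriv ?_
  have h1 := Real.sq_sqrt (show 0 ≤ s ^ 2 + δ ^ 2 by positivity)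
  set q := Real.sqrt (s ^ 2 + δ ^ 2)
  field_simp
  linarith

namespace IsMinimizerWithin

theorem memH1 (h : IsMinimizerWithin Ω Q Qmax g u ε) (i : Fin m) : MemH1 Ω fun x => u x i :=
  h.admissible.1 i

theorem isFiniteMeasure (h : IsMinimizerWithin Ω Q Qmax g u ε) :
    IsFiniteMeasure (volume.restrict Ω) :=
  ⟨by simpa using h.isBounded.measure_lt_top⟩

theorem integrableOn (h : IsMinimizerWithin Ω Q Qmax g u ε) (i : Fin m) :
    IntegrableOn (fun x => u x i) Ω := by
  have := h.isFiniteMeasure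
  exact (h.memH1 i).1.integrable (by norm_num)

/-- Lowering `u_i` by `t φ` may violate the sign constraint. Lowering it by `t φ G(u_i)` with `G(s)
= s / √(s² + δ²)` multiplies `u_i` by a positive factor when `t` is small, so signs and positivity
set persist. The first variation contains the extra term `-∫ φ G'(u_i) |∇u_i|²`, which is
nonpositive and may be dropped. The conclusion is weak subharmonicity of `√(u_i² + δ²)`. -/
theorem integral_regularized_nonpos (h : IsMinimizerWithin Ω Q Qmax g u ε) (i : Fin m)
    {φ : E n → ℝ} (hφ : IsTestFunction Ω φ) (hφ0 : ∀ x, 0 ≤ φ x) {δ : ℝ} (hδ : 0 < δ) :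
    ∫ x in Ω, inner ℝ ((u x i / Real.sqrt (u x i ^ 2 + δ ^ 2)) •
      weakGradient Ω (fun y => u y i) x) (gradient φ x) ≤ 0 := by
  set F := weakGradient Ω fun y => u y i with hF
  have hFw : IsWeakGradient Ω (fun y => u y i) F := (h.memH1 i).isWeakGradient
  have hF2 : MemLp F 2 (volume.restrict Ω) := (h.memH1 i).memLp_weakGradient h.isOpen
  have hf2 := (h.memH1 i).1
  set G : ℝ → ℝ := fun s => s / Real.sqrt (s ^ 2 + δ ^ 2) with hG
  set G' : ℝ → ℝ := fun s => δ ^ 2 / Real.sqrt (s ^ 2 + δ ^ 2) ^ 3 with hG'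
  have hGs : ContDiff ℝ ∞ G :=
    contDiff_id.div (contDiff_sqrt_sq_add_sq hδ) fun s => (sqrt_sq_add_sq_pos s hδ).ne'
  have hG'0 : ∀ s, 0 ≤ G' s := fun s => by
    have := sqrt_sq_add_sq_pos s hδ
    positivity
  have hG'L : ∀ s, |G' s| ≤ δ⁻¹ := fun s => by
    rw [abs_of_nonneg (hG'0 s), hG']
    have h1 := le_sqrt_sq_add_sq s δ
    have h2 : δ ^ 3 ≤ Real.sqrt (s ^ 2 + δ ^ 2) ^ 3 := by gcongr
    have h3 : δ ^ 2 / Real.sqrt (s ^ 2 + δ ^ 2) ^ 3 ≤ δ ^ 2 / δ ^ 3 := by gcongr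
    refine h3.trans (le_of_eq ?_)
    field_simp
  have hG1 : ∀ s, |G s| ≤ 1 := fun s => by
    rw [hG]
    simp only
    rw [abs_div, abs_of_pos (sqrt_sq_add_sq_pos s hδ)]
    exact (div_le_one (sqrt_sq_add_sq_pos s hδ)).2 (abs_le_sqrt_sq_add_sq s δ)
  have := h.isFiniteMeasure
  have hGm : AEStronglyMeasurable (fun x => G (u x i)) (volume.restrict Ω) :=
    hGs.continuous.comp_aestronglyMeasurable hf2.1
  have hG'c : Continuous G' := continuous_const.div
    ((contDiff_sqrt_sq_add_sq hδ).continuous.pow 3) fun s => by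
      have := sqrt_sq_add_sq_pos s hδ
      positivity
  have hG2 : MemLp (fun x => G (u x i)) 2 (volume.restrict Ω) :=
    MemLp.of_bound hGm 1 (Eventually.of_forall fun x => hG1 _)
  have hGw : IsWeakGradient Ω (fun x => G (u x i)) fun x => G' (u x i) • F x :=
    hFw.comp h.isOpen hf2 hF2 hGs (fun s => hasDerivAt_div_sqrt s hδ) hG'L
      (locallyIntegrableOn_of_locallyIntegrable_restrict (hG2.locallyIntegrable (by norm_num)))
  have hGF2 : MemLp (fun x => G' (u x i) • F x) 2 (volume.restrict Ω) := by
    refine hF2.of_le_mul (c := δ⁻¹) ((hG'c.comp_aestronglyMeasurable hf2.1).smul hF2.1)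
      (Eventually.of_forall fun x => ?_)
    rw [norm_smul]
    exact mul_le_mul_of_nonneg_right (hG'L _) (norm_nonneg _)
  have hψ := hφ.const_mul (-1)
  have hψe : ∀ x, gradient (fun y => -1 * φ y) x = -gradient φ x := fun x => by
    have := gradient_mul (f := fun _ => (-1 : ℝ)) (g := φ) (x := x) (differentiableAt_const _)
      (hφ.differentiable x)
    rw [this, gradient_fun_const]
    simp
  have hp1 := MemH1.isTestFunction_mul h.isOpen hψ ⟨hG2, _, hGw, hGF2⟩
  have hpw := hGw.mul_contDiff h.isOpen hψ.1
  have hp2 := (hψ.memLp_gradient_mul h.isOpen hG2 hGF2).restrict Ω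
  have hp10 := hp1.memH10_of_compact h.isOpen hφ.2.1 hφ.2.2 fun x hx => by
    rw [image_eq_zero_of_notMem_tsupport hx, mul_zero, zero_mul]
  obtain ⟨C, hC, hφC, -⟩ := hφ.bounded
  -- With `φ ≤ C` and `√(u_i² + δ²) ≥ δ`, the condition `t < δ / C` keeps the factor in `heq`
  -- positive.
  have hpos : ∀ t, 0 < t → t < δ / C → ∀ x, t * φ x / Real.sqrt (u x i ^ 2 + δ ^ 2) < 1 := by
    intro t ht htC x
    rw [div_lt_one (sqrt_sq_add_sq_pos _ hδ)]
    refine lt_of_lt_of_le ?_ (le_sqrt_sq_add_sq (u x i) δ)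
    rw [lt_div_iff₀ hC] at htC
    exact (mul_le_mul_of_nonneg_left ((le_abs_self _).trans (hφC x)) ht.le).trans_lt htC
  have heq : ∀ t x, u x i + t * (-1 * φ x * G (u x i))
      = u x i * (1 - t * φ x / Real.sqrt (u x i ^ 2 + δ ^ 2)) := fun t x => by
    simp only [hG]
    ring
  have key := first_variation_nonneg h.isOpen h.isBounded h.aemeasurable h.abs_le h.admissible
    h.eps_pos h.le i hp10 hpw hp2 (t₀ := δ / C) (by positivity) ?_ ?_
  · have i1 : IntegrableOn (fun x => φ x * (G' (u x i) * ‖F x‖ ^ 2)) Ω := by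
      have := integrable_inner_of_memLp hGF2 hF2
      simp only [real_inner_smul_left, real_inner_self_eq_norm_sq] at this
      exact this.bdd_mul (c := C) hφ.1.continuous.aestronglyMeasurable
        (Eventually.of_forall hφC)
    have hGF2' : MemLp (fun x => G (u x i) • F x) 2 (volume.restrict Ω) := by
      refine hF2.of_le_mul (c := 1) (hGm.smul hF2.1) (Eventually.of_forall fun x => ?_)
      rw [norm_smul]
      exact mul_le_mul_of_nonneg_right (hG1 _) (norm_nonneg _)
    have i2 : IntegrableOn (fun x => inner ℝ (G (u x i) • F x) (gradient φ x)) Ω :=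
      integrable_inner_of_memLp hGF2' (hφ.memLp_gradient 2 _)
    have e : ∀ x, inner ℝ (F x) ((-1 * φ x) • G' (u x i) • F x
        + G (u x i) • gradient (fun y => -1 * φ y) x)
        = -(φ x * (G' (u x i) * ‖F x‖ ^ 2)) - inner ℝ (G (u x i) • F x) (gradient φ x) :=
      fun x => by
        rw [hψe, inner_add_right, real_inner_smul_right, real_inner_smul_right,
          real_inner_smul_right, inner_neg_right, real_inner_smul_left, real_inner_self_eq_norm_sq]
        ring
    have i1' : IntegrableOn (fun x => -(φ x * (G' (u x i) * ‖F x‖ ^ 2))) Ω := i1.neg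
    simp only [← hF, e] at key
    rw [integral_sub i1' i2, integral_neg] at key
    have h2 : 0 ≤ ∫ x in Ω, φ x * (G' (u x i) * ‖F x‖ ^ 2) :=
      integral_nonneg fun x => mul_nonneg (hφ0 x) (mul_nonneg (hG'0 _) (sq_nonneg _))
    change ∫ x in Ω, inner ℝ (G (u x i) • F x) (gradient φ x) ≤ 0
    linarith
  · intro t ht htC
    filter_upwards [h.admissible.2.2 i] with x hx
    rw [heq]
    exact mul_nonneg hx (by linarith [hpos t ht htC x])
  · intro t ht htC
    filter_upwards [h.admissible.2.2 i] with x hx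
    rcases hx.eq_or_lt with h0 | h0
    · refine posChar_congr (perturb_of_eq_zero u i ?_)
      simp [hG, ← h0]
    · rw [posChar_of_pos (norm_pos_of_apply_pos h0), posChar_of_pos]
      refine norm_pos_of_apply_pos (i := i) ?_
      rw [perturb_apply_self, heq]
      exact mul_pos h0 (by linarith [hpos t ht htC x])

end IsMinimizerWithin

variable {f : E n → ℝ} {F : E n → E n}

theorem monotoneOn_radialMean (hf : IsWeakGradient Ω f F) (hfi : IntegrableOn f Ω) {x : E n}
    {R : ℝ} (hxR : Metric.ball x R ⊆ Ω) (h : ∀ r, 0 < r → r < R →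
      ∫ z in Ω, inner ℝ (F z) (gradient (dilate potential x r) z) ≤ 0) :
    MonotoneOn (radialMean Ω f x) (Ioo 0 R) := by
  have hd : ∀ r ∈ Ioo 0 R, HasDerivAt (radialMean Ω f x) _ r := fun r hr =>
    hasDerivAt_radialMean hf hfi hr.1 ((Metric.closedBall_subset_ball hr.2).trans hxR)
  refine monotoneOn_of_deriv_nonneg (convex_Ioo 0 R)
    (fun r hr => (hd r hr).continuousAt.continuousWithinAt) ?_ ?_
  · rw [interior_Ioo]
    exact fun r hr => (hd r hr).differentiableAt.differentiableWithinAt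
  · rw [interior_Ioo]
    intro r hr
    rw [(hd r hr).deriv, neg_nonneg]
    have := hr.1
    exact mul_nonpos_of_nonneg_of_nonpos (by positivity) (h r hr.1 hr.2)

/-- It serves twice: with `c = 0` for superharmonicity off the zero set, and with `c` a multiple of
`Qmax` for linear growth. -/
theorem antitoneOn_radialMean_sub (hf : IsWeakGradient Ω f F) (hfi : IntegrableOn f Ω) {x : E n}
    {R : ℝ} (hxR : Metric.ball x R ⊆ Ω) {c : ℝ} (h : ∀ r, 0 < r → r < R →
      -((r ^ n)⁻¹ * r * ∫ z in Ω, inner ℝ (F z) (gradient (dilate potential x r) z)) ≤ c) :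
    AntitoneOn (fun r => radialMean Ω f x r - c * r) (Ioo 0 R) := by
  have hd : ∀ r ∈ Ioo 0 R, HasDerivAt (fun r => radialMean Ω f x r - c * r) _ r := fun r hr =>
    (hasDerivAt_radialMean hf hfi hr.1 ((Metric.closedBall_subset_ball hr.2).trans hxR)).sub
      ((hasDerivAt_id' r).const_mul c)
  refine antitoneOn_of_deriv_nonpos (convex_Ioo 0 R)
    (fun r hr => (hd r hr).continuousAt.continuousWithinAt) ?_ ?_
  · rw [interior_Ioo]
    exact fun r hr => (hd r hr).differentiableAt.differentiableWithinAt
  · rw [interior_Ioo]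
    intro r hr
    rw [(hd r hr).deriv, mul_one]
    have := h r hr.1 hr.2
    linarith

end Minimizers

/-! ### Sub- and superharmonicity of the components, and the growth bound -/

section RadialMeans

variable {Ω : Set (E n)} {Q : E n → ℝ} {Qmax ε : ℝ} {g u : E n → E m}

theorem integrableOn_dilate_mul {k : E n → ℝ} (hk : Continuous k)
    (hk0 : ∀ y, 1 ≤ ‖y‖ → k y = 0) {f : E n → ℝ} (hf : IntegrableOn f Ω) (x : E n) (r : ℝ) :
    IntegrableOn (fun z => dilate k x r z * f z) Ω := by
  obtain ⟨B, -, hB⟩ := exists_bound_of_eq_zero hk hk0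
  have hc : Continuous (dilate k x r) :=
    hk.comp (by fun_prop : Continuous fun z : E n => r⁻¹ • (z - x))
  exact hf.bdd_mul (c := B) hc.aestronglyMeasurable (Eventually.of_forall fun z => hB _)

theorem radialMean_mono {f g : E n → ℝ} (hf : IntegrableOn f Ω) (hg : IntegrableOn g Ω)
    (hfg : ∀ᵐ z ∂volume.restrict Ω, f z ≤ g z) (x : E n) {r : ℝ} (hr : 0 < r) :
    radialMean Ω f x r ≤ radialMean Ω g x r := by
  refine mul_le_mul_of_nonneg_left ?_ (by positivity)
  refine integral_mono_ae
    (integrableOn_dilate_mul contDiff_kernel.continuous (fun y => kernel_eq_zero) hf x r)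
    (integrableOn_dilate_mul contDiff_kernel.continuous (fun y => kernel_eq_zero) hg x r) ?_
  filter_upwards [hfg] with z hz
  exact mul_le_mul_of_nonneg_left hz (kernel_nonneg _)

theorem radialMean_nonneg {f : E n → ℝ} (hf : ∀ᵐ z ∂volume.restrict Ω, 0 ≤ f z) (x : E n) {r : ℝ}
    (hr : 0 < r) : 0 ≤ radialMean Ω f x r := by
  refine mul_nonneg (by positivity) (integral_nonneg_of_ae ?_)
  filter_upwards [hf] with z hz
  exact mul_nonneg (kernel_nonneg _) hz

namespace IsMinimizerWithin

theorem nonneg (h : IsMinimizerWithin Ω Q Qmax g u ε) (i : Fin m) :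
    ∀ᵐ z ∂volume.restrict Ω, 0 ≤ u z i := h.admissible.2.2 i

/-- The components of a minimizer are subharmonic. -/
theorem monotoneOn_radialMean (h : IsMinimizerWithin Ω Q Qmax g u ε) (i : Fin m) {x : E n} {R : ℝ}
    (hxR : Metric.ball x R ⊆ Ω) : MonotoneOn (radialMean Ω (fun z => u z i) x) (Ioo 0 R) := by
  have := h.isFiniteMeasure
  have hfi := h.integrableOn i
  have hreg : ∀ δ, 0 < δ →
      MonotoneOn (radialMean Ω (fun z => Real.sqrt (u z i ^ 2 + δ ^ 2)) x) (Ioo 0 R) ∧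
      IntegrableOn (fun z => Real.sqrt (u z i ^ 2 + δ ^ 2)) Ω := by
    intro δ hδ
    have hs := contDiff_sqrt_sq_add_sq hδ
    have hi : IntegrableOn (fun z => Real.sqrt (u z i ^ 2 + δ ^ 2)) Ω := by
      refine (hfi.abs.add (integrable_const δ)).mono'
        (hs.continuous.comp_aestronglyMeasurable hfi.1) (Eventually.of_forall fun z => ?_)
      rw [Real.norm_of_nonneg (Real.sqrt_nonneg _), ← sq_abs (u z i)]
      exact sqrt_sq_add_sq_le (abs_nonneg _) hδ.le
    have hw := (h.memH1 i).isWeakGradient.comp h.isOpen (h.memH1 i).1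
      ((h.memH1 i).memLp_weakGradient h.isOpen) hs (fun s => hasDerivAt_sqrt_sq_add_sq s hδ)
      (L := 1) (fun s => by
        rw [abs_div, abs_of_pos (sqrt_sq_add_sq_pos s hδ)]
        exact (div_le_one (sqrt_sq_add_sq_pos s hδ)).2 (abs_le_sqrt_sq_add_sq s δ))
      (locallyIntegrableOn_of_locallyIntegrable_restrict hi.locallyIntegrable)
    refine ⟨BernoulliSystem.monotoneOn_radialMean hw hi hxR fun r hr hrR => ?_, hi⟩
    exact h.integral_regularized_nonpos i (isTestFunction_dilate contDiff_potential
      (fun y => potential_eq_zero) hr ((Metric.closedBall_subset_ball hrR).trans hxR))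
      (fun z => potential_nonneg _) hδ
  intro s hs r hr hsr
  -- For `u_i ≥ 0` one has `u_i ≤ √(u_i² + δ²) ≤ u_i + δ`, so monotonicity of the regularized means
  -- passes to `u_i` up to `δ` times the mean of `1`.
  have hle : ∀ δ, 0 < δ → radialMean Ω (fun z => u z i) x s
      ≤ radialMean Ω (fun z => u z i) x r + δ * radialMean Ω (fun _ => 1) x r := by
    intro δ hδ
    obtain ⟨hm, hi⟩ := hreg δ hδ
    have h1 := radialMean_mono hfi hi (Eventually.of_forall fun z =>
      (le_abs_self _).trans (abs_le_sqrt_sq_add_sq (u z i) δ)) x hs.1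
    have h2 := hm hs hr hsr
    have h3 := radialMean_mono (g := fun z => u z i + δ) hi (hfi.add (integrable_const δ)) (by
      filter_upwards [h.nonneg i] with z hz
      exact sqrt_sq_add_sq_le hz hδ.le) x hr.1
    have h4 : radialMean Ω (fun z => u z i + δ) x r
        = radialMean Ω (fun z => u z i) x r + δ * radialMean Ω (fun _ => 1) x r := by
      have j1 := integrableOn_dilate_mul contDiff_kernel.continuous (fun y => kernel_eq_zero) hfi x r
      have j2 := integrableOn_dilate_mul contDiff_kernel.continuous (fun y => kernel_eq_zero)
        (integrable_const (1 : ℝ) (μ := volume.restrict Ω)) x r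
      have e : ∀ z, dilate kernel x r z * (u z i + δ)
          = dilate kernel x r z * u z i + δ * (dilate kernel x r z * 1) := fun z => by ring
      simp only [radialMean, e]
      rw [integral_add j1 (j2.const_mul δ), integral_const_mul]
      ring
    linarith
  set c := radialMean Ω (fun _ => (1 : ℝ)) x r
  have hc : 0 ≤ c := radialMean_nonneg (Eventually.of_forall fun _ => zero_le_one) x hr.1
  refine le_of_forall_pos_le_add fun η hη => ?_
  refine (hle (η / (c + 1)) (by positivity)).trans ?_
  have : η / (c + 1) * c ≤ η := by
    rw [div_mul_eq_mul_div, div_le_iff₀ (by positivity)]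
    nlinarith
  linarith

/-- The components of a minimizer are superharmonic where the minimizer does not vanish. -/
theorem antitoneOn_radialMean (h : IsMinimizerWithin Ω Q Qmax g u ε) (i : Fin m) {x : E n} {R : ℝ}
    (hxR : Metric.ball x R ⊆ Ω)
    (hpos : ∀ᵐ z ∂volume.restrict Ω, z ∈ Metric.ball x R → 0 < ‖u z‖) :
    AntitoneOn (radialMean Ω (fun z => u z i) x) (Ioo 0 R) := by
  have key := antitoneOn_radialMean_sub (h.memH1 i).isWeakGradient (h.integrableOn i) hxR (c := 0)
    fun r hr hrR => ?_
  · simpa using! key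
  · rw [neg_nonpos]
    have hT := isTestFunction_dilate contDiff_potential (fun y => potential_eq_zero) hr
      ((Metric.closedBall_subset_ball hrR).trans hxR)
    refine mul_nonneg (by positivity) ?_
    -- The direction is `ζ_r ≥ 0`. It does not enlarge the positivity set, because `u ≠ 0` already
    -- holds a.e. in the ball, and it does not shrink it, because all components are nonnegative and
    -- a positive one stays positive.
    refine first_variation_nonneg h.isOpen h.isBounded h.aemeasurable h.abs_le h.admissible
      h.eps_pos h.le i ((hT.memH1 Ω).memH10_of_compact h.isOpen hT.2.1 hT.2.2 fun z hz =>
        image_eq_zero_of_notMem_tsupport hz) (isWeakGradient_of_contDiff hT.1)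
      (hT.memLp_gradient 2 _) one_pos ?_ ?_
    · intro t ht _
      filter_upwards [h.nonneg i] with z hz
      exact add_nonneg hz (mul_nonneg ht.le (potential_nonneg _))
    · intro t ht _
      filter_upwards [hpos, eventually_all.2 h.nonneg] with z hz hz0
      by_cases hzR : z ∈ Metric.ball x r
      · have h1 := hz (Metric.ball_subset_ball hrR.le hzR)
        rw [posChar_of_pos h1, posChar_of_pos]
        obtain ⟨j, hj⟩ : ∃ j, 0 < u z j := by
          by_contra hne
          push Not at hne
          refine h1.ne' (norm_eq_zero.2 ?_)
          ext j
          exact le_antisymm (hne j) (hz0 j)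
        refine norm_pos_of_apply_pos (i := j) ?_
        rw [perturb_apply]
        refine add_pos_of_pos_of_nonneg hj (mul_nonneg (by split_ifs <;> norm_num) ?_)
        exact mul_nonneg ht.le (potential_nonneg _)
      · refine posChar_congr (perturb_of_eq_zero u i ?_)
        rw [dilate_eq_zero (fun y => potential_eq_zero) hr hzR, mul_zero]

end IsMinimizerWithin

theorem volume_real_closedBall (x : E n) {r : ℝ} (hr : 0 ≤ r) :
    volume.real (Metric.closedBall x r) = r ^ n * volume.real (Metric.closedBall (0 : E n) 1) := by
  have := Measure.addHaar_real_closedBall' (volume : Measure (E n)) x hr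
  simpa using this

theorem setIntegral_le_of_closedBall {h : E n → ℝ} {x : E n} {r C : ℝ} (hr : 0 ≤ r) (hC : 0 ≤ C)
    (hh : ∀ᵐ z ∂volume.restrict Ω, h z ≤ (Metric.closedBall x r).indicator (fun _ => C) z) :
    ∫ z in Ω, h z ≤ C * (r ^ n * volume.real (Metric.closedBall (0 : E n) 1)) := by
  have hi : Integrable ((Metric.closedBall x r).indicator fun _ => C) :=
    (integrable_indicator_iff Metric.isClosed_closedBall.measurableSet).2
      (integrableOn_const (isCompact_closedBall x r).measure_lt_top.ne)
  have hI : ∫ z, (Metric.closedBall x r).indicator (fun _ => C) z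
      = C * (r ^ n * volume.real (Metric.closedBall (0 : E n) 1)) := by
    rw [integral_indicator Metric.isClosed_closedBall.measurableSet, setIntegral_const,
      volume_real_closedBall x hr, smul_eq_mul, mul_comm]
  rw [← hI]
  have h0 : ∀ z, 0 ≤ (Metric.closedBall x r).indicator (fun _ => C) z :=
    fun z => indicator_nonneg (fun _ _ => hC) z
  by_cases hint : IntegrableOn h Ω
  · calc ∫ z in Ω, h z ≤ ∫ z in Ω, (Metric.closedBall x r).indicator (fun _ => C) z :=
        integral_mono_ae hint hi.integrableOn hh
      _ ≤ _ := setIntegral_le_integral hi (Eventually.of_forall h0)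
  -- A non-integrable `h` has Bochner integral `0`, which is still below the nonnegative bound.
  · rw [integral_undef hint]
    exact integral_nonneg h0

/-- The constants `S` and `M` bound the potential and its gradient. -/
theorem exists_potential_bounds (n : ℕ) : ∃ S M : ℝ, 0 ≤ S ∧ 0 ≤ M ∧
    (∀ y : E n, potential y ^ 2 ≤ S) ∧ ∀ y : E n, ‖gradient potential y‖ ^ 2 ≤ M := by
  have hT : IsTestFunction univ (potential (n := n)) :=
    ⟨contDiff_potential, hasCompactSupport_of_eq_zero fun y => potential_eq_zero, subset_univ _⟩
  obtain ⟨C, hC, h1, h2⟩ := hT.bounded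
  refine ⟨C ^ 2, C ^ 2, sq_nonneg _, sq_nonneg _, fun y => ?_, fun y => ?_⟩
  · rw [← sq_abs]
    exact pow_le_pow_left₀ (abs_nonneg _) (h1 y) 2
  · exact pow_le_pow_left₀ (norm_nonneg _) (h2 y) 2

/-- A bound for the distance between `u` and the competitors which are supported in a ball of
radius `r`. -/
def competitorDistance (n : ℕ) (Qmax S M r : ℝ) : ℝ :=
  Real.sqrt (Qmax ^ 2 * (r ^ 2 * S + M) * (r ^ n * volume.real (Metric.closedBall (0 : E n) 1)))
    + r ^ n * volume.real (Metric.closedBall (0 : E n) 1)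

/-- The factor `r ^ n` must vanish at `r = 0`, which requires `n ≠ 0`. -/
theorem exists_competitorDistance_lt (hn : n ≠ 0) (Qmax S M : ℝ) {ε : ℝ} (hε : 0 < ε) :
    ∃ r₀, 0 < r₀ ∧ ∀ r, 0 < r → r ≤ r₀ → competitorDistance n Qmax S M r < ε := by
  have hc : ContinuousAt (competitorDistance n Qmax S M) 0 := by
    unfold competitorDistance
    fun_prop
  have h0 : competitorDistance n Qmax S M 0 = 0 := by
    simp [competitorDistance, hn]
  have hev := hc.eventually_lt_const (by rwa [h0])
  obtain ⟨δ, hδ, hδ'⟩ := Metric.eventually_nhds_iff.1 hev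
  refine ⟨δ / 2, half_pos hδ, fun r hr hrδ => hδ' ?_⟩
  rw [Real.dist_eq, sub_zero, abs_of_pos hr]
  linarith

/-- The competitor adds `t ζ_r` to `u_i`. The gradient square costs at most `t² (M / r²) r^n V`, and
new positivity at most `Qmax² r^n V`, whatever the size of `u`. Minimality then bounds the cross
term from below. -/
theorem IsMinimizerWithin.derivative_bound (h : IsMinimizerWithin Ω Q Qmax g u ε) {S M : ℝ}
    (hS0 : 0 ≤ S) (hM0 : 0 ≤ M) (hS : ∀ y : E n, potential y ^ 2 ≤ S)
    (hM : ∀ y : E n, ‖gradient potential y‖ ^ 2 ≤ M) (i : Fin m) {x : E n} {r : ℝ} (hr : 0 < r)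
    (hxr : Metric.closedBall x r ⊆ Ω) (hd : competitorDistance n Qmax S M r < ε) :
    -((r ^ n)⁻¹ * r * ∫ z in Ω, inner ℝ (weakGradient Ω (fun y => u y i) z)
      (gradient (dilate potential x r) z))
      ≤ (M + 1) * volume.real (Metric.closedBall (0 : E n) 1) / 2 * Qmax := by
  set V := volume.real (Metric.closedBall (0 : E n) 1) with hV
  have hV0 : 0 ≤ V := measureReal_nonneg
  have hQ := h.pos
  set φ := dilate (potential (n := n)) x r with hφ
  have hT : IsTestFunction Ω φ :=
    isTestFunction_dilate contDiff_potential (fun y => potential_eq_zero) hr hxr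
  -- This choice makes both costs multiples of `Qmax² r^n`, so the slope bound is linear in `Qmax`
  -- and independent of `r`.
  set t := Qmax * r with ht
  have ht0 : 0 < t := by positivity
  have hφ0 : ∀ z ∉ Metric.closedBall x r, φ z = 0 := fun z hz =>
    dilate_eq_zero (fun y => potential_eq_zero) hr fun h' => hz (Metric.ball_subset_closedBall h')
  have hTb : IsTestFunction (Metric.closedBall x r) φ :=
    isTestFunction_dilate contDiff_potential (fun y => potential_eq_zero) hr subset_rfl
  have hgr : ∀ z, ‖gradient φ z‖ ^ 2 ≤ (Metric.closedBall x r).indicator (fun _ => M / r ^ 2) z := by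
    intro z
    by_cases hz : z ∈ Metric.closedBall x r
    · rw [indicator_of_mem hz, hφ, gradient_dilate (contDiff_potential.differentiable (by simp)),
        norm_smul, mul_pow, norm_inv, Real.norm_of_nonneg hr.le, inv_pow, inv_mul_eq_div]
      gcongr
      exact hM _
    · rw [indicator_of_notMem hz, hTb.gradient_eq_zero hz]
      simp
  have hp10 := (((hT.const_mul t).memH1 Ω).memH10_of_compact h.isOpen (hT.const_mul t).2.1
    (hT.const_mul t).2.2 fun z hz => image_eq_zero_of_notMem_tsupport (f := fun z => t * φ z) hz)
  have hw := (isWeakGradient_of_contDiff hT.1 (Ω := Ω)).const_mul t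
  have hw2 : MemLp (fun z => t • gradient φ z) 2 (volume.restrict Ω) :=
    (hT.memLp_gradient 2 _).const_smul t
  set v := perturb u i fun z => t * φ z with hv
  have hadm : Admissible Ω g v := h.admissible.perturb h.isOpen hp10 (by
    filter_upwards [h.nonneg i] with z hz
    exact add_nonneg hz (mul_nonneg ht0.le (potential_nonneg _)))
  have hJ := J_perturb h.isOpen h.isBounded h.admissible.1 h.aemeasurable h.abs_le i hp10.1.1 hw hw2
  have hout : ∀ z ∉ Metric.closedBall x r, posChar v z = posChar u z := fun z hz =>
    posChar_congr (perturb_of_eq_zero u i (by rw [hφ0 z hz, mul_zero]))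
  have b1 : ∫ z in Ω, ‖t • gradient φ z‖ ^ 2 ≤ t ^ 2 * (M / r ^ 2) * (r ^ n * V) := by
    refine setIntegral_le_of_closedBall hr.le (by positivity)
      (x := x) (Eventually.of_forall fun z => ?_)
    rw [norm_smul, mul_pow, Real.norm_of_nonneg ht0.le]
    have := mul_le_mul_of_nonneg_left (hgr z) (sq_nonneg t)
    refine this.trans (le_of_eq ?_)
    by_cases hz : z ∈ Metric.closedBall x r <;> simp [hz]
  have b2 : ∫ z in Ω, Q z ^ 2 * (posChar v z - posChar u z) ≤ Qmax ^ 2 * (r ^ n * V) := by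
    refine setIntegral_le_of_closedBall hr.le (by positivity) (x := x) ?_
    filter_upwards [h.abs_le] with z hz
    by_cases hzb : z ∈ Metric.closedBall x r
    · rw [indicator_of_mem hzb]
      have h1 : Q z ^ 2 ≤ Qmax ^ 2 := by
        rw [← sq_abs]
        gcongr
      nlinarith [posChar_le_one v z, posChar_nonneg u z, sq_nonneg (Q z)]
    · rw [indicator_of_notMem hzb, hout z hzb, sub_self, mul_zero]
  have b3 : ∫ z in Ω, |posChar u z - posChar v z| ≤ 1 * (r ^ n * V) := by
    refine setIntegral_le_of_closedBall hr.le zero_le_one (x := x)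
      (Eventually.of_forall fun z => ?_)
    by_cases hzb : z ∈ Metric.closedBall x r
    · rw [indicator_of_mem hzb, _root_.abs_le]
      constructor <;> linarith [posChar_le_one v z, posChar_nonneg u z, posChar_le_one u z,
        posChar_nonneg v z]
    · rw [indicator_of_notMem hzb, hout z hzb, sub_self, abs_zero]
  have b4 : ∫ z in Ω, ((t * φ z) ^ 2 + ‖t • gradient φ z‖ ^ 2)
      ≤ t ^ 2 * (S + M / r ^ 2) * (r ^ n * V) := by
    refine setIntegral_le_of_closedBall hr.le (by positivity)
      (x := x) (Eventually.of_forall fun z => ?_)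
    have h1 := hgr z
    have h3 : (t * φ z) ^ 2 + ‖t • gradient φ z‖ ^ 2 = t ^ 2 * (φ z ^ 2 + ‖gradient φ z‖ ^ 2) := by
      rw [norm_smul, Real.norm_of_nonneg ht0.le]
      ring
    rw [h3]
    by_cases hz : z ∈ Metric.closedBall x r
    · rw [indicator_of_mem hz] at h1 ⊢
      have h2 : φ z ^ 2 ≤ S := hS _
      gcongr
    · rw [indicator_of_notMem hz] at h1 ⊢
      rw [hφ0 z hz]
      nlinarith [sq_nonneg t]
  have hdist : d Ω u v < ε := by
    refine lt_of_le_of_lt ?_ hd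
    rw [d, competitorDistance, hv, h1Norm_sub_perturb h.isOpen i hw]
    refine add_le_add (Real.sqrt_le_sqrt (b4.trans (le_of_eq ?_))) (by simpa using b3)
    rw [ht, ← hV]
    field_simp
  have hle := h.le v hadm hdist
  rw [hv, hJ] at hle
  simp only [real_inner_smul_right, integral_const_mul] at hle
  set A := ∫ z in Ω, inner ℝ (weakGradient Ω (fun y => u y i) z) (gradient φ z) with hA
  have h1 : 0 ≤ 2 * (t * A) + t ^ 2 * (M / r ^ 2) * (r ^ n * V) + Qmax ^ 2 * (r ^ n * V) := by
    linarith
  -- Factoring out the positive number `2 Qmax r^n` leaves the slope estimate.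
  have h2 : 2 * (t * A) + t ^ 2 * (M / r ^ 2) * (r ^ n * V) + Qmax ^ 2 * (r ^ n * V)
      = 2 * Qmax * r ^ n * ((r ^ n)⁻¹ * r * A + (M + 1) * V / 2 * Qmax) := by
    rw [ht]
    field_simp
    ring
  rw [h2] at h1
  have h3 := nonneg_of_mul_nonneg_right h1 (by positivity)
  linarith

end RadialMeans

/-! ### The continuous representative -/

section PreciseVersion

variable {Ω : Set (E n)} {Q : E n → ℝ} {Qmax ε : ℝ} {g u : E n → E m} {f : E n → ℝ}

/-- The total mass of the weight `η`. -/
def kernelMass (n : ℕ) : ℝ := ∫ y : E n, kernel y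

theorem kernelMass_pos (n : ℕ) : 0 < kernelMass n := by
  have hc : Continuous (kernel (n := n)) := contDiff_kernel.continuous
  refine integral_pos_of_integrable_nonneg_nonzero hc
    (hc.integrable_of_hasCompactSupport (hasCompactSupport_of_eq_zero fun y => kernel_eq_zero))
    kernel_nonneg (x := 0) ?_
  exact (kernel_pos (by simp)).ne'

theorem radialMean_const {x : E n} {r : ℝ} (hr : 0 < r) (hx : Metric.ball x r ⊆ Ω) (a : ℝ) :
    radialMean Ω (fun _ => a) x r = kernelMass n * a := by
  have h1 : ∫ z in Ω, dilate kernel x r z = ∫ z, dilate kernel x r z :=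
    setIntegral_eq_integral_of_forall_compl_eq_zero fun z hz =>
      dilate_eq_zero (fun y => kernel_eq_zero) hr fun h => hz (hx h)
  rw [radialMean, integral_mul_const, h1, integral_dilate kernel x hr, kernelMass]
  field_simp

theorem continuous_radialMean (hf : IntegrableOn f Ω) (r : ℝ) :
    Continuous fun x => radialMean Ω f x r := by
  obtain ⟨B, -, hB⟩ := exists_bound_of_eq_zero (n := n) contDiff_kernel.continuous
    (fun y => kernel_eq_zero)
  refine continuous_const.mul (continuous_of_dominated (bound := fun z => B * |f z|)
    (fun x => (integrableOn_dilate_mul contDiff_kernel.continuous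
      (fun y => kernel_eq_zero) hf x r).1) (fun x => Eventually.of_forall fun z => ?_)
    (hf.abs.const_mul B) (Eventually.of_forall fun z => ?_))
  · rw [norm_mul]
    exact mul_le_mul_of_nonneg_right (hB _) (abs_nonneg _)
  · refine Continuous.mul ?_ continuous_const
    exact contDiff_kernel.continuous.comp (by fun_prop : Continuous fun x : E n => r⁻¹ • (z - x))

/-- At a Lebesgue point the deviation from `kernelMass n * f x` is at most `B V` times the average
of `|f - f x|` over the ball of radius `r`. -/
theorem tendsto_radialMean_ae (hΩ : IsOpen Ω) (hf : IntegrableOn f Ω) :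
    ∀ᵐ x ∂volume.restrict Ω,
      Tendsto (radialMean Ω f x) (𝓝[>] 0) (𝓝 (kernelMass n * f x)) := by
  obtain ⟨B, hB0, hB⟩ := exists_bound_of_eq_zero (n := n) contDiff_kernel.continuous
    (fun y => kernel_eq_zero)
  set V := volume.real (Metric.closedBall (0 : E n) 1) with hV
  have hV0 : 0 < V := ENNReal.toReal_pos
    (Metric.measure_closedBall_pos _ _ one_pos).ne' (isCompact_closedBall _ _).measure_lt_top.ne
  -- Extension by zero allows the differentiation theorem on the whole space; small balls around
  -- points of `Ω` do not see the extension.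
  have hi : Integrable (Ω.indicator f) := (integrable_indicator_iff hΩ.measurableSet).2 hf
  have hL := IsUnifLocDoublingMeasure.ae_tendsto_average_norm_sub volume hi.locallyIntegrable 1
  rw [ae_restrict_iff' hΩ.measurableSet]
  filter_upwards [hL] with x hx hxΩ
  obtain ⟨R, hR, hRΩ⟩ := Metric.isOpen_iff.1 hΩ x hxΩ
  have h1 := hx (l := 𝓝[>] (0 : ℝ)) (fun _ => x) (fun r => r) tendsto_id (by
    filter_upwards [self_mem_nhdsWithin] with r hr
    rw [one_mul]
    exact Metric.mem_closedBall_self (le_of_lt hr))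
  rw [tendsto_iff_norm_sub_tendsto_zero]
  refine squeeze_zero' (g := fun r => B * V * ⨍ y in Metric.closedBall x r,
    ‖Ω.indicator f y - Ω.indicator f x‖) (Eventually.of_forall fun r => norm_nonneg _) ?_ ?_
  · filter_upwards [Ioo_mem_nhdsGT hR] with r hr
    have hcb : Metric.closedBall x r ⊆ Ω := (Metric.closedBall_subset_ball hr.2).trans hRΩ
    have hsubi : IntegrableOn (fun z => f z - f x) (Metric.closedBall x r) :=
      (hf.mono_set hcb).sub (integrableOn_const (isCompact_closedBall x r).measure_lt_top.ne)
    have hrn : 0 < r ^ n := pow_pos hr.1 n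
    have hT := isTestFunction_dilate contDiff_kernel (fun y => kernel_eq_zero) hr.1 hcb
    have e1 : radialMean Ω f x r - kernelMass n * f x
        = (r ^ n)⁻¹ * ∫ z in Ω, dilate kernel x r z * (f z - f x) := by
      rw [← radialMean_const hr.1 (Metric.ball_subset_closedBall.trans hcb) (f x)]
      have j1 := integrableOn_dilate_mul contDiff_kernel.continuous (fun y => kernel_eq_zero) hf x r
      have j2 : IntegrableOn (fun z => dilate kernel x r z * f x) Ω :=
        ((hT.1.continuous.integrable_of_hasCompactSupport hT.2.1).mul_const _).integrableOn
      simp only [radialMean, mul_sub]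
      rw [integral_sub j1 j2, mul_sub]
    have e2 : ∫ z in Ω, dilate kernel x r z * (f z - f x)
        = ∫ z in Metric.closedBall x r, dilate kernel x r z * (f z - f x) := by
      refine setIntegral_eq_of_subset_of_forall_sdiff_eq_zero hΩ.measurableSet hcb fun z hz => ?_
      rw [dilate_eq_zero (fun y => kernel_eq_zero) hr.1
        fun h => hz.2 (Metric.ball_subset_closedBall h), zero_mul]
    have e3 : ⨍ y in Metric.closedBall x r, ‖Ω.indicator f y - Ω.indicator f x‖
        = (r ^ n * V)⁻¹ * ∫ z in Metric.closedBall x r, ‖f z - f x‖ := by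
      rw [setAverage_eq, volume_real_closedBall x hr.1.le, smul_eq_mul]
      congr 1
      refine setIntegral_congr_fun Metric.isClosed_closedBall.measurableSet fun z hz => ?_
      simp only [indicator_of_mem (hcb hz), indicator_of_mem hxΩ]
    have e4 : ‖∫ z in Metric.closedBall x r, dilate kernel x r z * (f z - f x)‖
        ≤ B * ∫ z in Metric.closedBall x r, ‖f z - f x‖ := by
      rw [← integral_const_mul]
      refine norm_integral_le_of_norm_le (hsubi.norm.const_mul B) (Eventually.of_forall fun z => ?_)
      rw [norm_mul]
      exact mul_le_mul_of_nonneg_right (hB _) (norm_nonneg _)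
    rw [e1, e2, e3, norm_mul, norm_inv, Real.norm_of_nonneg hrn.le]
    refine (mul_le_mul_of_nonneg_left e4 (by positivity)).trans (le_of_eq ?_)
    field_simp
  · simpa using h1.const_mul (B * V)

/-- The pointwise limit of the radial means of the components of `u`. -/
def preciseVersion (Ω : Set (E n)) (u : E n → E m) (x : E n) : E m :=
  WithLp.toLp 2 fun i => limUnder (𝓝[>] (0 : ℝ)) (radialMean Ω (fun z => u z i) x) / kernelMass n

theorem preciseVersion_apply {x : E n} {i : Fin m} {a : ℝ}
    (h : Tendsto (radialMean Ω (fun z => u z i) x) (𝓝[>] 0) (𝓝 a)) :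
    kernelMass n * preciseVersion Ω u x i = a := by
  have hc := kernelMass_pos n
  simp only [preciseVersion, h.limUnder_eq]
  field_simp

/-- The derivative of the radial means is at most this constant times `Qmax`. -/
def growthConstant (n : ℕ) (M : ℝ) : ℝ :=
  (M + 1) * volume.real (Metric.closedBall (0 : E n) 1) / 2

theorem growthConstant_nonneg (n : ℕ) {M : ℝ} (hM : 0 ≤ M) : 0 ≤ growthConstant n M := by
  have : 0 ≤ volume.real (Metric.closedBall (0 : E n) 1) := measureReal_nonneg
  unfold growthConstant
  positivity

namespace IsMinimizerWithin

/-- Monotone in `r` and bounded below by `0`, the means converge at every point of `Ω`, not only at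
almost every one. -/
theorem tendsto_radialMean (h : IsMinimizerWithin Ω Q Qmax g u ε) (i : Fin m)
    {x : E n} (hx : x ∈ Ω) :
    Tendsto (radialMean Ω (fun z => u z i) x) (𝓝[>] 0)
      (𝓝 (kernelMass n * preciseVersion Ω u x i)) := by
  obtain ⟨R, hR, hRΩ⟩ := Metric.isOpen_iff.1 h.isOpen x hx
  have hb : BddBelow (radialMean Ω (fun z => u z i) x '' Ioo 0 R) := by
    refine ⟨0, ?_⟩
    rintro _ ⟨r, hr, rfl⟩
    exact radialMean_nonneg (h.nonneg i) x hr.1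
  have ht := (h.monotoneOn_radialMean i hRΩ).tendsto_nhdsWithin_Ioo_right (nonempty_Ioo.2 hR) hb
  rwa [preciseVersion_apply ht]

theorem preciseVersion_nonneg (h : IsMinimizerWithin Ω Q Qmax g u ε) (i : Fin m)
    {x : E n} (hx : x ∈ Ω) :
    0 ≤ preciseVersion Ω u x i := by
  have h1 : 0 ≤ kernelMass n * preciseVersion Ω u x i :=
    ge_of_tendsto (h.tendsto_radialMean i hx) (by
      filter_upwards [self_mem_nhdsWithin] with r hr using radialMean_nonneg (h.nonneg i) x hr)
  exact nonneg_of_mul_nonneg_right h1 (kernelMass_pos n)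

theorem preciseVersion_le (h : IsMinimizerWithin Ω Q Qmax g u ε) (i : Fin m)
    {x : E n} {r R : ℝ} (hr : 0 < r) (hrR : r < R)
    (hx : Metric.ball x R ⊆ Ω) :
    kernelMass n * preciseVersion Ω u x i ≤ radialMean Ω (fun z => u z i) x r := by
  refine le_of_tendsto (h.tendsto_radialMean i (hx (Metric.mem_ball_self (hr.trans hrR)))) ?_
  filter_upwards [Ioo_mem_nhdsGT hr] with s hs
  exact h.monotoneOn_radialMean i hx ⟨hs.1, hs.2.trans hrR⟩ ⟨hr, hrR⟩ hs.2.le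

/-- The mean minus `growthConstant n M * Qmax * r` is nonincreasing, hence at most its limit at `0`.
This reverses the sub-mean value inequality `preciseVersion_le` up to a linear error. -/
theorem radialMean_le (h : IsMinimizerWithin Ω Q Qmax g u ε) (i : Fin m) {S M R₀ : ℝ}
    (hS0 : 0 ≤ S) (hM0 : 0 ≤ M) (hS : ∀ y : E n, potential y ^ 2 ≤ S)
    (hM : ∀ y : E n, ‖gradient potential y‖ ^ 2 ≤ M)
    (hd : ∀ r, 0 < r → r ≤ R₀ → competitorDistance n Qmax S M r < ε)
    {x : E n} {r R : ℝ} (hr : 0 < r) (hrR : r < R) (hR : R ≤ R₀) (hx : Metric.ball x R ⊆ Ω) :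
    radialMean Ω (fun z => u z i) x r
      ≤ kernelMass n * preciseVersion Ω u x i + growthConstant n M * Qmax * r := by
  have hm := antitoneOn_radialMean_sub (h.memH1 i).isWeakGradient (h.integrableOn i) hx
    (c := growthConstant n M * Qmax) fun s hs hsR =>
    h.derivative_bound hS0 hM0 hS hM i hs ((Metric.closedBall_subset_ball hsR).trans hx)
      (hd s hs (hsR.le.trans hR))
  have ht := h.tendsto_radialMean i (hx (Metric.mem_ball_self (hr.trans hrR)))
  have ht2 : Tendsto (fun s => radialMean Ω (fun z => u z i) x s - growthConstant n M * Qmax * s)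
      (𝓝[>] 0) (𝓝 (kernelMass n * preciseVersion Ω u x i - growthConstant n M * Qmax * 0)) :=
    ht.sub ((tendsto_id.mono_left nhdsWithin_le_nhds).const_mul _)
  have h1 := ge_of_tendsto ht2 (b := radialMean Ω (fun z => u z i) x r
    - growthConstant n M * Qmax * r) (by
      filter_upwards [Ioo_mem_nhdsGT hr] with s hs
      exact hm ⟨hs.1, hs.2.trans hrR⟩ ⟨hr, hrR⟩ hs.2.le)
  linarith

theorem radialMean_eq (h : IsMinimizerWithin Ω Q Qmax g u ε) (i : Fin m)
    {x : E n} {r R : ℝ} (hr : 0 < r) (hrR : r < R)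
    (hx : Metric.ball x R ⊆ Ω)
    (hpos : ∀ᵐ z ∂volume.restrict Ω, z ∈ Metric.ball x R → 0 < ‖u z‖) :
    radialMean Ω (fun z => u z i) x r = kernelMass n * preciseVersion Ω u x i := by
  refine le_antisymm ?_ (h.preciseVersion_le i hr hrR hx)
  refine ge_of_tendsto (h.tendsto_radialMean i (hx (Metric.mem_ball_self (hr.trans hrR)))) ?_
  filter_upwards [Ioo_mem_nhdsGT hr] with s hs
  exact h.antitoneOn_radialMean i hx hpos ⟨hs.1, hs.2.trans hrR⟩ ⟨hr, hrR⟩ hs.2.le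

theorem preciseVersion_ae_eq (h : IsMinimizerWithin Ω Q Qmax g u ε) :
    preciseVersion Ω u =ᵐ[volume.restrict Ω] u := by
  have h1 : ∀ i, ∀ᵐ x ∂volume.restrict Ω, preciseVersion Ω u x i = u x i := fun i => by
    filter_upwards [tendsto_radialMean_ae h.isOpen (h.integrableOn i)] with x hx
    exact mul_left_cancel₀ (kernelMass_pos n).ne' (preciseVersion_apply hx)
  filter_upwards [eventually_all.2 h1] with x hx
  ext i
  exact hx i

/-- By `preciseVersion_le` and `radialMean_le` the representative differs from the continuous
function `radialMean Ω _ · r / kernelMass n` by a multiple of `r`, locally uniformly, so it is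
continuous. -/
theorem continuousOn_preciseVersion (h : IsMinimizerWithin Ω Q Qmax g u ε) (hn : n ≠ 0) :
    ContinuousOn (preciseVersion Ω u) Ω := by
  obtain ⟨S, M, hS0, hM0, hS, hM⟩ := exists_potential_bounds n
  obtain ⟨R₀, hR₀, hd⟩ := exists_competitorDistance_lt hn Qmax S M h.eps_pos
  set K := growthConstant n M * Qmax with hK
  have hK0 : 0 ≤ K := mul_nonneg (growthConstant_nonneg n hM0) h.pos.le
  have hc := kernelMass_pos n
  refine h.isOpen.continuousOn_iff.2 fun {x₀} hx₀ => ?_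
  have hcomp : ∀ i, ContinuousAt (fun x => preciseVersion Ω u x i) x₀ := fun i => by
    obtain ⟨R₁, hR₁, hR₁Ω⟩ := Metric.isOpen_iff.1 h.isOpen x₀ hx₀
    set R := min (R₁ / 2) R₀ with hR
    have hR0 : 0 < R := lt_min (half_pos hR₁) hR₀
    refine continuousAt_of_locally_uniform_approx_of_continuousAt fun U hU => ?_
    obtain ⟨η, hη, hηU⟩ := Metric.mem_uniformity_dist.1 hU
    obtain ⟨r, hr, hrR, hrη⟩ : ∃ r, 0 < r ∧ r < R ∧ K * r < kernelMass n * η := by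
      -- `K + 1` replaces `K` in the denominator because `K` may vanish as far as is known here.
      refine ⟨min (R / 2) (kernelMass n * η / (2 * (K + 1))), by positivity, ?_, ?_⟩
      · exact (min_le_left _ _).trans_lt (half_lt_self hR0)
      · have h1 : min (R / 2) (kernelMass n * η / (2 * (K + 1)))
          ≤ kernelMass n * η / (2 * (K + 1)) := min_le_right _ _
        calc K * min (R / 2) (kernelMass n * η / (2 * (K + 1)))
            ≤ (K + 1) * (kernelMass n * η / (2 * (K + 1))) := by gcongr; linarith
          _ = kernelMass n * η / 2 := by field_simp
          _ < kernelMass n * η := half_lt_self (by positivity)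
    refine ⟨Metric.ball x₀ (R₁ / 2), Metric.ball_mem_nhds _ (half_pos hR₁),
      fun x => radialMean Ω (fun z => u z i) x r / kernelMass n,
      ((continuous_radialMean (h.integrableOn i) r).div_const _).continuousAt, fun y hy => hηU ?_⟩
    have hyR : Metric.ball y R ⊆ Ω := by
      refine (Metric.ball_subset_ball' ?_).trans hR₁Ω
      have h1 : R ≤ R₁ / 2 := min_le_left _ _
      have h2 := Metric.mem_ball.1 hy
      linarith
    have a1 := h.preciseVersion_le i hr hrR hyR
    have a2 := h.radialMean_le i hS0 hM0 hS hM hd hr hrR (min_le_right _ _) hyR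
    rw [← hK] at a2
    rw [Real.dist_eq, abs_sub_lt_iff]
    constructor
    · have : preciseVersion Ω u y i ≤ radialMean Ω (fun z => u z i) y r / kernelMass n := by
        rw [le_div_iff₀' hc]
        exact a1
      linarith
    · rw [sub_lt_iff_lt_add, div_lt_iff₀' hc]
      linarith
  have : ContinuousAt (fun x => WithLp.toLp 2 fun i => preciseVersion Ω u x i) x₀ :=
    (PiLp.continuous_toLp 2 _).continuousAt.comp (continuousAt_pi.2 hcomp)
  exact this

theorem isPreciseVersion (h : IsMinimizerWithin Ω Q Qmax g u ε) (hn : n ≠ 0) :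
    IsPreciseVersion Ω u (preciseVersion Ω u) := by
  have hae := h.preciseVersion_ae_eq
  refine ⟨hae, fun x hx => ?_⟩
  have hcont : ContinuousAt (preciseVersion Ω u) x :=
    (h.continuousOn_preciseVersion hn).continuousAt (h.isOpen.mem_nhds hx)
  rw [Metric.tendsto_nhds]
  intro η hη
  obtain ⟨R, hR, hRΩ⟩ := Metric.isOpen_iff.1 h.isOpen x hx
  obtain ⟨δ, hδ, hδη⟩ := Metric.continuousAt_iff.1 hcont (η / 2) (half_pos hη)
  filter_upwards [Ioo_mem_nhdsGT (lt_min hR hδ)] with ρ hρ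
  have hρΩ : Metric.ball x ρ ⊆ Ω :=
    (Metric.ball_subset_ball (hρ.2.le.trans (min_le_left _ _))).trans hRΩ
  have hui : IntegrableOn u Ω := by
    have : MemLp u 1 (volume.restrict Ω) :=
      MemLp.of_eval_piLp fun i => memLp_one_iff_integrable.2 (h.integrableOn i)
    exact memLp_one_iff_integrable.1 this
  -- On a small ball `u` agrees a.e. with a function taking values in this closed convex ball, so
  -- its average lies there too.
  have hmem : ⨍ y in Metric.ball x ρ, u y ∈ Metric.closedBall (preciseVersion Ω u x) (η / 2) := by
    refine (convex_closedBall _ _).set_average_mem Metric.isClosed_closedBall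
      (Metric.measure_ball_pos _ _ hρ.1).ne' measure_ball_lt_top.ne ?_ (hui.mono_set hρΩ)
    filter_upwards [ae_restrict_of_ae_restrict_of_subset hρΩ hae,
      ae_restrict_mem Metric.isOpen_ball.measurableSet] with y hy hyρ
    rw [← hy, Metric.mem_closedBall]
    exact (hδη ((Metric.mem_ball.1 hyρ).trans (hρ.2.trans_le (min_le_right _ _)))).le
  exact (Metric.mem_closedBall.1 hmem).trans_lt (half_lt_self hη)

end IsMinimizerWithin

end PreciseVersion

/-! ### Linear growth at zeros and the Lipschitz estimate -/

section Lipschitz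

variable {Ω : Set (E n)} {Q : E n → ℝ} {Qmax ε : ℝ} {g u : E n → E m}

/-- The radius `6/7` is the quotient of `3/4` and `7/8`: a kernel dilated to radius `7R/8` must be
bounded below on the ball of radius `3R/4`. -/
theorem exists_kernel_constants (n : ℕ) : ∃ B κ L : ℝ, 0 ≤ B ∧ 0 < κ ∧ 0 ≤ L ∧
    (∀ y : E n, kernel y ≤ B) ∧ (∀ y : E n, ‖y‖ ≤ 6 / 7 → κ ≤ kernel y) ∧
    ∀ y y' : E n, |kernel y - kernel y'| ≤ L * ‖y - y'‖ := by
  obtain ⟨B, hB0, hB⟩ := exists_bound_of_eq_zero (n := n) contDiff_kernel.continuous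
    (fun y => kernel_eq_zero)
  obtain ⟨y₀, hy₀, hmin⟩ := (isCompact_closedBall (0 : E n) (6 / 7)).exists_isMinOn
    ⟨0, by simp; norm_num⟩ contDiff_kernel.continuous.continuousOn
  obtain ⟨L, hL⟩ := ContDiff.lipschitzWith_of_hasCompactSupport
    (hasCompactSupport_of_eq_zero fun y => kernel_eq_zero (n := n)) contDiff_kernel (by simp)
  refine ⟨B, kernel y₀, L, hB0, kernel_pos ?_, L.2, fun y => (le_abs_self _).trans (hB y),
    fun y hy => hmin (mem_closedBall_zero_iff.2 hy), fun y y' => ?_⟩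
  · exact (mem_closedBall_zero_iff.1 hy₀).trans_lt (by norm_num)
  · have := hL.dist_le_mul y y'
    rwa [Real.dist_eq, dist_eq_norm] at this

theorem norm_le_sum_abs (v : E m) : ‖v‖ ≤ ∑ i, |v i| := by
  have hv : v = ∑ j, v j • (EuclideanSpace.single j (1 : ℝ) : E m) := by
    have := (EuclideanSpace.basisFun (Fin m) ℝ).sum_repr v
    simpa using this.symm
  conv_lhs => rw [hv]
  refine (norm_sum_le _ _).trans (Finset.sum_le_sum fun j _ => ?_)
  rw [norm_smul, PiLp.norm_single]
  simp

/-- A bound by `C Qmax R^(n+1)` for the integral of `f` near a zero of the minimizer. -/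
theorem setIntegral_le_of_radialMean_le {f : E n → ℝ} (hf : IntegrableOn f Ω)
    (hf0 : ∀ᵐ z ∂volume.restrict Ω, 0 ≤ f z) {κ : ℝ} (hκ : 0 < κ)
    (hκk : ∀ y : E n, ‖y‖ ≤ 6 / 7 → κ ≤ kernel y) {z : E n} {R a : ℝ} (hR : 0 < R)
    (hz : Metric.ball z R ⊆ Ω) (h : radialMean Ω f z (7 / 8 * R) ≤ a * (7 / 8 * R))
    (ha : 0 ≤ a) :
    ∫ y in Metric.ball z (3 / 4 * R), f y ≤ a / κ * R ^ (n + 1) := by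
  -- Strictly below `R`, as the growth bound requires, and strictly above `3R/4`, since the kernel
  -- vanishes at the edge of its support.
  set r := 7 / 8 * R with hr
  have hr0 : 0 < r := by positivity
  have hsub : Metric.ball z (3 / 4 * R) ⊆ Ω :=
    (Metric.ball_subset_ball (by linarith)).trans hz
  have hki := integrableOn_dilate_mul contDiff_kernel.continuous (fun y => kernel_eq_zero) hf z r
  have h1 : κ * ∫ y in Metric.ball z (3 / 4 * R), f y ≤ ∫ y in Ω, dilate kernel z r y * f y := by
    rw [← integral_const_mul]
    refine le_trans (integral_mono_ae ((hf.mono_set hsub).const_mul κ) (hki.mono_set hsub) ?_)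
      (setIntegral_mono_set hki ?_ hsub.eventuallyLE)
    · filter_upwards [ae_restrict_of_ae_restrict_of_subset hsub hf0,
        ae_restrict_mem Metric.isOpen_ball.measurableSet] with y hy hyb
      refine mul_le_mul_of_nonneg_right (hκk _ ?_) hy
      rw [norm_smul, norm_inv, Real.norm_of_nonneg hr0.le, ← div_eq_inv_mul, div_le_iff₀ hr0,
        ← dist_eq_norm, hr]
      have := Metric.mem_ball.1 hyb
      linarith
    · filter_upwards [hf0] with y hy
      exact mul_nonneg (kernel_nonneg _) hy
  have hrn : 0 < r ^ n := by positivity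
  rw [radialMean, inv_mul_le_iff₀ hrn] at h
  have hrR : r ^ (n + 1) ≤ R ^ (n + 1) := by
    gcongr
    linarith
  rw [show a / κ * R ^ (n + 1) = a * R ^ (n + 1) / κ by ring, le_div_iff₀' hκ]
  calc κ * ∫ y in Metric.ball z (3 / 4 * R), f y ≤ r ^ n * (a * r) := h1.trans h
    _ = a * r ^ (n + 1) := by ring
    _ ≤ a * R ^ (n + 1) := by gcongr

theorem abs_integral_mul_le_of_ball {f k : E n → ℝ} (hf : IntegrableOn f Ω)
    (hΩ : MeasurableSet Ω) (hf0 : ∀ᵐ z ∂volume.restrict Ω, 0 ≤ f z) {z : E n} {R b : ℝ}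
    (hz : Metric.ball z R ⊆ Ω) (hk0 : ∀ y ∉ Metric.ball z R, k y = 0) (hk : ∀ y, |k y| ≤ b) :
    |∫ y in Ω, k y * f y| ≤ b * ∫ y in Metric.ball z R, f y := by
  have e : ∫ y in Ω, k y * f y = ∫ y in Metric.ball z R, k y * f y :=
    setIntegral_eq_of_subset_of_forall_sdiff_eq_zero hΩ hz
      fun y hy => by rw [hk0 y hy.2, zero_mul]
  rw [e, ← integral_const_mul, ← Real.norm_eq_abs]
  refine norm_integral_le_of_norm_le ((hf.mono_set hz).const_mul b) ?_
  filter_upwards [ae_restrict_of_ae_restrict_of_subset hz hf0] with y hy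
  rw [norm_mul, Real.norm_of_nonneg hy]
  exact mul_le_mul_of_nonneg_right (hk y) hy

namespace IsMinimizerWithin

/-- `a` bounds the derivative in `r` of the radial means for all radii up to `R₀`. -/
def HasGrowth (Ω : Set (E n)) (u : E n → E m) (a R₀ : ℝ) : Prop :=
  ∀ (i : Fin m) (x : E n) (r R : ℝ), 0 < r → r < R → R ≤ R₀ → Metric.ball x R ⊆ Ω →
    radialMean Ω (fun z => u z i) x r ≤ kernelMass n * preciseVersion Ω u x i + a * r

theorem setIntegral_le (h : IsMinimizerWithin Ω Q Qmax g u ε) {a R₀ : ℝ} (ha : 0 ≤ a)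
    (hg : HasGrowth Ω u a R₀) {κ : ℝ} (hκ : 0 < κ)
    (hκk : ∀ y : E n, ‖y‖ ≤ 6 / 7 → κ ≤ kernel y) (i : Fin m) {z : E n} {R : ℝ} (hR : 0 < R)
    (hR₀ : R ≤ R₀) (hz : Metric.ball z R ⊆ Ω) (hz0 : preciseVersion Ω u z = 0) :
    ∫ y in Metric.ball z (3 / 4 * R), u y i ≤ a / κ * R ^ (n + 1) := by
  refine setIntegral_le_of_radialMean_le (h.integrableOn i) (h.nonneg i) hκ hκk hR hz ?_ ha
  have := hg i z (7 / 8 * R) R (by positivity) (by linarith) hR₀ hz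
  simpa [hz0] using this

/-- The sub-mean value property at radius `R/5` about `y` bounds the value by an integral over
`B_{3R/4}(z)`, which is controlled by the growth of the means at the zero `z`. -/
theorem preciseVersion_le_of_zero (h : IsMinimizerWithin Ω Q Qmax g u ε) {a R₀ : ℝ} (ha : 0 ≤ a)
    (hg : HasGrowth Ω u a R₀) {B κ : ℝ} (hB0 : 0 ≤ B) (hB : ∀ y : E n, kernel y ≤ B) (hκ : 0 < κ)
    (hκk : ∀ y : E n, ‖y‖ ≤ 6 / 7 → κ ≤ kernel y) (i : Fin m) {z : E n} {R : ℝ} (hR : 0 < R)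
    (hR₀ : R ≤ R₀) (hz : Metric.ball z R ⊆ Ω) (hz0 : preciseVersion Ω u z = 0) {y : E n}
    (hy : dist y z ≤ R / 2) :
    kernelMass n * preciseVersion Ω u y i ≤ 5 ^ n * B / κ * a * R := by
  have hball : Metric.ball y (R / 4) ⊆ Metric.ball z (3 / 4 * R) :=
    Metric.ball_subset_ball' (by linarith)
  have hzΩ : Metric.ball z (3 / 4 * R) ⊆ Ω := (Metric.ball_subset_ball (by linarith)).trans hz
  have h1 := h.preciseVersion_le i (r := R / 5) (R := R / 4) (by positivity) (by linarith)
    (hball.trans hzΩ)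
  have h2 := h.setIntegral_le ha hg hκ hκk i hR hR₀ hz hz0
  have h3 := abs_integral_mul_le_of_ball (k := dilate kernel y (R / 5)) (b := B) (h.integrableOn i)
    h.isOpen.measurableSet (h.nonneg i) hzΩ
    (fun w hw => dilate_eq_zero (fun y => kernel_eq_zero) (by positivity)
      fun hw' => hw (hball (Metric.ball_subset_ball (by linarith) hw')))
    (fun w => (abs_of_nonneg (kernel_nonneg _)).trans_le (hB _))
  refine h1.trans ?_
  rw [radialMean]
  calc ((R / 5) ^ n)⁻¹ * ∫ w in Ω, dilate kernel y (R / 5) w * u w i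
      ≤ ((R / 5) ^ n)⁻¹ * (B * (a / κ * R ^ (n + 1))) := by
        refine mul_le_mul_of_nonneg_left ?_ (by positivity)
        exact (le_abs_self _).trans (h3.trans (mul_le_mul_of_nonneg_left h2 hB0))
    _ = 5 ^ n * B / κ * a * R := by
        rw [div_pow]
        field_simp
        ring

/-- Off the zero set the components equal their means, so both values are kernel integrals at the
same radius `s`. Their difference is at most the Lipschitz constant of the kernel times `dist y y' /
s` times the integral over `B_{3R/4}(z)`, after normalization by `s^n`. -/
theorem abs_preciseVersion_sub_le (h : IsMinimizerWithin Ω Q Qmax g u ε) {a R₀ : ℝ} (ha : 0 ≤ a)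
    (hg : HasGrowth Ω u a R₀) {κ L : ℝ} (hκ : 0 < κ)
    (hκk : ∀ y : E n, ‖y‖ ≤ 6 / 7 → κ ≤ kernel y) (hL0 : 0 ≤ L)
    (hL : ∀ y y' : E n, |kernel y - kernel y'| ≤ L * ‖y - y'‖) (i : Fin m) {z : E n} {R : ℝ}
    (hR : 0 < R) (hR₀ : R ≤ R₀) (hz : Metric.ball z R ⊆ Ω) (hz0 : preciseVersion Ω u z = 0)
    {y y' : E n} {ρ : ℝ} (hρ : 0 < ρ) (hRρ : R ≤ 12 * ρ)
    (hyz : Metric.ball y (ρ / 2) ⊆ Metric.ball z (3 / 4 * R)) (hyΩ : Metric.ball y ρ ⊆ Ω)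
    (hpos : ∀ w ∈ Metric.ball y ρ, preciseVersion Ω u w ≠ 0) (hyy : dist y y' ≤ ρ / 4) :
    kernelMass n * |preciseVersion Ω u y i - preciseVersion Ω u y' i|
      ≤ 96 ^ (n + 1) * L / κ * a * dist y y' := by
  set s := ρ / 8 with hs
  have hs0 : 0 < s := by positivity
  have hzΩ : Metric.ball z (3 / 4 * R) ⊆ Ω := (Metric.ball_subset_ball (by linarith)).trans hz
  have hb1 : Metric.ball y (ρ / 4) ⊆ Metric.ball y (ρ / 2) :=
    Metric.ball_subset_ball (by linarith)
  have hb2 : Metric.ball y' (ρ / 4) ⊆ Metric.ball y (ρ / 2) :=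
    Metric.ball_subset_ball' (by rw [dist_comm]; linarith)
  have hb3 : Metric.ball y (ρ / 2) ⊆ Metric.ball y ρ := Metric.ball_subset_ball (by linarith)
  have hae : ∀ᵐ w ∂volume.restrict Ω, w ∈ Metric.ball y ρ → 0 < ‖u w‖ := by
    filter_upwards [h.preciseVersion_ae_eq] with w hw hwy
    rw [← hw]
    exact norm_pos_iff.2 (hpos w hwy)
  have e1 := h.radialMean_eq i hs0 (R := ρ / 4) (by linarith) ((hb1.trans hb3).trans hyΩ)
    (hae.mono fun w hw hw' => hw (hb3 (hb1 hw')))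
  have e2 := h.radialMean_eq i hs0 (R := ρ / 4) (by linarith) ((hb2.trans hb3).trans hyΩ)
    (hae.mono fun w hw hw' => hw (hb3 (hb2 hw')))
  have i1 := integrableOn_dilate_mul contDiff_kernel.continuous (fun y => kernel_eq_zero)
    (h.integrableOn i) y s
  have i2 := integrableOn_dilate_mul contDiff_kernel.continuous (fun y => kernel_eq_zero)
    (h.integrableOn i) y' s
  have hkey := abs_integral_mul_le_of_ball (b := L * (s⁻¹ * dist y y'))
    (k := fun w => dilate kernel y s w - dilate kernel y' s w) (h.integrableOn i)
    h.isOpen.measurableSet (h.nonneg i) hzΩ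
    (fun w hw => by
      have hw1 : w ∉ Metric.ball y s := fun hw' =>
        hw (hyz (hb1 (Metric.ball_subset_ball (by linarith) hw')))
      have hw2 : w ∉ Metric.ball y' s := fun hw' =>
        hw (hyz (hb2 (Metric.ball_subset_ball (by linarith) hw')))
      rw [dilate_eq_zero (fun y => kernel_eq_zero) hs0 hw1,
        dilate_eq_zero (fun y => kernel_eq_zero) hs0 hw2, sub_zero])
    (fun w => by
      refine (hL _ _).trans (mul_le_mul_of_nonneg_left (le_of_eq ?_) hL0)
      rw [← smul_sub, norm_smul, norm_inv, Real.norm_of_nonneg hs0.le, sub_sub_sub_cancel_left,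
        dist_eq_norm, norm_sub_rev])
  have h2 := h.setIntegral_le ha hg hκ hκk i hR hR₀ hz hz0
  have hdiff : kernelMass n * (preciseVersion Ω u y i - preciseVersion Ω u y' i)
      = (s ^ n)⁻¹ * ∫ w in Ω, (dilate kernel y s w - dilate kernel y' s w) * u w i := by
    simp only [sub_mul]
    rw [integral_sub i1 i2, mul_sub, mul_sub, ← e1, ← e2]
    rfl
  -- `R ≤ 12 ρ = 96 s`; this turns `R^(n+1)` into the power of `s` that cancels the normalization.
  have hRs : R ^ (n + 1) ≤ (96 * s) ^ (n + 1) := by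
    gcongr
    linarith
  rw [← abs_of_pos (kernelMass_pos n), ← abs_mul, hdiff, abs_mul, abs_of_pos (by positivity)]
  calc (s ^ n)⁻¹ * |∫ w in Ω, (dilate kernel y s w - dilate kernel y' s w) * u w i|
      ≤ (s ^ n)⁻¹ * (L * (s⁻¹ * dist y y') * (a / κ * (96 * s) ^ (n + 1))) := by
        refine mul_le_mul_of_nonneg_left (hkey.trans ?_) (by positivity)
        refine mul_le_mul_of_nonneg_left (h2.trans ?_) (by positivity)
        gcongr
    _ = 96 ^ (n + 1) * L / κ * a * dist y y' := by
        rw [mul_pow]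
        field_simp
        ring

/-- If some zero lies within `4 dist y y'` of `y`, both values are bounded by the growth estimate.
Otherwise `y'` lies well inside the largest zero-free ball about `y`, and the harmonic estimate
applies. The two alternatives contribute the two summands of the constant. -/
theorem abs_sub_le_of_ball (h : IsMinimizerWithin Ω Q Qmax g u ε) (hn : n ≠ 0) {a R₀ : ℝ}
    (ha : 0 ≤ a) (hg : HasGrowth Ω u a R₀) {B κ L : ℝ} (hB0 : 0 ≤ B)
    (hB : ∀ y : E n, kernel y ≤ B) (hκ : 0 < κ) (hκk : ∀ y : E n, ‖y‖ ≤ 6 / 7 → κ ≤ kernel y)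
    (hL0 : 0 ≤ L) (hL : ∀ y y' : E n, |kernel y - kernel y'| ≤ L * ‖y - y'‖) (i : Fin m)
    {x : E n} {r : ℝ} (hr : 0 < r) (hr₀ : r ≤ R₀) (hx : Metric.ball x r ⊆ Ω)
    (hx0 : preciseVersion Ω u x = 0) {y y' : E n} (hy : y ∈ Metric.ball x (r / 3))
    (hy' : y' ∈ Metric.ball x (r / 3)) :
    kernelMass n * |preciseVersion Ω u y i - preciseVersion Ω u y' i|
      ≤ (60 * (5 ^ n * B / κ) + 96 ^ (n + 1) * L / κ) * a * dist y y' := by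
  have hc := kernelMass_pos n
  set A := 5 ^ n * B / κ with hA
  have hA0 : 0 ≤ A := by positivity
  set D := 96 ^ (n + 1) * L / κ with hD
  have hD0 : 0 ≤ D := by positivity
  rw [Metric.mem_ball] at hy hy'
  have hxΩ : x ∈ Ω := hx (Metric.mem_ball_self hr)
  have hsub : Metric.ball x (r / 3) ⊆ Ω := (Metric.ball_subset_ball (by linarith)).trans hx
  have growth : ∀ q, dist q x < r / 3 → ∀ z, preciseVersion Ω u z = 0 →
      kernelMass n * preciseVersion Ω u q i ≤ A * a * (12 * dist q z) := by
    intro q hq z hz0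
    -- For a remote zero the given zero `x` with `R = r` is used, as `r ≤ 12 dist q z`. For a close
    -- one the ball of radius `3 dist q z` about `z` stays inside `B_r(x)`.
    rcases le_or_gt (r / 12) (dist q z) with ht | ht
    · have h1 := h.preciseVersion_le_of_zero ha hg hB0 hB hκ hκk i hr hr₀ hx hx0 (y := q)
        (by linarith)
      refine h1.trans ?_
      gcongr
      linarith
    · rcases (dist_nonneg (x := q) (y := z)).eq_or_lt with h0 | h0
      · rw [← h0, eq_of_dist_eq_zero h0.symm, hz0]
        simp
      · have hzx : dist z x ≤ dist q z + dist q x := by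
          rw [dist_comm q z]
          exact dist_triangle z q x
        have h1 := h.preciseVersion_le_of_zero ha hg hB0 hB hκ hκk i (z := z) (R := 3 * dist q z)
          (by positivity) (by linarith) ((Metric.ball_subset_ball' (by linarith)).trans hx) hz0
          (y := q) (by linarith)
        refine h1.trans ?_
        gcongr
        norm_num
  by_cases hcase : ∃ z, preciseVersion Ω u z = 0 ∧ z ∈ Ω ∧ dist y z ≤ 4 * dist y y'
  · obtain ⟨z, hz0, -, hz⟩ := hcase
    have g1 := growth y hy z hz0
    have g2 := growth y' hy' z hz0
    have hy'z : dist y' z ≤ 5 * dist y y' := by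
      have := dist_triangle y' y z
      rw [dist_comm y' y] at this
      linarith
    have p1 := h.preciseVersion_nonneg i (hsub (Metric.mem_ball.2 hy))
    have p2 := h.preciseVersion_nonneg i (hsub (Metric.mem_ball.2 hy'))
    have hd0 := dist_nonneg (x := y) (y := y')
    have g3 : A * a * (12 * dist y z) ≤ A * a * (60 * dist y y') :=
      mul_le_mul_of_nonneg_left (by linarith) (by positivity)
    have g4 : A * a * (12 * dist y' z) ≤ A * a * (60 * dist y y') :=
      mul_le_mul_of_nonneg_left (by linarith) (by positivity)
    have g5 : kernelMass n * |preciseVersion Ω u y i - preciseVersion Ω u y' i|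
        ≤ A * a * (60 * dist y y') := by
      rw [← abs_of_pos hc, ← abs_mul, mul_sub, _root_.abs_le]
      have q1 := mul_nonneg hc.le p1
      have q2 := mul_nonneg hc.le p2
      constructor <;> linarith
    have g6 : 0 ≤ D * a * dist y y' := by positivity
    linarith
  · push Not at hcase
    set Z : Set (E n) := {z | z ∈ Ω ∧ preciseVersion Ω u z = 0} with hZ
    have hxZ : x ∈ Z := ⟨hxΩ, hx0⟩
    set ρ := Metric.infDist y Z with hρ
    have hρx : ρ ≤ dist y x := Metric.infDist_le_dist_of_mem hxZ
    have hρτ : 4 * dist y y' ≤ ρ :=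
      (Metric.le_infDist ⟨x, hxZ⟩).2 fun {z} hz => (hcase z hz.2 hz.1).le
    have hyΩ : y ∈ Ω := hsub (Metric.mem_ball.2 hy)
    have hballΩ : Metric.ball y ρ ⊆ Ω := (Metric.ball_subset_ball' (by linarith)).trans hx
    -- For `y = y'` the bound `4 dist y y' ≤ ρ` is void, and positivity comes from continuity at
    -- `y`, where the value is nonzero.
    have hρ0 : 0 < ρ := by
      rcases eq_or_ne y y' with hyy | hyy
      · have hy0 : preciseVersion Ω u y ≠ 0 := fun h0 => by
          have := hcase y h0 hyΩ
          rw [dist_self] at this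
          have := dist_nonneg (x := y) (y := y')
          linarith
        have hev : ∀ᶠ w in 𝓝 y, preciseVersion Ω u w ≠ 0 :=
          ((h.continuousOn_preciseVersion hn).continuousAt
            (h.isOpen.mem_nhds hyΩ)).eventually_ne hy0
        obtain ⟨δ, hδ, hδ'⟩ := Metric.eventually_nhds_iff.1 hev
        refine hδ.trans_le ((Metric.le_infDist ⟨x, hxZ⟩).2 fun {z} hz => ?_)
        by_contra hlt
        rw [not_le, dist_comm] at hlt
        exact hδ' hlt hz.2
      · have := dist_pos.2 hyy
        linarith
    have hpos : ∀ w ∈ Metric.ball y ρ, preciseVersion Ω u w ≠ 0 := fun w hw h0 => by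
      have h1 : ρ ≤ dist y w := Metric.infDist_le_dist_of_mem ⟨hballΩ hw, h0⟩
      rw [Metric.mem_ball, dist_comm] at hw
      linarith
    have key : kernelMass n * |preciseVersion Ω u y i - preciseVersion Ω u y' i|
        ≤ D * a * dist y y' := by
      -- If `ρ ≥ r/12`, the zero `x` and `R = r` satisfy `R ≤ 12 ρ`. Otherwise a zero `z` within
      -- `2ρ` of `y` is taken with `R = 6ρ`; then `2ρ + r/3 + 6ρ < r` keeps its ball inside
      -- `B_r(x)`.
      rcases le_or_gt (r / 12) ρ with hρr | hρr
      · exact h.abs_preciseVersion_sub_le ha hg hκ hκk hL0 hL i hr hr₀ hx hx0 hρ0 (by linarith)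
          (Metric.ball_subset_ball' (by linarith)) hballΩ hpos (by linarith)
      · obtain ⟨z, hz, hzρ⟩ := (Metric.infDist_lt_iff ⟨x, hxZ⟩).1
          (show Metric.infDist y Z < 2 * ρ by linarith)
        have hzx : dist z x ≤ dist y z + dist y x := by
          rw [dist_comm y z]
          exact dist_triangle z y x
        exact h.abs_preciseVersion_sub_le ha hg hκ hκk hL0 hL i (z := z) (R := 6 * ρ)
          (by positivity) (by linarith) ((Metric.ball_subset_ball' (by linarith)).trans hx) hz.2
          hρ0 (by linarith) (Metric.ball_subset_ball' (by linarith)) hballΩ hpos (by linarith)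
    have g6 : 0 ≤ A * a * dist y y' := by positivity
    linarith

end IsMinimizerWithin

/-- The Lipschitz estimate near zeros of minimizers, with a constant depending only on `n`
and `m`. -/
theorem exists_lipschitz_constant (hn : n ≠ 0) (m : ℕ) : ∃ C S M : ℝ, 0 < C ∧ 0 ≤ S ∧ 0 ≤ M ∧
    ∀ (Ω : Set (E n)) (Q : E n → ℝ) (Qmax ε R₀ : ℝ) (g u : E n → E m),
      IsMinimizerWithin Ω Q Qmax g u ε →
      (∀ r, 0 < r → r ≤ R₀ → competitorDistance n Qmax S M r < ε) →
      ∀ (x : E n) (r : ℝ), 0 < r → r ≤ R₀ → Metric.ball x r ⊆ Ω → preciseVersion Ω u x = 0 →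
        lipSeminorm (preciseVersion Ω u) (Metric.ball x (r / 3)) ≤ ENNReal.ofReal (C * Qmax) := by
  obtain ⟨S, M, hS0, hM0, hS, hM⟩ := exists_potential_bounds n
  obtain ⟨B, κ, L, hB0, hκ, hL0, hB, hκk, hL⟩ := exists_kernel_constants n
  have hc := kernelMass_pos n
  have hK := growthConstant_nonneg n hM0
  set D := (60 * (5 ^ n * B / κ) + 96 ^ (n + 1) * L / κ) * growthConstant n M / kernelMass n with hD
  have hD0 : 0 ≤ D := by positivity
  -- The factor `m` comes from summing over the components; the `1` keeps the constant positive, for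
  -- instance when `m = 0`.
  refine ⟨m * D + 1, S, M, by positivity, hS0, hM0, ?_⟩
  intro Ω Q Qmax ε R₀ g u h hd x r hr hr₀ hx hx0
  have hQ := h.pos
  have hg : IsMinimizerWithin.HasGrowth Ω u (growthConstant n M * Qmax) R₀ :=
    fun i x r R hr hrR hR hx => h.radialMean_le i hS0 hM0 hS hM hd hr hrR hR hx
  refine iSup₂_le fun y hy => iSup₂_le fun y' hy' => ENNReal.div_le_of_le_mul ?_
  have hi : ∀ i, |(preciseVersion Ω u y - preciseVersion Ω u y') i| ≤ D * Qmax * dist y y' := by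
    intro i
    have h1 := h.abs_sub_le_of_ball hn (by positivity) hg hB0 hB hκ hκk hL0 hL i hr hr₀ hx hx0 hy hy'
    rw [PiLp.sub_apply]
    have h2 : D * Qmax * dist y y' = (60 * (5 ^ n * B / κ) + 96 ^ (n + 1) * L / κ)
        * (growthConstant n M * Qmax) * dist y y' / kernelMass n := by
      rw [hD]
      ring
    rw [h2, le_div_iff₀' hc]
    exact h1
  have hv : dist (preciseVersion Ω u y) (preciseVersion Ω u y') ≤ (m * D + 1) * Qmax * dist y y' := by
    rw [dist_eq_norm]
    refine (norm_le_sum_abs _).trans ((Finset.sum_le_sum fun i _ => hi i).trans ?_)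
    have h0 : 0 ≤ Qmax * dist y y' := by positivity
    simp only [Finset.sum_const, Finset.card_univ, Fintype.card_fin, nsmul_eq_mul]
    linarith
  rw [edist_dist, edist_dist, ← ENNReal.ofReal_mul (by positivity)]
  exact ENNReal.ofReal_le_ofReal hv

end Lipschitz

/-! ### Absolute and local minimizers, and dimension zero -/

section Minimizers

variable {Ω : Set (E n)} {Q : E n → ℝ} {Qmin Qmax : ℝ} {g u : E n → E m}

theorem competitorDistance_nonneg (n : ℕ) (Qmax S M : ℝ) {r : ℝ} (hr : 0 ≤ r) :
    0 ≤ competitorDistance n Qmax S M r := by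
  unfold competitorDistance
  positivity

theorem competitorDistance_mono (n : ℕ) (Qmax : ℝ) {S M r R : ℝ} (hS : 0 ≤ S) (hM : 0 ≤ M)
    (hr : 0 ≤ r) (hrR : r ≤ R) :
    competitorDistance n Qmax S M r ≤ competitorDistance n Qmax S M R := by
  unfold competitorDistance
  gcongr

theorem ae_abs_le_of_bounds (hQmin : 0 < Qmin)
    (hQ : ∀ᵐ x ∂volume.restrict Ω, Qmin ≤ Q x ∧ Q x ≤ Qmax) :
    ∀ᵐ x ∂volume.restrict Ω, |Q x| ≤ Qmax := by
  filter_upwards [hQ] with x hx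
  rw [abs_of_pos (hQmin.trans_le hx.1)]
  exact hx.2

theorem IsAbsoluteMinimizer.isMinimizerWithin (h : IsAbsoluteMinimizer Ω Q g u) (hΩ : IsOpen Ω)
    (hb : Bornology.IsBounded Ω) (hQm : AEMeasurable Q (volume.restrict Ω)) (hpos : 0 < Qmax)
    (hQ : ∀ᵐ x ∂volume.restrict Ω, |Q x| ≤ Qmax) {ε : ℝ} (hε : 0 < ε) :
    IsMinimizerWithin Ω Q Qmax g u ε :=
  ⟨hΩ, hb, hQm, hpos, hQ, h.1, hε, fun v hv _ => h.2 v hv⟩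

theorem IsLocalMinimizer.exists_isMinimizerWithin (h : IsLocalMinimizer Ω Q g u) (hΩ : IsOpen Ω)
    (hb : Bornology.IsBounded Ω) (hQm : AEMeasurable Q (volume.restrict Ω)) (hpos : 0 < Qmax)
    (hQ : ∀ᵐ x ∂volume.restrict Ω, |Q x| ≤ Qmax) :
    ∃ ε, 0 < ε ∧ IsMinimizerWithin Ω Q Qmax g u ε :=
  let ⟨hA, ε, hε, hle⟩ := h
  ⟨ε, hε, hΩ, hb, hQm, hpos, hQ, hA, hε, hle⟩

theorem isPreciseVersion_self_of_subsingleton [Subsingleton (E n)] (Ω : Set (E n))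
    (u : E n → E m) : IsPreciseVersion Ω u u := by
  refine ⟨Filter.EventuallyEq.rfl, fun x _ => tendsto_const_nhds.congr' ?_⟩
  filter_upwards [self_mem_nhdsWithin] with ρ hρ
  have hu : u = fun _ => u x := funext fun y => congrArg u (Subsingleton.elim y x)
  rw [hu]
  exact (setAverage_const (Metric.measure_ball_pos volume x hρ).ne' measure_ball_lt_top.ne _).symm

theorem lipSeminorm_of_subsingleton [Subsingleton (E n)] (w : E n → E m) (s : Set (E n)) :
    lipSeminorm w s = 0 := by
  refine le_antisymm (iSup₂_le fun y _ => iSup₂_le fun z _ => ?_) bot_le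
  rw [Subsingleton.elim y z]
  simp

end Minimizers

end BernoulliSystem

end

theorem mainTheorem3 (n m : ℕ) :
    ∃ C : ℝ, 0 < C ∧
      ∀ (Ω : Set (BernoulliSystem.E n)) (Q : BernoulliSystem.E n → ℝ) (Qmin Qmax : ℝ)
        (g u : BernoulliSystem.E n → BernoulliSystem.E m),
        IsOpen Ω → IsConnected Ω → Bornology.IsBounded Ω →
        AEMeasurable Q (volume.restrict Ω) →
        0 < Qmin → Qmin ≤ Qmax →
        (∀ᵐ x ∂volume.restrict Ω, Qmin ≤ Q x ∧ Q x ≤ Qmax) →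
        BernoulliSystem.MemH1Vec Ω g →
        (∀ i : Fin m, ∀ᵐ x ∂volume.restrict Ω, 0 ≤ g x i) →
        (BernoulliSystem.IsAbsoluteMinimizer Ω Q g u →
          ∃ w : BernoulliSystem.E n → BernoulliSystem.E m,
            BernoulliSystem.IsPreciseVersion Ω u w ∧
            ∀ (x : BernoulliSystem.E n) (r : ℝ), 0 < r → Metric.ball x r ⊆ Ω → w x = 0 →
              BernoulliSystem.lipSeminorm w (Metric.ball x (r / 3)) ≤
                ENNReal.ofReal (C * Qmax)) ∧
        (BernoulliSystem.IsLocalMinimizer Ω Q g u →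
          ∃ w : BernoulliSystem.E n → BernoulliSystem.E m,
            BernoulliSystem.IsPreciseVersion Ω u w ∧
            ∃ r₀ : ℝ, 0 < r₀ ∧
              ∀ (x : BernoulliSystem.E n) (r : ℝ), 0 < r → r ≤ r₀ →
                Metric.ball x r ⊆ Ω → w x = 0 →
                BernoulliSystem.lipSeminorm w (Metric.ball x (r / 3)) ≤
                  ENNReal.ofReal (C * Qmax)) := by
  -- In dimension zero the space is a single point, and every seminorm vanishes.
  rcases eq_or_ne n 0 with rfl | hn
  · refine ⟨1, one_pos, fun Ω Q Qmin Qmax g u _ _ _ _ _ _ _ _ _ => ⟨fun _ => ?_, fun _ => ?_⟩⟩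
    · exact ⟨u, BernoulliSystem.isPreciseVersion_self_of_subsingleton Ω u, fun x r _ _ _ =>
        (BernoulliSystem.lipSeminorm_of_subsingleton u _).trans_le bot_le⟩
    · exact ⟨u, BernoulliSystem.isPreciseVersion_self_of_subsingleton Ω u, 1, one_pos,
        fun x r _ _ _ _ => (BernoulliSystem.lipSeminorm_of_subsingleton u _).trans_le bot_le⟩
  obtain ⟨C, S, M, hC, hS, hM, key⟩ := BernoulliSystem.exists_lipschitz_constant hn m
  refine ⟨C, hC, fun Ω Q Qmin Qmax g u hΩ _ hb hQm hmin hle hQ _ _ => ⟨fun h => ?_, fun h => ?_⟩⟩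
  · have hmax := hmin.trans_le hle
    have hmw := fun (ε : ℝ) (hε : 0 < ε) =>
      h.isMinimizerWithin hΩ hb hQm hmax (BernoulliSystem.ae_abs_le_of_bounds hmin hQ) hε
    refine ⟨BernoulliSystem.preciseVersion Ω u, (hmw 1 one_pos).isPreciseVersion hn,
      fun x r hr hx hx0 => ?_⟩
    have hε := BernoulliSystem.competitorDistance_nonneg n Qmax S M hr.le
    -- An absolute minimizer minimizes within any distance, so `ε` is taken above the competitor
    -- distance at radius `r`, which by monotonicity dominates that of all smaller radii. Hence `R₀
    -- = r` is allowed.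
    exact key Ω Q Qmax _ r g u (hmw (BernoulliSystem.competitorDistance n Qmax S M r + 1)
      (by linarith)) (fun s hs hsr => lt_add_of_le_of_pos
        (BernoulliSystem.competitorDistance_mono n Qmax hS hM hs.le hsr) one_pos)
      x r hr le_rfl hx hx0
  · obtain ⟨ε, hε, hmw⟩ := h.exists_isMinimizerWithin hΩ hb hQm (hmin.trans_le hle)
      (BernoulliSystem.ae_abs_le_of_bounds hmin hQ)
    -- For a local minimizer `ε` is given, and `r₀` is chosen so that all competitors at smaller
    -- radii stay within it; the constant `C` is unaffected.
    obtain ⟨r₀, hr₀, hd⟩ := BernoulliSystem.exists_competitorDistance_lt hn Qmax S M hε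
    exact ⟨BernoulliSystem.preciseVersion Ω u, hmw.isPreciseVersion hn, r₀, hr₀,
      fun x r hr hrr hx hx0 => key Ω Q Qmax ε r₀ g u hmw hd x r hr hrr hx hx0⟩
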